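/- Let $D\in\{2,4\}$ and let $M$ be a $D$-dimensional smooth manifold (Hausdorff, $\sigma$-compact, without boundary). All spaces of functions, fields, forms and operators below are extended to formal power series in the real deformation parameter $\lambda$. *Twist.* Let $X_\alpha$ be finitely many mutually commuting real vector fields on $M$, let $\Theta=(\Theta^{\alpha\beta})$ be a real antisymmetric matrix, and let $\mathcal F=\exp\big(-\tfrac{i\lambda}{2}\Theta^{\alpha\beta}X_\alpha\otimes X_\beta\big)$ be the corresponding Abelian Drinfeld twist, with $\mathcal F^{-1}=\bar f^\alpha\otimes\bar f_\alpha$. Vector fields act on functions, spinors ($\mathbb C^D$-valued functions, componentwise), vector fields and forms by the Lie derivative. For every bilinear operation $B$ (product, wedge product, contraction $\iota$, and their matrix-valued versions) let $B^\star:=B\circ\mathcal F^{-1}$; this defines $\star$, $\wedge_\star$ and $\iota^\star$. *Gamma matrices.* Let $\gamma_0,\dots,\gamma_{D-1}$ be complex $D\times D$ matrices with $\gamma_a\gamma_b+\gamma_b\gamma_a=2\eta_{ab}$, $\eta=\mathrm{diag}(1,-1,\dots,-1)$, and $\gamma_a^\dagger=\gamma_0\gamma_a\gamma_0$. Put $\gamma^a=\eta^{ab}\gamma_b$,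 $\gamma_{ab}=\frac12[\gamma_a,\gamma_b]$, $\Gamma=\gamma_3:=\gamma_0\gamma_1$ if $D=2$, and $\Gamma=\gamma_5:=i\gamma_0\gamma_1\gamma_2\gamma_3$ if $D=4$. *Cartan geometry.* Let $(V,\Omega)$ be a noncommutative Cartan geometry with $V=V^a\gamma_a$. That is, $V$ and $\Omega$ are matrix-valued one-forms (power series in $\lambda$) with $V^\dagger=\gamma_0V\gamma_0$ and $\Omega^\dagger=-\gamma_0\Omega\gamma_0$; the forms $V^a|_{\lambda=0}$ are a global coframe, which orients $M$; and $\Omega=\omega\gamma_3+\tilde\omega 1$ with $\tilde\omega|_{\lambda=0}=0$ if $D=2$, $\Omega=\frac14\omega^{ab}\gamma_{ab}+i\omega1+\tilde\omega\gamma_5$ with $\omega|_{\lambda=0}=\tilde\omega|_{\lambda=0}=0$ if $D=4$. Let $\mathrm d_\Omega\psi=\mathrm d\psi-\Omega\star\psi$ and $\overline\psi=\psi^\dagger\gamma_0$. *Dirac operators.* 1. $\mathrm D^{\mathrm{AC}}$ (Aschieri–Castellani) is the operator on Dirac fields with $\langle\psi_1,\mathrm D^{\mathrm{AC}}\psi_2\rangle=S(\psi_1,\psi_2)$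 for all $\psi_2$ and all compactly supported $\psi_1$, where for $D=2$ $$\langle\psi_1,\psi_2\rangle=\int_M\mathrm{Tr}\big(\psi_2\star\overline{\psi_1}\star V\wedge_\star V\gamma_3\big),\qquad S(\psi_1,\psi_2)=2i\int_M\mathrm{Tr}\big((\mathrm d_\Omega\psi_2)\star\overline{\psi_1}\wedge_\star V\gamma_3\big),$$ and for $D=4$ $$\langle\psi_1,\psi_2\rangle=i\int_M\mathrm{Tr}\big(\psi_2\star\overline{\psi_1}\star V\wedge_\star V\wedge_\star V\wedge_\star V\gamma_5\big),\qquad S(\psi_1,\psi_2)=-4\int_M\mathrm{Tr}\big((\mathrm d_\Omega\psi_2)\star\overline{\psi_1}\wedge_\star V\wedge_\star V\wedge_\star V\gamma_5\big).$$ 2. $\mathrm D^{\mathrm{contr}}\psi=i\gamma^a\,\iota^\star_{E^\star_a}(\mathrm d_\Omega\psi)$, where the vector fields $E^\star_a$ are defined by $\iota^\star_{E^\star_a}(V^b)=\delta_a^b$. 3. The classical (undeformed) Dirac operator of $(V,\Omega)$ is $\mathrm D_{(0)}\psi=i\gamma^a\big(E_a(\psi)-\Omega_a\psi\big)$, where the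 vector fields $E_a$ are defined by $\iota_{E_a}(V^b)=\delta_a^b$, and $\Omega_a=\iota_{E_a}\Omega$. 4. $\mathrm D^{\mathcal F}\psi=(\bar f^\alpha\blacktriangleright\mathrm D_{(0)})\,\bar f_\alpha(\psi)$, where $X\blacktriangleright P=X\circ P-P\circ X$. Let $\Xi$ be the space of real vector fields and $\mathfrak K=\{X\in\Xi:\mathcal L_XV=0,\ \mathcal L_X\Omega=0\}$ the Killing vector fields. The twist is *semi-Killing* if $\Theta^{\alpha\beta}X_\alpha\otimes X_\beta\in\Xi\otimes\mathfrak K+\mathfrak K\otimes\Xi$. (For $\Theta$ in canonical Darboux form this holds if in each Darboux pair $(X_{2n-1},X_{2n})$ one vector field is Killing.) **Proposition.** If the twist is semi-Killing, then $E_a$, $E_a^\star$ and $\mathrm D^{\mathrm{AC}}$ exist and are unique, and $$\mathrm D^{\mathrm{AC}}=\mathrm D^{\mathrm{contr}}=\mathrm D^{\mathcal F}.$$ If, moreover, all $X_\alpha$ are Killing, then these operators also equal the classical Dirac operator $\mathrm D_{(0)}$. -/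

import Mathlib

open scoped Manifold ContDiff TensorProduct

noncomputable section

namespace TwistedDirac

/-! ## Smooth functions, vector fields and differential forms -/

/-- Complex multiplication is smooth over the reals. -/
instance instContMDiffRingComplex : ContMDiffRing 𝓘(ℝ, ℂ) ∞ ℂ where
  contMDiff_mul := by
    rw [← modelWithCornersSelf_prod, chartedSpaceSelf_prod]
    exact contDiff_mul.contMDiff

section Calculus

variable (k : ℕ) (M : Type*) [TopologicalSpace M] [ChartedSpace (EuclideanSpace ℝ (Fin k)) M]

/-- Complex-valued smooth functions on the `k`-dimensional manifold `M`. -/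
abbrev Fn : Type _ := ContMDiffMap (𝓡 k) 𝓘(ℝ, ℂ) M ℂ ∞

/-- Complex vector fields on `M`, as derivations of the algebra of complex-valued smooth functions.
(A real-linear derivation of this algebra kills the constants, so it is complex linear.) -/
abbrev CVec : Type _ := Derivation ℝ (Fn k M) (Fn k M)

/-- Complex differential forms of degree `p`: alternating function-multilinear maps on complex
vector fields. -/
abbrev Form (p : ℕ) : Type _ := (CVec k M) [⋀^Fin p]→ₗ[Fn k M] (Fn k M)

variable {k M}

/-- A constant function. -/
def cst (c : ℂ) : Fn k M := ContMDiffMap.const c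

/-- Pointwise complex conjugation. -/
def conjFn (f : Fn k M) : Fn k M :=
  ⟨fun x => (starRingEnd ℂ) (f x),
    (Complex.conjCLE : ℂ →L[ℝ] ℂ).contMDiff.comp f.contMDiff⟩

/-- The Lie derivative of a form along a vector field,
`(L_X φ)(Y₁, …, Y_p) = X (φ (Y₁, …, Y_p)) - ∑ i, φ (Y₁, …, [X, Y_i], …, Y_p)`. -/
def lieForm {p : ℕ} (X : CVec k M) (φ : Form k M p) : Form k M p where
  toFun Y := X (φ Y) - ∑ i, φ (Function.update Y i ⁅X, Y i⁆)
  map_update_add' Y i U W := by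
    rename_i inst
    obtain rfl : inst = instDecidableEqFin p := Subsingleton.elim _ _
    rw [← add_sub_add_comm, ← Finset.sum_add_distrib, φ.map_update_add, map_add]
    congr 1
    refine Finset.sum_congr rfl fun j _ => ?_
    rcases eq_or_ne j i with rfl | hj
    · have : ⁅X, U + W⁆ = ⁅X, U⁆ + ⁅X, W⁆ := by
        ext1 g
        simp [Derivation.commutator_apply]
        ring
      simp only [Function.update_self, Function.update_idem]
      rw [this, φ.map_update_add]
    · simp only [Function.update_of_ne hj]
      rw [Function.update_comm hj.symm, φ.map_update_add, Function.update_comm hj,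
        Function.update_comm hj]
  map_update_smul' Y i f U := by
    rename_i inst
    obtain rfl : inst = instDecidableEqFin p := Subsingleton.elim _ _
    have key : ∀ j, φ (Function.update (Function.update Y i (f • U)) j
          ⁅X, Function.update Y i (f • U) j⁆) =
        f • φ (Function.update (Function.update Y i U) j ⁅X, Function.update Y i U j⁆) +
          if j = i then X f • φ (Function.update Y i U) else 0 := by
      intro j
      rcases eq_or_ne j i with rfl | hj
      · have : ⁅X, f • U⁆ = f • ⁅X, U⁆ + X f • U := by
          ext1 g
          simp [Derivation.commutator_apply]
          ring
        simp only [Function.update_self, Function.update_idem, if_true]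
        rw [this, φ.map_update_add, φ.map_update_smul, φ.map_update_smul]
      · simp only [Function.update_of_ne hj, if_neg hj, add_zero]
        rw [Function.update_comm hj.symm, φ.map_update_smul, Function.update_comm hj.symm]
    simp only [key]
    rw [Finset.sum_add_distrib, Finset.sum_ite_eq' Finset.univ i, if_pos (Finset.mem_univ i),
      φ.map_update_smul, ← Finset.smul_sum, smul_sub]
    simp only [smul_eq_mul, Derivation.leibniz]
    ring
  map_eq_zero_of_eq' Y i j hY hij := by
    have h0 : φ Y = 0 := φ.map_eq_zero_of_eq Y hY hij
    have hs : ∑ l, φ (Function.update Y l ⁅X, Y l⁆) = 0 := by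
      rw [← Finset.sum_subset (Finset.subset_univ {i, j}), Finset.sum_pair hij]
      · have : Function.update Y j ⁅X, Y j⁆ =
            Function.update Y i ⁅X, Y i⁆ ∘ Equiv.swap i j := by
          funext l
          rcases eq_or_ne l j with rfl | hj
          · simp [hY]
          · rcases eq_or_ne l i with rfl | hi
            · simp [Function.update_of_ne hij, Function.update_of_ne hij.symm, hY]
            · simp [Function.update_of_ne hj, Function.update_of_ne hi,
                Equiv.swap_apply_of_ne_of_ne hi hj]
        rw [this, φ.map_swap _ hij, add_neg_cancel]
      · intro l _ hl
        simp only [Finset.mem_insert, Finset.mem_singleton, not_or] at hl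
        exact φ.map_eq_zero_of_eq _ (by
          simpa [Function.update_of_ne (Ne.symm hl.1), Function.update_of_ne (Ne.symm hl.2)]
            using hY) hij
    rw [h0, hs, map_zero, sub_zero]

theorem lieForm_add {p : ℕ} (X Y : CVec k M) (φ : Form k M p) :
    lieForm (X + Y) φ = lieForm X φ + lieForm Y φ := by
  ext1 Z
  have h : ∀ i, φ (Function.update Z i ⁅X + Y, Z i⁆) =
      φ (Function.update Z i ⁅X, Z i⁆) + φ (Function.update Z i ⁅Y, Z i⁆) := by
    intro i
    have : ⁅X + Y, Z i⁆ = ⁅X, Z i⁆ + ⁅Y, Z i⁆ := by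
      ext1 g
      simp [Derivation.commutator_apply]
      ring
    rw [this, φ.map_update_add]
  change (X + Y) (φ Z) - ∑ i, φ (Function.update Z i ⁅X + Y, Z i⁆) = (X (φ Z) - _) + (Y (φ Z) - _)
  simp only [h, Finset.sum_add_distrib, Derivation.add_apply]
  ring

theorem lieForm_cst_smul {p : ℕ} (c : ℝ) (X : CVec k M) (φ : Form k M p) :
    lieForm (c • X) φ = (cst (c : ℂ) : Fn k M) • lieForm X φ := by
  ext1 Z
  have hc : ∀ g : Fn k M, c • g = (cst (c : ℂ) : Fn k M) • g := by
    intro g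
    ext x
    exact Complex.real_smul
  have h : ∀ i, φ (Function.update Z i ⁅c • X, Z i⁆) =
      (cst (c : ℂ) : Fn k M) • φ (Function.update Z i ⁅X, Z i⁆) := by
    intro i
    have : ⁅c • X, Z i⁆ = (cst (c : ℂ) : Fn k M) • ⁅X, Z i⁆ := by
      ext1 g
      rw [Derivation.smul_apply, ← hc]
      simp [Derivation.commutator_apply, smul_sub]
    rw [this, φ.map_update_smul]
  change (c • X) (φ Z) - ∑ i, φ (Function.update Z i ⁅c • X, Z i⁆) =
    (cst (c : ℂ) : Fn k M) • (X (φ Z) - ∑ i, φ (Function.update Z i ⁅X, Z i⁆))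
  simp only [h, Derivation.smul_apply, hc, ← Finset.smul_sum, smul_sub]

/-- The wedge product, `(φ ∧ τ)(Y) = ∑ sign(σ) φ(Y_σ(1), …) τ(Y_σ(p+1), …)` over shuffles `σ`. -/
def wedge {p q : ℕ} (φ : Form k M p) (τ : Form k M q) : Form k M (p + q) :=
  ((LinearMap.mul' (Fn k M) (Fn k M)).compAlternatingMap (φ.domCoprod τ)).domDomCongr
    finSumFinEquiv

/-- The differential of a function, `(df)(Y) = Y f`. -/
def dFn (f : Fn k M) : Form k M 1 :=
  AlternatingMap.ofSubsingleton (Fn k M) (CVec k M) (Fn k M) (0 : Fin 1)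
    { toFun := fun Y => Y f
      map_add' := fun _ _ => rfl
      map_smul' := fun _ _ => rfl }

/-- The contraction of a one-form with a vector field. -/
def contract (v : CVec k M) (φ : Form k M 1) : Fn k M := φ fun _ => v

theorem mdiffAt (f : Fn k M) (x : M) : MDifferentiableAt (𝓡 k) 𝓘(ℝ, ℂ) f x :=
  f.contMDiff.mdifferentiable (by simp) x

end Calculus

section RealFields

variable (k : ℕ) (M : Type*) [TopologicalSpace M] [ChartedSpace (EuclideanSpace ℝ (Fin k)) M]
  [IsManifold (𝓡 k) ∞ M]

/-- Real smooth vector fields: smooth sections of the tangent bundle. -/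
abbrev RVec : Type _ :=
  ContMDiffSection (𝓡 k) (EuclideanSpace ℝ (Fin k)) ∞ (TangentSpace (𝓡 k) : M → Type _)

variable {k M}

/-- The function `X f` for a real vector field `X`. -/
def RVec.apply (X : RVec k M) (f : Fn k M) : Fn k M :=
  ⟨fun x => mfderiv (𝓡 k) 𝓘(ℝ, ℂ) f x (X x), by
    have h1 : ContMDiff (𝓡 k) 𝓘(ℝ, ℂ).tangent ∞
        (fun x : M => tangentMap (𝓡 k) 𝓘(ℝ, ℂ) f ⟨x, X x⟩) :=
      (f.contMDiff.contMDiff_tangentMap (m := ∞) (by simp)).comp X.contMDiff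
    exact contMDiff_snd_tangentBundle_modelSpace ℂ 𝓘(ℝ, ℂ) |>.comp h1⟩

/-- A real vector field acts on complex-valued functions as a derivation. -/
def RVec.toCVec (X : RVec k M) : CVec k M :=
  Derivation.mk'
    { toFun := X.apply
      map_add' := fun f g => by
        ext x
        change mfderiv (𝓡 k) 𝓘(ℝ, ℂ) (⇑f + ⇑g) x (X x) = _
        rw [mfderiv_add (mdiffAt f x) (mdiffAt g x)]
        rfl
      map_smul' := fun c f => by
        ext x
        change mfderiv (𝓡 k) 𝓘(ℝ, ℂ) (c • ⇑f) x (X x) = _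
        rw [const_smul_mfderiv (mdiffAt f x)]
        rfl }
    (fun f g => by
      ext x
      change mfderiv (𝓡 k) 𝓘(ℝ, ℂ) (⇑f * ⇑g) x (X x) = _
      rw [((mdiffAt f x).hasMFDerivAt.mul (mdiffAt g x).hasMFDerivAt).mfderiv]
      rfl)

theorem RVec.toCVec_add (X Y : RVec k M) : (X + Y).toCVec = X.toCVec + Y.toCVec := by
  ext f x
  exact (mfderiv (𝓡 k) 𝓘(ℝ, ℂ) f x).map_add (X x) (Y x)

theorem RVec.toCVec_smul (c : ℝ) (X : RVec k M) : (c • X).toCVec = c • X.toCVec := by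
  ext f x
  exact (mfderiv (𝓡 k) 𝓘(ℝ, ℂ) f x).map_smul c (X x)

open Classical in
/-- The value `φ_x(v₁, …, v_p)` of a form on real tangent vectors at a point, computed by extending
the tangent vectors to smooth vector fields (the result does not depend on the extension). -/
def evalForm {p : ℕ} (φ : Form k M p) (x : M) (v : Fin p → TangentSpace (𝓡 k) x) : ℂ :=
  if h : ∃ Y : Fin p → RVec k M, ∀ i, Y i x = v i then φ (fun i => (h.choose i).toCVec) x else 0

end RealFields

/-! ## The Abelian twist and its star products -/

section Twist

variable (k : ℕ) (M : Type*) [TopologicalSpace M] [ChartedSpace (EuclideanSpace ℝ (Fin k)) M]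
  [IsManifold (𝓡 k) ∞ M]

/-- The data of an Abelian Drinfeld twist `exp (-(iλ/2) ∑ Θ^{αβ} X_α ⊗ X_β)`: a real antisymmetric
matrix `Θ` and mutually commuting real vector fields `X_α`. -/
structure AbelianTwist where
  m : ℕ
  Θ : Matrix (Fin m) (Fin m) ℝ
  antisymm : Θ.transpose = -Θ
  X : Fin m → RVec k M
  comm : ∀ α β, ⁅(X α).toCVec, (X β).toCVec⁆ = 0

/-- Formal power series in the deformation parameter `λ` with coefficients in `W`. -/
abbrev Formal (W : Type*) : Type _ := ℕ → W

variable {k M}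

namespace AbelianTwist

variable (F : AbelianTwist k M) {U W Z : Type*} [AddCommMonoid Z] [Module (Fn k M) Z]
  (actU : CVec k M → U → U) (actW : CVec k M → W → W) (B : U → W → Z)

/-- `B ((∑ Θ^{αβ} X_α ⊗ X_β)^r (u ⊗ w))`. -/
def iter : ℕ → U → W → Z
  | 0, u, w => B u w
  | r + 1, u, w =>
      ∑ α, ∑ β, (cst (F.Θ α β : ℂ) : Fn k M) •
        iter r (actU (F.X α).toCVec u) (actW (F.X β).toCVec w)

/-- The deformation `B (ℱ⁻¹ (u ⊗ w))` of a bilinear operation `B`, extended to formal power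
series; here `ℱ⁻¹ = ∑_r (λ^r / r!) (i/2)^r (∑ Θ^{αβ} X_α ⊗ X_β)^r`, and `actU`, `actW` are the
actions of vector fields on the arguments of `B`. -/
def star (u : Formal U) (w : Formal W) : Formal Z := fun n =>
  ∑ p ∈ Finset.HasAntidiagonal.antidiagonal n, ∑ q ∈ Finset.HasAntidiagonal.antidiagonal p.2,
    (cst ((Complex.I / 2) ^ p.1 / (p.1.factorial : ℂ)) : Fn k M) •
      F.iter actU actW B p.1 (u q.1) (w q.2)

end AbelianTwist

end Twist

/-! ## Spinors and matrix-valued forms; the spinor space is `ℂ^k`, which is the right one for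
`k = 2` and `k = 4` -/

section Spinors

variable (k : ℕ) (M : Type*) [TopologicalSpace M] [ChartedSpace (EuclideanSpace ℝ (Fin k)) M]

/-- Dirac fields. -/
abbrev Spinor : Type _ := Fin k → Fn k M

/-- Spinor-valued one-forms. -/
abbrev SpinorForm : Type _ := Fin k → Form k M 1

/-- Matrix-valued functions. -/
abbrev MatFn : Type _ := Fin k → Fin k → Fn k M

/-- Matrix-valued forms. -/
abbrev MatForm (p : ℕ) : Type _ := Fin k → Fin k → Form k M p

variable {k M}

/-- Vector fields act on spinors by componentwise derivatives. -/
def lieSpinor (X : CVec k M) (ψ : Spinor k M) : Spinor k M := fun i => X (ψ i)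

/-- Componentwise Lie derivative of spinor-valued one-forms. -/
def lieSpinorForm (X : CVec k M) (θ : SpinorForm k M) : SpinorForm k M := fun i => lieForm X (θ i)

/-- Componentwise derivative of matrix-valued functions. -/
def lieMatFn (X : CVec k M) (A : MatFn k M) : MatFn k M := fun i j => X (A i j)

/-- Componentwise Lie derivative of matrix-valued forms. -/
def lieMatForm {p : ℕ} (X : CVec k M) (A : MatForm k M p) : MatForm k M p :=
  fun i j => lieForm X (A i j)

/-- Lie derivative of vector fields. -/
def lieVec (X Y : CVec k M) : CVec k M := ⁅X, Y⁆

/-- The adjoint action of vector fields on operators on spinors. -/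
def lieOp (X : CVec k M) (D : Spinor k M → Spinor k M) : Spinor k M → Spinor k M :=
  fun ψ => lieSpinor X (D ψ) - D (lieSpinor X ψ)

/-- Column times row, `ψ χ`. -/
def outer (ψ χ : Spinor k M) : MatFn k M := fun i j => ψ i * χ j

/-- Column of one-forms times row of functions, `θ χ`. -/
def outerForm (θ : SpinorForm k M) (χ : Spinor k M) : MatForm k M 1 := fun i j => χ j • θ i

/-- Matrix of functions times matrix of one-forms. -/
def mulMatForm (m : MatFn k M) (A : MatForm k M 1) : MatForm k M 1 :=
  fun i j => ∑ l, m i l • A l j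

/-- Wedge product of matrix-valued forms. -/
def wedgeMat {p q : ℕ} (A : MatForm k M p) (C : MatForm k M q) : MatForm k M (p + q) :=
  fun i j => ∑ l, wedge (A i l) (C l j)

/-- Matrix of one-forms times column of functions, `A ψ`. -/
def mulSpinor (A : MatForm k M 1) (ψ : Spinor k M) : SpinorForm k M :=
  fun i => ∑ l, ψ l • A i l

/-- Contraction of a spinor-valued one-form with a vector field. -/
def contractSpinor (v : CVec k M) (θ : SpinorForm k M) : Spinor k M := fun i => contract v (θ i)

/-- `Tr (A Γ)` for a constant matrix `Γ`. -/
def traceMul {p : ℕ} (A : MatForm k M p) (Γ : Matrix (Fin k) (Fin k) ℂ) : Form k M p :=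
  ∑ i, ∑ l, (cst (Γ l i) : Fn k M) • A i l

/-- The constant matrix `Γ` applied to a spinor. -/
def constMul (Γ : Matrix (Fin k) (Fin k) ℂ) (ψ : Spinor k M) : Spinor k M :=
  fun i => ∑ j, cst (Γ i j) * ψ j

end Spinors

/-! ## Integration of top forms -/

section Integration

variable {k : ℕ} {M : Type*} [TopologicalSpace M] [ChartedSpace (EuclideanSpace ℝ (Fin k)) M]
  [IsManifold (𝓡 k) ∞ M] [T2Space M] [SigmaCompactSpace M]

/-- A smooth partition of unity subordinate to the chart domains. -/
def chartPartition (k : ℕ) (M : Type*) [TopologicalSpace M]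
    [ChartedSpace (EuclideanSpace ℝ (Fin k)) M] [IsManifold (𝓡 k) ∞ M] [T2Space M]
    [SigmaCompactSpace M] : SmoothPartitionOfUnity M (𝓡 k) M Set.univ :=
  (SmoothPartitionOfUnity.exists_isSubordinate_chartAt_source (𝓡 k) M).choose

/-- The coordinate vectors of the chart at `p`, at the point with coordinates `y`. -/
def coordVec (p : M) (y : EuclideanSpace ℝ (Fin k)) (i : Fin k) :
    TangentSpace (𝓡 k) ((extChartAt (𝓡 k) p).symm y) :=
  mfderiv 𝓘(ℝ, EuclideanSpace ℝ (Fin k)) (𝓡 k) (extChartAt (𝓡 k) p).symm y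
    (EuclideanSpace.single i (1 : ℝ))

/-- The sign of a chart with respect to the orientation for which the coframe `e` is positive. -/
def chartSign (e : Fin k → Form k M 1) (p : M) (y : EuclideanSpace ℝ (Fin k)) : ℝ :=
  Real.sign (Matrix.det (Matrix.of fun a b : Fin k =>
    (evalForm (e a) ((extChartAt (𝓡 k) p).symm y) fun _ => coordVec p y b).re))

/-- The integral of a (compactly supported) top form over `M`, oriented by the coframe `e`: the
form is split by the partition of unity and integrated in the charts. -/
def integral (e : Fin k → Form k M 1) (φ : Form k M k) : ℂ :=
  ∑ᶠ p : M, ∫ y in (extChartAt (𝓡 k) p).target,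
    ((chartPartition k M p ((extChartAt (𝓡 k) p).symm y) * chartSign e p y : ℝ) : ℂ) *
      evalForm φ ((extChartAt (𝓡 k) p).symm y) (coordVec p y)

end Integration

/-! ## Clifford algebra conventions in dimensions 2 and 4 -/

/-- The two spacetime dimensions `D = 2` and `D = 4`. -/
inductive SpacetimeDim
  | two
  | four

namespace SpacetimeDim

/-- The number of space dimensions. -/
def spatial : SpacetimeDim → ℕ
  | two => 1
  | four => 3

/-- The spacetime dimension `D`, which is also the spinor dimension. -/
abbrev dim (δ : SpacetimeDim) : ℕ := δ.spatial + 1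

end SpacetimeDim

/-- The Minkowski metric `diag(1, -1, …, -1)`. -/
def eta {k : ℕ} (a b : Fin (k + 1)) : ℂ := if a = b then (if a = 0 then 1 else -1) else 0

/-- Gamma matrices: a representation of the Clifford relations
`γ_a γ_b + γ_b γ_a = 2 η_{ab}` on `ℂ^D` with `γ_a† = γ_0 γ_a γ_0`. -/
structure GammaMatrices (δ : SpacetimeDim) where
  gamma : Fin δ.dim → Matrix (Fin δ.dim) (Fin δ.dim) ℂ
  clifford : ∀ a b, gamma a * gamma b + gamma b * gamma a = (2 * eta a b) • 1
  adjoint : ∀ a, (gamma a).conjTranspose = gamma 0 * gamma a * gamma 0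

namespace GammaMatrices

/-- `γ^a = η^{ab} γ_b`. -/
def up {δ : SpacetimeDim} (γ : GammaMatrices δ) (a : Fin δ.dim) :
    Matrix (Fin δ.dim) (Fin δ.dim) ℂ :=
  ∑ b, eta a b • γ.gamma b

/-- `γ_{ab} = ½ [γ_a, γ_b]`. -/
def comm {δ : SpacetimeDim} (γ : GammaMatrices δ) (a b : Fin δ.dim) :
    Matrix (Fin δ.dim) (Fin δ.dim) ℂ :=
  (1 / 2 : ℂ) • (γ.gamma a * γ.gamma b - γ.gamma b * γ.gamma a)

/-- The chirality matrix: `γ_3 = γ_0 γ_1` for `D = 2`, `γ_5 = i γ_0 γ_1 γ_2 γ_3` for `D = 4`. -/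
def chirality : {δ : SpacetimeDim} → GammaMatrices δ → Matrix (Fin δ.dim) (Fin δ.dim) ℂ
  | .two, γ => γ.gamma 0 * γ.gamma 1
  | .four, γ => Complex.I • (γ.gamma 0 * γ.gamma 1 * γ.gamma 2 * γ.gamma 3)

end GammaMatrices

/-- The normalisation of the inner product: `1` for `D = 2`, `i` for `D = 4`. -/
def SpacetimeDim.innerConst : SpacetimeDim → ℂ
  | two => 1
  | four => Complex.I

/-- The normalisation of the Dirac action: `2i` for `D = 2`, `-4` for `D = 4`. -/
def SpacetimeDim.actionConst : SpacetimeDim → ℂ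
  | two => 2 * Complex.I
  | four => -4

/-! ## Noncommutative Cartan geometries -/

section Cartan

variable {δ : SpacetimeDim} {M : Type*} [TopologicalSpace M]
  [ChartedSpace (EuclideanSpace ℝ (Fin δ.dim)) M] [IsManifold (𝓡 δ.dim) ∞ M]

/-- The matrix-valued one-form `V^a γ_a`. -/
def gammaForm (γ : GammaMatrices δ) (V : Fin δ.dim → Form δ.dim M 1) : MatForm δ.dim M 1 :=
  fun i j => ∑ a, (cst (γ.gamma a i j) : Fn δ.dim M) • V a

/-- The complex matrix obtained by evaluating a matrix-valued one-form on a real vector field at a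
point. -/
def valueAt (A : MatForm δ.dim M 1) (Y : RVec δ.dim M) (x : M) :
    Matrix (Fin δ.dim) (Fin δ.dim) ℂ :=
  Matrix.of fun i j => contract Y.toCVec (A i j) x

/-- The expansion of the spin connection in the gamma-matrix basis:
`Ω = ω γ_3 + ω' 1` with `ω' = 0` at `λ = 0` for `D = 2`, and
`Ω = ¼ ω^{ab} γ_{ab} + i ω' 1 + ω'' γ_5` with `ω' = ω'' = 0` at `λ = 0` for `D = 4`. -/
def ConnectionExpansion (γ : GammaMatrices δ) (Ω : Formal (MatForm δ.dim M 1)) : Prop :=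
  match δ with
  | .two => ∃ w w' : Formal (Form δ.dim M 1), w' 0 = 0 ∧ ∀ n i j,
      Ω n i j = (cst (γ.chirality i j) : Fn δ.dim M) • w n +
        (cst ((1 : Matrix (Fin δ.dim) (Fin δ.dim) ℂ) i j) : Fn δ.dim M) • w' n
  | .four => ∃ (w : Fin δ.dim → Fin δ.dim → Formal (Form δ.dim M 1))
      (w' w'' : Formal (Form δ.dim M 1)), w' 0 = 0 ∧ w'' 0 = 0 ∧ ∀ n i j,
      Ω n i j = (∑ a, ∑ b, (cst (1 / 4 * γ.comm a b i j) : Fn δ.dim M) • w a b n) +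
        (cst (Complex.I * (1 : Matrix (Fin δ.dim) (Fin δ.dim) ℂ) i j) : Fn δ.dim M) • w' n +
        (cst (γ.chirality i j) : Fn δ.dim M) • w'' n

variable (M) in
/-- A noncommutative Cartan geometry `(V, Ω)` with `V = V^a γ_a`, given by formal power series.
The classical vielbein `V^a` at `λ = 0` is a global coframe, i.e. it identifies vector fields with
`D`-tuples of functions. -/
structure CartanGeometry (γ : GammaMatrices δ) where
  V : Fin δ.dim → Formal (Form δ.dim M 1)
  Ω : Formal (MatForm δ.dim M 1)
  coframe : Function.Bijective fun (Y : CVec δ.dim M) (a : Fin δ.dim) => contract Y (V a 0)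
  V_real : ∀ n Y x, (valueAt (gammaForm γ fun a => V a n) Y x).conjTranspose =
    γ.gamma 0 * valueAt (gammaForm γ fun a => V a n) Y x * γ.gamma 0
  Ω_real : ∀ n Y x, (valueAt (Ω n) Y x).conjTranspose =
    -(γ.gamma 0 * valueAt (Ω n) Y x * γ.gamma 0)
  Ω_expansion : ConnectionExpansion γ Ω

namespace CartanGeometry

variable {γ : GammaMatrices δ} (G : CartanGeometry M γ)

/-- The Clifford-algebra valued vielbein `V = V^a γ_a`. -/
def vielbein : Formal (MatForm δ.dim M 1) := fun n => gammaForm γ fun a => G.V a n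

/-- The Killing vector fields of `(V, Ω)`: those with `L_X V = 0` and `L_X Ω = 0`. -/
def killing : Submodule ℝ (RVec δ.dim M) where
  carrier := {X | ∀ n, lieMatForm X.toCVec (G.vielbein n) = 0 ∧ lieMatForm X.toCVec (G.Ω n) = 0}
  add_mem' {X Y} hX hY n := by
    have h := fun i j => congrFun (congrFun (hX n).1 i) j
    have h' := fun i j => congrFun (congrFun (hY n).1 i) j
    have g := fun i j => congrFun (congrFun (hX n).2 i) j
    have g' := fun i j => congrFun (congrFun (hY n).2 i) j
    simp only [lieMatForm, Pi.zero_apply] at h h' g g'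
    constructor <;> funext i j <;> simp [lieMatForm, RVec.toCVec_add, lieForm_add, h, h', g, g']
  zero_mem' n := by
    have h0 : (0 : RVec δ.dim M).toCVec = 0 := by
      simpa using RVec.toCVec_smul (0 : ℝ) (0 : RVec δ.dim M)
    have hl : ∀ φ : Form δ.dim M 1, lieForm 0 φ = 0 := by
      intro φ
      simpa using lieForm_add (0 : CVec δ.dim M) 0 φ
    constructor <;> funext i j <;> simp [lieMatForm, h0, hl]
  smul_mem' c X hX n := by
    have h := fun i j => congrFun (congrFun (hX n).1 i) j
    have g := fun i j => congrFun (congrFun (hX n).2 i) j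
    simp only [lieMatForm, Pi.zero_apply] at h g
    constructor <;> funext i j <;> simp [lieMatForm, RVec.toCVec_smul, lieForm_cst_smul, h, g]

/-- A twist is semi-Killing if `∑ Θ^{αβ} X_α ⊗ X_β ∈ Ξ ⊗ 𝔎 + 𝔎 ⊗ Ξ`, where `Ξ` is the space of all
vector fields and `𝔎` the space of Killing vector fields. -/
def IsSemiKilling (F : AbelianTwist δ.dim M) : Prop :=
  ∑ α, ∑ β, F.Θ α β • (F.X α ⊗ₜ[ℝ] F.X β) ∈
    LinearMap.range (TensorProduct.map LinearMap.id G.killing.subtype) ⊔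
      LinearMap.range (TensorProduct.map G.killing.subtype LinearMap.id)

/-- A twist is Killing if all its vector fields are Killing. -/
def IsKilling (F : AbelianTwist δ.dim M) : Prop := ∀ α, F.X α ∈ G.killing

/-! ### The Dirac operators -/

/-- The Dirac adjoint `ψ̄ = ψ† γ_0`. -/
def diracAdjoint (γ : GammaMatrices δ) (ψ : Formal (Spinor δ.dim M)) : Formal (Spinor δ.dim M) :=
  fun n j => ∑ i, conjFn (ψ n i) * cst (γ.gamma 0 i j)

/-- The star-covariant differential `d_Ω ψ = dψ - Ω ⋆ ψ`. -/
def covDiff (F : AbelianTwist δ.dim M) (ψ : Formal (Spinor δ.dim M)) :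
    Formal (SpinorForm δ.dim M) :=
  fun n => (fun i => dFn (ψ n i)) - F.star lieMatForm lieSpinor mulSpinor G.Ω ψ n

/-- `A ∧⋆ V ∧⋆ ⋯ ∧⋆ V` with `r` factors `V`, for a matrix-valued one-form `A`. -/
def wedgeV (F : AbelianTwist δ.dim M) (A : Formal (MatForm δ.dim M 1)) :
    (r : ℕ) → Formal (MatForm δ.dim M (r + 1))
  | 0 => A
  | r + 1 => F.star lieMatForm lieMatForm wedgeMat (wedgeV F A r) G.vielbein

/-- `E_a` is the (undeformed) inverse vielbein, `ι_{E_a} V^b = δ_a^b`. -/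
def IsInverse (E : Fin δ.dim → Formal (CVec δ.dim M)) : Prop :=
  ∀ a b n, ∑ p ∈ Finset.HasAntidiagonal.antidiagonal n, contract (E a p.1) (G.V b p.2) =
    if n = 0 ∧ a = b then 1 else 0

/-- `E_a` is the star-inverse vielbein, `ι⋆_{E_a} V^b = δ_a^b`. -/
def IsStarInverse (F : AbelianTwist δ.dim M) (E : Fin δ.dim → Formal (CVec δ.dim M)) : Prop :=
  ∀ a b n, F.star lieVec lieForm contract (E a) (G.V b) n = if n = 0 ∧ a = b then 1 else 0

/-- The contraction Dirac operator `ψ ↦ i γ^a ι⋆_{E_a} (d_Ω ψ)`, with `E_a` the star-inverse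
vielbein. -/
def contrDirac (F : AbelianTwist δ.dim M) (E : Fin δ.dim → Formal (CVec δ.dim M))
    (ψ : Formal (Spinor δ.dim M)) : Formal (Spinor δ.dim M) := fun n =>
  ∑ a, constMul (Complex.I • γ.up a)
    (F.star lieVec lieSpinorForm contractSpinor (E a) (G.covDiff F ψ) n)

/-- The coefficients in `λ` of the classical Dirac operator `ψ ↦ i γ^a (E_a(ψ) - Ω_a ψ)` of
`(V, Ω)`, with `E_a` the inverse vielbein and `Ω_a = ι_{E_a} Ω`. -/
def classicalCoeff (E : Fin δ.dim → Formal (CVec δ.dim M)) :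
    Formal (Spinor δ.dim M → Spinor δ.dim M) := fun n ψ =>
  ∑ a, constMul (Complex.I • γ.up a)
    (lieSpinor (E a n) ψ -
      ∑ p ∈ Finset.HasAntidiagonal.antidiagonal n, contractSpinor (E a p.1) (mulSpinor (G.Ω p.2) ψ))

/-- The classical Dirac operator of `(V, Ω)` on formal power series. -/
def classicalDirac (E : Fin δ.dim → Formal (CVec δ.dim M)) (ψ : Formal (Spinor δ.dim M)) :
    Formal (Spinor δ.dim M) := fun n =>
  ∑ p ∈ Finset.HasAntidiagonal.antidiagonal n, G.classicalCoeff E p.1 (ψ p.2)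

/-- The deformed Dirac operator, `ψ ↦ (f̄^α ▸ D) (f̄_α ψ)` where `D` is the classical Dirac operator
of `(V, Ω)`, `ℱ⁻¹ = f̄^α ⊗ f̄_α` and `▸` is the adjoint action. -/
def deformedDirac (F : AbelianTwist δ.dim M) (E : Fin δ.dim → Formal (CVec δ.dim M))
    (ψ : Formal (Spinor δ.dim M)) : Formal (Spinor δ.dim M) :=
  F.star lieOp lieSpinor (fun D χ => D χ) (G.classicalCoeff E) ψ

variable [T2Space M] [SigmaCompactSpace M]

/-- Termwise integral of `Tr (A Γ)` for a formal power series of matrix-valued top forms, where `Γ`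
is the chirality matrix and `M` is oriented by the classical vielbein. -/
def intTrace (A : Formal (MatForm δ.dim M δ.dim)) : Formal ℂ := fun n =>
  integral (fun a => G.V a 0) (traceMul (A n) γ.chirality)

/-- The inner product `⟨ψ₁, ψ₂⟩`: `∫ Tr (ψ₂ ⋆ ψ̄₁ ⋆ V ∧⋆ V γ_3)` for `D = 2` and
`i ∫ Tr (ψ₂ ⋆ ψ̄₁ ⋆ V ∧⋆ V ∧⋆ V ∧⋆ V γ_5)` for `D = 4`. -/
def inner (F : AbelianTwist δ.dim M) (ψ₁ ψ₂ : Formal (Spinor δ.dim M)) : Formal ℂ :=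
  δ.innerConst • G.intTrace (G.wedgeV F
    (F.star lieMatFn lieMatForm mulMatForm
      (F.star lieSpinor lieSpinor outer ψ₂ (diracAdjoint γ ψ₁)) G.vielbein) δ.spatial)

/-- The Dirac action form: `2i ∫ Tr ((d_Ω ψ₂) ⋆ ψ̄₁ ∧⋆ V γ_3)` for `D = 2` and
`-4 ∫ Tr ((d_Ω ψ₂) ⋆ ψ̄₁ ∧⋆ V ∧⋆ V ∧⋆ V γ_5)` for `D = 4`. -/
def action (F : AbelianTwist δ.dim M) (ψ₁ ψ₂ : Formal (Spinor δ.dim M)) : Formal ℂ :=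
  δ.actionConst • G.intTrace (G.wedgeV F
    (F.star lieSpinorForm lieSpinor outerForm (G.covDiff F ψ₂) (diracAdjoint γ ψ₁)) δ.spatial)

/-- `D` is the Aschieri–Castellani Dirac operator: `⟨ψ₁, D ψ₂⟩` equals the Dirac action form of
`ψ₁, ψ₂` for all `ψ₂` and all compactly supported `ψ₁`. -/
def IsACDirac (F : AbelianTwist δ.dim M)
    (D : Formal (Spinor δ.dim M) → Formal (Spinor δ.dim M)) : Prop :=
  ∀ ψ₂ ψ₁ : Formal (Spinor δ.dim M), (∀ n i, HasCompactSupport (ψ₁ n i)) →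
    G.inner F ψ₁ (D ψ₂) = G.action F ψ₁ ψ₂

end CartanGeometry

end Cartan

end TwistedDirac

end

open TwistedDirac

open scoped Manifold ContDiff TensorProduct Topology

noncomputable section

namespace TwistedDirac

/-! ### Functions, vector fields and charts -/

section LocalGeometry

set_option linter.unusedSectionVars false

variable {k : ℕ} {M : Type*} [TopologicalSpace M] [ChartedSpace (EuclideanSpace ℝ (Fin k)) M]

/-! Semi-Killing means that Θ^{αβ} X_α ⊗ X_β vanishes in (Ξ/𝔎) ⊗ (Ξ/𝔎). By `exists_splitting` one
can therefore write X_α = K_α + C_α with K_α Killing, C_α a constant combination of the X's, and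
Θ^{αβ} C_α ⊗ C_β = 0. Every term of the twist generator then has a leg K that is Killing and
commutes with all X's. Two facts follow. If both arguments of a bilinear operation are invariant
under these K, the operation is not deformed (`iter_succ_eq_zero`). If one of them is, the deformed
and the undeformed operation differ by Lie derivatives along such K (`iter_succ_mem_right`,
`iter_succ_mem_left`), and for compact support these integrate to zero (`integral_lieForm_eq_zero`).

The equations for the inverse vielbeins are triangular in λ with invertible leading part, hence
uniquely solvable. Differentiating the equation for E along a Killing field shows that E is
invariant; so the contraction of E with V is undeformed and E is also the star inverse.
Associativity of deformed operations (`star_assoc`) turns ι⋆_E(dψ - Ω ⋆ ψ) into E ⋆ ψ - (ι_E Ω) ⋆ ψ.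
This is the classical operator with twisted coefficients, since the adjoint action on a first order
operator differentiates its coefficients; hence the contraction operator equals the deformed one. If
all X's are Killing, they annihilate these coefficients and the twist disappears.

For the Aschieri–Castellani operator, d_Ω ψ is expanded as V^a ⋆ ι⋆_{E_a} d_Ω ψ. Under the integral
every star next to V can be dropped, and only the star in front of the Dirac adjoint of ψ₁ survives.
The wedge product antisymmetrises the gamma matrices, which produces det V times the product of all
gammas, and this product times Γ is a scalar. Both pairings become the same constant times ∫ det V ·
tr(χ ⋆ ψ̄₁) with χ the contraction operator applied to ψ₂ (`isACDirac_contrDirac`). Uniqueness is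
nondegeneracy of the inner product (`eq_zero_of_inner_eq_zero`): the lowest coefficient d_n of a
null vector is tested against a bump function times its own conjugate, which gives ∫ b |d_n|² = 0.

Forms are alternating maps on derivations and the integral is defined through charts, so
tensoriality, independence of charts and the divergence theorem are established beforehand. -/

@[simp] theorem cst_apply (c : ℂ) (x : M) : (cst c : Fn k M) x = c := rfl

/-- A real-valued smooth function, regarded as a complex-valued one. -/
def ofRealFn (χ : ContMDiffMap (𝓡 k) 𝓘(ℝ, ℝ) M ℝ ∞) : Fn k M :=
  ⟨fun x => (χ x : ℂ), (Complex.ofRealCLM : ℝ →L[ℝ] ℂ).contMDiff.comp χ.contMDiff⟩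

theorem sumFn_apply {ι : Type*} (s : Finset ι) (f : ι → Fn k M) (x : M) :
    (∑ i ∈ s, f i) x = ∑ i ∈ s, f i x := by
  classical
  induction s using Finset.induction_on with
  | empty => rfl
  | insert a s ha ih => rw [Finset.sum_insert ha, Finset.sum_insert ha, ← ih]; rfl

theorem sumVec_apply {ι : Type*} (s : Finset ι) (Y : ι → CVec k M) (f : Fn k M) :
    (∑ i ∈ s, Y i) f = ∑ i ∈ s, Y i f := by
  classical
  induction s using Finset.induction_on with
  | empty => rfl
  | insert a s ha ih => rw [Finset.sum_insert ha, Finset.sum_insert ha, ← ih]; rfl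

variable [IsManifold (𝓡 k) ∞ M]

/-- The differential of a function at a point. -/
def dAt (f : Fn k M) (x : M) : TangentSpace (𝓡 k) x →L[ℝ] ℂ := mfderiv (𝓡 k) 𝓘(ℝ, ℂ) f x

theorem RVec.toCVec_apply (X : RVec k M) (f : Fn k M) (x : M) :
    X.toCVec f x = dAt f x (X x) := rfl

theorem dAt_congr {f g : Fn k M} {x : M} (h : ⇑f =ᶠ[𝓝 x] ⇑g) : dAt f x = dAt g x :=
  h.mfderiv_eq

theorem isManifold_one : IsManifold (𝓡 k) 1 M := IsManifold.of_le (n := ∞) (by simp)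

theorem RVec.toCVec_congr (X : RVec k M) {f g : Fn k M} {x : M} (h : ⇑f =ᶠ[𝓝 x] ⇑g) :
    X.toCVec f x = X.toCVec g x := by
  rw [RVec.toCVec_apply, RVec.toCVec_apply, dAt_congr h]

theorem coord_mem (p : M) {y : EuclideanSpace ℝ (Fin k)} (hy : y ∈ (extChartAt (𝓡 k) p).target) :
    (extChartAt (𝓡 k) p).symm y ∈ (chartAt (EuclideanSpace ℝ (Fin k)) p).source := by
  rw [← extChartAt_source (𝓡 k)]
  exact (extChartAt (𝓡 k) p).map_target hy

theorem contDiffAt_coord (u : Fn k M) (p : M) {y : EuclideanSpace ℝ (Fin k)}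
    (hy : y ∈ (extChartAt (𝓡 k) p).target) :
    ContDiffAt ℝ ∞ (u ∘ (extChartAt (𝓡 k) p).symm) y := by
  rw [← contMDiffAt_iff_contDiffAt]
  refine u.contMDiff.contMDiffAt.comp y ?_
  have := contMDiffOn_extChartAt_symm (I := 𝓡 k) (n := ∞) p
  exact (this y hy).contMDiffAt (extChartAt_target_mem_nhds' hy)

theorem mdifferentiableAt_coord_symm (p : M) {y : EuclideanSpace ℝ (Fin k)}
    (hy : y ∈ (extChartAt (𝓡 k) p).target) :
    MDifferentiableAt 𝓘(ℝ, EuclideanSpace ℝ (Fin k)) (𝓡 k) (extChartAt (𝓡 k) p).symm y := by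
  have := contMDiffOn_extChartAt_symm (I := 𝓡 k) (n := ∞) p
  exact ((this y hy).contMDiffAt (extChartAt_target_mem_nhds' hy)).mdifferentiableAt (by simp)

theorem dAt_coordVec (u : Fn k M) (p : M) {y : EuclideanSpace ℝ (Fin k)}
    (hy : y ∈ (extChartAt (𝓡 k) p).target) (i : Fin k) :
    dAt u ((extChartAt (𝓡 k) p).symm y) (coordVec p y i) =
      fderiv ℝ (u ∘ (extChartAt (𝓡 k) p).symm) y (EuclideanSpace.single i 1) := by
  rw [← mfderiv_eq_fderiv, mfderiv_comp y (mdiffAt u _) (mdifferentiableAt_coord_symm p hy)]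
  rfl

/-- The components of a tangent vector in the coordinates of the chart at `p`. -/
def coordComp (p x : M) (v : TangentSpace (𝓡 k) x) : EuclideanSpace ℝ (Fin k) :=
  mfderiv (𝓡 k) 𝓘(ℝ, EuclideanSpace ℝ (Fin k)) (extChartAt (𝓡 k) p) x v

theorem sum_coordVec (p : M) {y : EuclideanSpace ℝ (Fin k)}
    (hy : y ∈ (extChartAt (𝓡 k) p).target)
    (v : TangentSpace (𝓡 k) ((extChartAt (𝓡 k) p).symm y)) :
    ∑ i, coordComp p ((extChartAt (𝓡 k) p).symm y) v i • coordVec p y i = v := by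
  have : IsManifold (𝓡 k) 1 M := isManifold_one
  have h := mfderivWithin_extChartAt_symm_comp_mfderiv_extChartAt (I := 𝓡 k) hy
  rw [(𝓡 k).range_eq_univ, mfderivWithin_univ] at h
  have h2 := congrArg (fun L => L v) h
  refine Eq.trans ?_ h2
  change _ = mfderiv 𝓘(ℝ, EuclideanSpace ℝ (Fin k)) (𝓡 k) (extChartAt (𝓡 k) p).symm y
    (coordComp p ((extChartAt (𝓡 k) p).symm y) v)
  set c := coordComp p ((extChartAt (𝓡 k) p).symm y) v
  have hc : c = ∑ i, c i • EuclideanSpace.single i (1 : ℝ) := by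
    ext j
    simp [Finset.sum_apply, Pi.single_apply]
  conv_rhs => rw [hc]
  refine Eq.symm ((map_sum (mfderiv 𝓘(ℝ, EuclideanSpace ℝ (Fin k)) (𝓡 k)
    (extChartAt (𝓡 k) p).symm y) _ _).trans ?_)
  refine Finset.sum_congr rfl fun i _ => ?_
  exact (mfderiv 𝓘(ℝ, EuclideanSpace ℝ (Fin k)) (𝓡 k) (extChartAt (𝓡 k) p).symm y).map_smul _ _

theorem coordComp_coordVec (p : M) {y : EuclideanSpace ℝ (Fin k)}
    (hy : y ∈ (extChartAt (𝓡 k) p).target) (i : Fin k) :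
    coordComp p ((extChartAt (𝓡 k) p).symm y) (coordVec p y i) = EuclideanSpace.single i 1 := by
  have : IsManifold (𝓡 k) 1 M := isManifold_one
  have h := mfderiv_extChartAt_comp_mfderivWithin_extChartAt_symm (I := 𝓡 k) hy
  rw [(𝓡 k).range_eq_univ, mfderivWithin_univ] at h
  exact congrArg (fun L => L (EuclideanSpace.single i (1 : ℝ))) h

/-- Cut-off functions for the chart at `p`. -/
def IsCutoff (p : M) (χ : ContMDiffMap (𝓡 k) 𝓘(ℝ, ℝ) M ℝ ∞) : Prop :=
  tsupport χ ⊆ (chartAt (EuclideanSpace ℝ (Fin k)) p).source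

/-- The coordinate vector field `∂_i` of the chart at `p`, multiplied by a cut-off function. -/
def coordField (p : M) (χ : ContMDiffMap (𝓡 k) 𝓘(ℝ, ℝ) M ℝ ∞) (hχ : IsCutoff p χ) (i : Fin k) :
    RVec k M :=
  ⟨fun x => χ x • VectorField.mpullback (𝓡 k) 𝓘(ℝ, EuclideanSpace ℝ (Fin k))
      (extChartAt (𝓡 k) p) (fun _ => EuclideanSpace.single i (1 : ℝ)) x, by
    intro x
    have : IsManifold (𝓡 k) 1 M := isManifold_one
    -- Smoothness of the pullback is available on the chart domain only; off the support of `χ` the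
    -- product vanishes near `x`.
    by_cases hx : x ∈ tsupport χ
    · have hx' := hχ hx
      refine ContMDiffAt.smul_section (χ.contMDiff x) ?_
      refine ContMDiffAt.mpullback_vectorField_preimage (n := ∞) ?_
        (contMDiffAt_extChartAt' hx') (isInvertible_mfderiv_extChartAt (by simpa using hx')) (by simp)
      exact contMDiffAt_vectorSpace_iff_contDiffAt.2 contDiffAt_const
    · have h0 : ∀ᶠ z in 𝓝 x, χ z = 0 := by
        filter_upwards [(isClosed_tsupport χ).isOpen_compl.mem_nhds hx] with z hz
        exact image_eq_zero_of_notMem_tsupport hz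
      refine (Bundle.contMDiff_zeroSection ℝ (TangentSpace (𝓡 k) : M → Type _) x).congr_of_eventuallyEq ?_
      filter_upwards [h0] with z hz
      simp [hz, Bundle.zeroSection]⟩

/-- The pullback of a constant field involves the inverse of the derivative of the chart, which is
the derivative of the inverse chart. -/
theorem coordField_apply (p : M) (χ : ContMDiffMap (𝓡 k) 𝓘(ℝ, ℝ) M ℝ ∞) (hχ : IsCutoff p χ)
    (i : Fin k) {y : EuclideanSpace ℝ (Fin k)} (hy : y ∈ (extChartAt (𝓡 k) p).target) :
    coordField p χ hχ i ((extChartAt (𝓡 k) p).symm y) =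
      χ ((extChartAt (𝓡 k) p).symm y) • coordVec p y i := by
  have : IsManifold (𝓡 k) 1 M := isManifold_one
  refine congrArg (fun v : TangentSpace (𝓡 k) ((extChartAt (𝓡 k) p).symm y) =>
    χ ((extChartAt (𝓡 k) p).symm y) • v) ?_
  have h1 := mfderiv_extChartAt_comp_mfderivWithin_extChartAt_symm (I := 𝓡 k) hy
  have h2 := mfderivWithin_extChartAt_symm_comp_mfderiv_extChartAt (I := 𝓡 k) hy
  rw [(𝓡 k).range_eq_univ, mfderivWithin_univ] at h1 h2
  exact congrArg (fun L => L (EuclideanSpace.single i (1 : ℝ))) (ContinuousLinearMap.inverse_eq h1 h2)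

theorem coordField_toCVec (p : M) (χ : ContMDiffMap (𝓡 k) 𝓘(ℝ, ℝ) M ℝ ∞) (hχ : IsCutoff p χ)
    (i : Fin k) (u : Fn k M) {y : EuclideanSpace ℝ (Fin k)}
    (hy : y ∈ (extChartAt (𝓡 k) p).target) :
    (coordField p χ hχ i).toCVec u ((extChartAt (𝓡 k) p).symm y) =
      χ ((extChartAt (𝓡 k) p).symm y) •
        fderiv ℝ (u ∘ (extChartAt (𝓡 k) p).symm) y (EuclideanSpace.single i 1) := by
  rw [RVec.toCVec_apply, coordField_apply p χ hχ i hy, ← dAt_coordVec u p hy]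
  exact (dAt u _).map_smul _ _

theorem coordField_toCVec_of_notMem (p : M) (χ : ContMDiffMap (𝓡 k) 𝓘(ℝ, ℝ) M ℝ ∞)
    (hχ : IsCutoff p χ) (i : Fin k) (u : Fn k M) {x : M} (hx : χ x = 0) :
    (coordField p χ hχ i).toCVec u x = 0 := by
  rw [RVec.toCVec_apply]
  have : coordField p χ hχ i x = 0 := by
    exact (congrArg (fun c : ℝ => c • (VectorField.mpullback (𝓡 k) 𝓘(ℝ, EuclideanSpace ℝ (Fin k))
      (extChartAt (𝓡 k) p) (fun _ => EuclideanSpace.single i (1 : ℝ)) x :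
        TangentSpace (𝓡 k) x)) hx).trans (zero_smul ℝ _)
  rw [this, map_zero]

/-- A coordinate function of the chart at `p`, multiplied by a cut-off function. -/
def coordFn (p : M) (χ : ContMDiffMap (𝓡 k) 𝓘(ℝ, ℝ) M ℝ ∞) (hχ : IsCutoff p χ) (i : Fin k) :
    Fn k M :=
  ⟨fun x => ((χ x * extChartAt (𝓡 k) p x i : ℝ) : ℂ), by
    refine (Complex.ofRealCLM : ℝ →L[ℝ] ℂ).contMDiff.comp ?_
    intro x
    by_cases hx : x ∈ tsupport χ
    · have h1 : ContMDiffAt (𝓡 k) 𝓘(ℝ, ℝ) ∞ (fun x => extChartAt (𝓡 k) p x i) x :=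
        ((EuclideanSpace.proj i : EuclideanSpace ℝ (Fin k) →L[ℝ] ℝ).contMDiff.contMDiffAt).comp x
          (contMDiffAt_extChartAt' (hχ hx))
      exact (χ.contMDiff x).mul h1
    · have h0 : ∀ᶠ z in 𝓝 x, χ z = 0 := by
        filter_upwards [(isClosed_tsupport χ).isOpen_compl.mem_nhds hx] with z hz
        exact image_eq_zero_of_notMem_tsupport hz
      refine (contMDiffAt_const (c := (0 : ℝ))).congr_of_eventuallyEq ?_
      filter_upwards [h0] with z hz
      exact (congrArg (· * extChartAt (𝓡 k) p z i) hz).trans (zero_mul _)⟩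

theorem toCVec_coordFn (X : RVec k M) (p : M) (χ : ContMDiffMap (𝓡 k) 𝓘(ℝ, ℝ) M ℝ ∞)
    (hχ : IsCutoff p χ) (i : Fin k) {x : M}
    (hx : x ∈ (chartAt (EuclideanSpace ℝ (Fin k)) p).source) (h1 : ∀ᶠ z in 𝓝 x, χ z = 1) :
    X.toCVec (coordFn p χ hχ i) x = (coordComp p x (X x) i : ℂ) := by
  have : IsManifold (𝓡 k) 1 M := isManifold_one
  have h2 : ⇑(coordFn p χ hχ i) =ᶠ[𝓝 x]
      ((Complex.ofRealCLM.comp (EuclideanSpace.proj i : EuclideanSpace ℝ (Fin k) →L[ℝ] ℝ)) ∘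
        extChartAt (𝓡 k) p) := by
    filter_upwards [h1] with z hz
    change ((χ z * extChartAt (𝓡 k) p z i : ℝ) : ℂ) = _
    rw [hz, one_mul]
    rfl
  have h3 := h2.mfderiv_eq.trans (mfderiv_comp x
    (ContinuousLinearMap.differentiableAt _).mdifferentiableAt (mdifferentiableAt_extChartAt hx))
  rw [mfderiv_eq_fderiv, ContinuousLinearMap.fderiv] at h3
  exact congrArg (fun L => L (X x)) h3

/-- Near the points where the cut-offs are one, a vector field is the combination of the coordinate
fields given by its components. -/
theorem smul_toCVec_eq_sum (X : RVec k M) (p : M) (χ₁ χ₂ : ContMDiffMap (𝓡 k) 𝓘(ℝ, ℝ) M ℝ ∞)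
    (h₁ : IsCutoff p χ₁) (h₂ : IsCutoff p χ₂) (h : ∀ x ∈ tsupport χ₂, ∀ᶠ z in 𝓝 x, χ₁ z = 1) :
    ofRealFn χ₂ • X.toCVec =
      ∑ i, X.toCVec (coordFn p χ₁ h₁ i) • (coordField p χ₂ h₂ i).toCVec := by
  ext u x
  have hsum : (∑ i, X.toCVec (coordFn p χ₁ h₁ i) • (coordField p χ₂ h₂ i).toCVec) u x =
      ∑ i, X.toCVec (coordFn p χ₁ h₁ i) x * (coordField p χ₂ h₂ i).toCVec u x := by
    rw [sumVec_apply, sumFn_apply]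
    rfl
  rw [hsum]
  change (χ₂ x : ℂ) * X.toCVec u x = _
  -- On the support of `χ₂` the outer cut-off is locally 1, so `X (χ₁ xⁱ)` is the i-th component of
  -- `X`. Elsewhere both sides vanish.
  by_cases hx : x ∈ tsupport χ₂
  · have hxs := h₂ hx
    have hxe : x ∈ (extChartAt (𝓡 k) p).source := by rwa [extChartAt_source]
    obtain ⟨y, hy, rfl⟩ : ∃ y ∈ (extChartAt (𝓡 k) p).target, (extChartAt (𝓡 k) p).symm y = x :=
      ⟨extChartAt (𝓡 k) p x, (extChartAt (𝓡 k) p).map_source hxe,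
        (extChartAt (𝓡 k) p).left_inv hxe⟩
    have hX := sum_coordVec p hy (X ((extChartAt (𝓡 k) p).symm y))
    rw [RVec.toCVec_apply]
    conv_lhs => rw [← hX]
    rw [map_sum, Finset.mul_sum]
    refine Finset.sum_congr rfl fun i _ => ?_
    rw [toCVec_coordFn X p χ₁ h₁ i hxs (h _ hx), coordField_toCVec p χ₂ h₂ i u hy,
      ← dAt_coordVec u p hy, map_smul, Complex.real_smul, Complex.real_smul]
    ring
  · have h0 := image_eq_zero_of_notMem_tsupport hx
    rw [h0]
    simp [coordField_toCVec_of_notMem p χ₂ h₂ _ u h0]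

end LocalGeometry

end TwistedDirac

end

open scoped Manifold ContDiff TensorProduct Topology

noncomputable section

namespace TwistedDirac

/-! ### Tensoriality of one-forms and extension of tangent vectors -/

section PointwiseForms

set_option linter.unusedSectionVars false

variable {k : ℕ} {M : Type*} [TopologicalSpace M] [ChartedSpace (EuclideanSpace ℝ (Fin k)) M]

/-- Contraction of a one-form as a linear map. -/
def contractHom (φ : Form k M 1) : CVec k M →ₗ[Fn k M] Fn k M :=
  (AlternatingMap.ofSubsingleton (Fn k M) (CVec k M) (Fn k M) (0 : Fin 1)).symm φ

theorem contract_add (v w : CVec k M) (φ : Form k M 1) :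
    contract (v + w) φ = contract v φ + contract w φ := (contractHom φ).map_add v w

theorem contract_sub (v w : CVec k M) (φ : Form k M 1) :
    contract (v - w) φ = contract v φ - contract w φ := (contractHom φ).map_sub v w

theorem contract_smul (f : Fn k M) (v : CVec k M) (φ : Form k M 1) :
    contract (f • v) φ = f * contract v φ := (contractHom φ).map_smul f v

theorem contract_sum {ι : Type*} (s : Finset ι) (v : ι → CVec k M) (φ : Form k M 1) :
    contract (∑ i ∈ s, v i) φ = ∑ i ∈ s, contract (v i) φ := map_sum (contractHom φ) v s

theorem form_one_apply (φ : Form k M 1) (Y : Fin 1 → CVec k M) : φ Y = contract (Y 0) φ := by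
  rw [contract]
  congr 1
  funext i
  rw [Subsingleton.elim i 0]

/-- Evaluation at a point as a ring homomorphism. -/
def evalHom (x : M) : Fn k M →+* ℂ where
  toFun f := f x
  map_one' := rfl
  map_mul' _ _ := rfl
  map_zero' := rfl
  map_add' _ _ := rfl

variable [IsManifold (𝓡 k) ∞ M]

theorem RVec.toCVec_sub (X Y : RVec k M) : (X - Y).toCVec = X.toCVec - Y.toCVec := by
  rw [eq_sub_iff_add_eq, ← RVec.toCVec_add, sub_add_cancel]

/-- `RVec.toCVec` as a linear map. -/
def RVec.toCVecHom : RVec k M →ₗ[ℝ] CVec k M where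
  toFun := RVec.toCVec
  map_add' := RVec.toCVec_add
  map_smul' := RVec.toCVec_smul

theorem RVec.toCVec_sum {ι : Type*} (s : Finset ι) (X : ι → RVec k M) :
    (∑ i ∈ s, X i).toCVec = ∑ i ∈ s, (X i).toCVec := map_sum RVec.toCVecHom X s

theorem RVec.sum_apply {ι : Type*} (s : Finset ι) (X : ι → RVec k M) (x : M) :
    (∑ i ∈ s, X i) x = ∑ i ∈ s, X i x := by
  classical
  induction s using Finset.induction_on with
  | empty => rfl
  | insert a s ha ih => rw [Finset.sum_insert ha, Finset.sum_insert ha, ← ih]; rfl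

variable [T2Space M] [SigmaCompactSpace M]

theorem exists_cutoff (p : M) {C : Set M} (hC : IsClosed C)
    (hCp : C ⊆ (chartAt (EuclideanSpace ℝ (Fin k)) p).source) :
    ∃ χ : ContMDiffMap (𝓡 k) 𝓘(ℝ, ℝ) M ℝ ∞, IsCutoff p χ ∧ ∀ x ∈ C, ∀ᶠ z in 𝓝 x, χ z = 1 := by
  have : LocallyCompactSpace M := Manifold.locallyCompact_of_finiteDimensional (𝓡 k)
  obtain ⟨χ, h0, h1, -⟩ := exists_contMDiffMap_zero_one_nhds_of_isClosed (𝓡 k) (n := ⊤)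
    (chartAt (EuclideanSpace ℝ (Fin k)) p).open_source.isClosed_compl hC
    (Set.disjoint_compl_left_iff_subset.2 hCp)
  refine ⟨χ, fun x hx => ?_, fun x hx => (Filter.Eventually.filter_mono (nhds_le_nhdsSet hx) h1)⟩
  by_contra hxs
  exact notMem_tsupport_iff_eventuallyEq.2
    (Filter.Eventually.filter_mono (nhds_le_nhdsSet (s := _ᶜ) hxs) h0) hx

/-- The inner cut-off `χ₂` globalises coordinate fields. The outer one `χ₁` globalises coordinate
functions without changing their derivatives on the support of `χ₂`. -/
theorem exists_cutoff_pair (p : M) {C : Set M} (hC : IsClosed C)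
    (hCp : C ⊆ (chartAt (EuclideanSpace ℝ (Fin k)) p).source) :
    ∃ χ₁ χ₂ : ContMDiffMap (𝓡 k) 𝓘(ℝ, ℝ) M ℝ ∞, IsCutoff p χ₁ ∧ IsCutoff p χ₂ ∧
      (∀ x ∈ tsupport χ₂, ∀ᶠ z in 𝓝 x, χ₁ z = 1) ∧ ∀ x ∈ C, ∀ᶠ z in 𝓝 x, χ₂ z = 1 := by
  obtain ⟨χ₂, h₂, h₂'⟩ := exists_cutoff p hC hCp
  obtain ⟨χ₁, h₁, h₁'⟩ := exists_cutoff p (isClosed_tsupport χ₂) h₂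
  exact ⟨χ₁, χ₂, h₁, h₂, h₁', h₂'⟩

theorem exists_coord (p : M) {x : M} (hx : x ∈ (chartAt (EuclideanSpace ℝ (Fin k)) p).source) :
    ∃ y ∈ (extChartAt (𝓡 k) p).target, (extChartAt (𝓡 k) p).symm y = x := by
  have hxe : x ∈ (extChartAt (𝓡 k) p).source := by rwa [extChartAt_source]
  exact ⟨extChartAt (𝓡 k) p x, (extChartAt (𝓡 k) p).map_source hxe,
    (extChartAt (𝓡 k) p).left_inv hxe⟩

/-- A form is only known to be linear over functions on global fields, so dependence on the value at
a point needs an argument: after multiplication by a cut-off, `Y` is a combination of coordinate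
fields, and its coefficients vanish wherever `Y` does. -/
theorem contract_toCVec_eq_zero (φ : Form k M 1) (Y : RVec k M) {x : M} (h : Y x = 0) :
    contract Y.toCVec φ x = 0 := by
  obtain ⟨χ₁, χ₂, h₁, h₂, h12, hC⟩ := exists_cutoff_pair (k := k) x (C := {x}) isClosed_singleton (by simp)
  have h2 : χ₂ x = 1 := (hC x rfl).self_of_nhds
  have key := congrArg (fun Z => contract Z φ x) (smul_toCVec_eq_sum Y x χ₁ χ₂ h₁ h₂ h12)
  simp only [contract_smul, contract_sum, sumFn_apply] at key
  have h3 : ∀ i, (Y.toCVec (coordFn x χ₁ h₁ i) * contract (coordField x χ₂ h₂ i).toCVec φ) x = 0 := by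
    intro i
    change Y.toCVec (coordFn x χ₁ h₁ i) x * _ = 0
    rw [RVec.toCVec_apply, h, map_zero, zero_mul]
  simp only [h3, Finset.sum_const_zero] at key
  change (χ₂ x : ℂ) * contract Y.toCVec φ x = 0 at key
  simpa [h2] using key

theorem contract_toCVec_congr (φ : Form k M 1) {Y Z : RVec k M} {x : M} (h : Y x = Z x) :
    contract Y.toCVec φ x = contract Z.toCVec φ x := by
  have h1 : (Y - Z) x = 0 := by
    change Y x - Z x = 0
    rw [h, sub_self]
  have h2 := contract_toCVec_eq_zero φ (Y - Z) h1
  rw [RVec.toCVec_sub, contract_sub] at h2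
  exact sub_eq_zero.1 h2

theorem exists_extension (x : M) (v : TangentSpace (𝓡 k) x) : ∃ Y : RVec k M, Y x = v := by
  obtain ⟨χ, hχ, h1⟩ := exists_cutoff (k := k) x (C := {x}) isClosed_singleton (by simp)
  obtain ⟨y, hy, hxy⟩ := exists_coord x (mem_chart_source (EuclideanSpace ℝ (Fin k)) x)
  -- The base point is generalised so that it can be replaced by the image of `y`, although the type
  -- of the tangent vector depends on it.
  suffices h : ∀ z : M, χ z = 1 → (extChartAt (𝓡 k) x).symm y = z → ∀ v : TangentSpace (𝓡 k) z,
      ∃ Y : RVec k M, Y z = v from h x (h1 x rfl).self_of_nhds hxy v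
  rintro z hz rfl v
  refine ⟨∑ i, (coordComp x _ v i) • coordField x χ hχ i, ?_⟩
  rw [RVec.sum_apply]
  conv_rhs => rw [← sum_coordVec x hy v]
  refine Finset.sum_congr rfl fun i _ => ?_
  change coordComp x _ v i • coordField x χ hχ i _ = _
  rw [coordField_apply x χ hχ i hy, hz, one_smul]

/-- By tensoriality the extension chosen in `evalForm` may be exchanged for any other. -/
theorem evalForm_one (φ : Form k M 1) (x : M) (v : Fin 1 → TangentSpace (𝓡 k) x) {Y : RVec k M}
    (hY : Y x = v 0) : evalForm φ x v = contract Y.toCVec φ x := by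
  have h : ∃ Y : Fin 1 → RVec k M, ∀ i, Y i x = v i := by
    choose Y hY using fun i => exists_extension x (v i)
    exact ⟨Y, hY⟩
  rw [evalForm, dif_pos h, form_one_apply]
  exact contract_toCVec_congr φ ((h.choose_spec 0).trans hY.symm)

end PointwiseForms

/-! ### Real coframes and their densities -/

section Coframe

set_option linter.unusedSectionVars false

variable {k : ℕ} {M : Type*} [TopologicalSpace M] [ChartedSpace (EuclideanSpace ℝ (Fin k)) M]
  [IsManifold (𝓡 k) ∞ M]

variable (k M) in
/-- A global coframe of real one-forms. -/
structure RealCoframe where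
  e : Fin k → Form k M 1
  bij : Function.Bijective fun (Y : CVec k M) (a : Fin k) => contract Y (e a)
  real : ∀ a (Y : RVec k M) x, (contract Y.toCVec (e a) x).im = 0

namespace RealCoframe

variable (C : RealCoframe k M)

/-- The frame dual to a coframe. -/
def basis : Module.Basis (Fin k) (Fn k M) (CVec k M) :=
  Module.Basis.ofEquivFun (LinearEquiv.ofBijective
    (LinearMap.pi fun a => contractHom (C.e a)) C.bij)

theorem basis_repr (Y : CVec k M) (a : Fin k) : C.basis.repr Y a = contract Y (C.e a) := rfl

theorem contract_basis (a b : Fin k) : contract (C.basis a) (C.e b) = if a = b then 1 else 0 := by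
  rw [← basis_repr, C.basis.repr_self, Finsupp.single_apply]

theorem sum_contract_smul (Y : CVec k M) : ∑ a, contract Y (C.e a) • C.basis a = Y :=
  C.basis.sum_repr Y

/-- One function, the value on the dual frame, determines a top form. Integrals of forms thereby
become integrals of functions. -/
theorem topForm_apply (φ : Form k M k) (Y : Fin k → CVec k M) :
    φ Y = φ C.basis * Matrix.det (Matrix.of fun a b => contract (Y b) (C.e a)) := by
  conv_lhs => rw [φ.eq_smul_basis_det C.basis]
  rfl

variable [T2Space M] [SigmaCompactSpace M]

/-- The components of the coframe in the coordinates of the chart at `p`. -/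
def coordMatrix (p : M) (y : EuclideanSpace ℝ (Fin k)) : Matrix (Fin k) (Fin k) ℝ :=
  Matrix.of fun a b => (evalForm (C.e a) ((extChartAt (𝓡 k) p).symm y) fun _ => coordVec p y b).re

/-- The density of the volume form in the coordinates of the chart at `p`. -/
def density (p : M) (y : EuclideanSpace ℝ (Fin k)) : ℝ := |(C.coordMatrix p y).det|

theorem contract_eq_coordMatrix (p : M) (y : EuclideanSpace ℝ (Fin k)) {Y : RVec k M} {b : Fin k}
    (hY : Y ((extChartAt (𝓡 k) p).symm y) = coordVec p y b) (a : Fin k) :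
    contract Y.toCVec (C.e a) ((extChartAt (𝓡 k) p).symm y) = C.coordMatrix p y a b := by
  rw [coordMatrix, Matrix.of_apply, evalForm_one (C.e a) _ _ hY]
  refine Complex.ext rfl ?_
  rw [C.real, Complex.ofReal_im]

theorem evalForm_top (φ : Form k M k) (p : M) (y : EuclideanSpace ℝ (Fin k)) :
    evalForm φ ((extChartAt (𝓡 k) p).symm y) (coordVec p y) =
      φ C.basis ((extChartAt (𝓡 k) p).symm y) * (C.coordMatrix p y).det := by
  have h : ∃ Y : Fin k → RVec k M, ∀ i, Y i ((extChartAt (𝓡 k) p).symm y) = coordVec p y i := by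
    choose Y hY using fun i => exists_extension ((extChartAt (𝓡 k) p).symm y) (coordVec p y i)
    exact ⟨Y, hY⟩
  rw [evalForm, dif_pos h, C.topForm_apply]
  have h1 := h.choose_spec
  set Y := h.choose
  change φ C.basis _ * evalHom _ _ = _
  rw [RingHom.map_det]
  congr 1
  rw [← Complex.ofRealHom_eq_coe, RingHom.map_det]
  congr 1
  ext a b
  exact C.contract_eq_coordMatrix p y (h1 b) a

/-- The orientation sign times the determinant of the coframe is the absolute value of that
determinant, so a positive density replaces orientations. -/
theorem integral_eq (φ : Form k M k) :
    integral C.e φ = ∑ᶠ p : M, ∫ y in (extChartAt (𝓡 k) p).target,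
      ((chartPartition k M p ((extChartAt (𝓡 k) p).symm y) * C.density p y : ℝ) : ℂ) *
        φ C.basis ((extChartAt (𝓡 k) p).symm y) := by
  unfold integral
  refine finsum_congr fun p => ?_
  congr 1
  funext y
  rw [C.evalForm_top]
  have h : chartSign C.e p y = Real.sign (C.coordMatrix p y).det := rfl
  have hs : ∀ r : ℝ, Real.sign r * r = |r| := by
    intro r
    rcases lt_trichotomy r 0 with hr | rfl | hr
    · rw [Real.sign_of_neg hr, abs_of_neg hr]; ring
    · simp
    · rw [Real.sign_of_pos hr, abs_of_pos hr]; ring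
  rw [h, density, ← hs]
  push_cast
  ring

/-- A kernel vector `v` yields a field `Y` on which all coframe forms vanish at the point. Expanding
`Y` in the global dual frame, `Y` annihilates every function at the point, in particular the cut-off
coordinates, whose derivatives along `Y` are the entries of `v`. -/
theorem det_coordMatrix_ne_zero (p : M) {y : EuclideanSpace ℝ (Fin k)}
    (hy : y ∈ (extChartAt (𝓡 k) p).target) : (C.coordMatrix p y).det ≠ 0 := by
  intro h0
  obtain ⟨v, hv, hv0⟩ := Matrix.exists_mulVec_eq_zero_iff.2 h0
  obtain ⟨χ₁, χ₂, h₁, h₂, h12, hC⟩ := exists_cutoff_pair p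
    (C := {(extChartAt (𝓡 k) p).symm y}) isClosed_singleton
    (by simpa using coord_mem p hy)
  have hχ1 : χ₂ ((extChartAt (𝓡 k) p).symm y) = 1 := (hC _ rfl).self_of_nhds
  have hmem : (extChartAt (𝓡 k) p).symm y ∈ tsupport χ₂ := by
    refine subset_tsupport _ ?_
    rw [Function.mem_support, hχ1]
    exact one_ne_zero
  apply hv
  funext b
  set Y : RVec k M := ∑ i, v i • coordField p χ₂ h₂ i with hYdef
  have hY0 : ∀ a, contract Y.toCVec (C.e a) ((extChartAt (𝓡 k) p).symm y) = 0 := by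
    intro a
    have h3 := congrFun hv0 a
    rw [hYdef, RVec.toCVec_sum, contract_sum, sumFn_apply]
    have h4 : ∀ i, contract (v i • coordField p χ₂ h₂ i).toCVec (C.e a)
        ((extChartAt (𝓡 k) p).symm y) = ((C.coordMatrix p y a i * v i : ℝ) : ℂ) := by
      intro i
      have h5 : (v i • coordField p χ₂ h₂ i).toCVec =
          (cst (v i : ℂ) : Fn k M) • (coordField p χ₂ h₂ i).toCVec := by
        rw [RVec.toCVec_smul]
        ext u x
        exact Complex.real_smul
      rw [h5, contract_smul]
      change (v i : ℂ) * _ = _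
      rw [C.contract_eq_coordMatrix p y (b := i)
        (by rw [coordField_apply p χ₂ h₂ i hy, hχ1, one_smul])]
      push_cast
      ring
    rw [Finset.sum_congr rfl fun i _ => h4 i, ← Complex.ofReal_sum]
    have : ∑ i, C.coordMatrix p y a i * v i = 0 := h3
    rw [this, Complex.ofReal_zero]
  have hYb : Y.toCVec (coordFn p χ₁ h₁ b) ((extChartAt (𝓡 k) p).symm y) = 0 := by
    conv_lhs => rw [← C.sum_contract_smul Y.toCVec]
    rw [sumVec_apply, sumFn_apply]
    refine Finset.sum_eq_zero fun a _ => ?_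
    change contract Y.toCVec (C.e a) _ * _ = 0
    rw [hY0, zero_mul]
  rw [toCVec_coordFn Y p χ₁ h₁ b (coord_mem p hy) (h12 _ hmem)] at hYb
  have hYx : Y ((extChartAt (𝓡 k) p).symm y) = ∑ i, v i • coordVec p y i := by
    rw [hYdef, RVec.sum_apply]
    refine Finset.sum_congr rfl fun i _ => ?_
    change v i • coordField p χ₂ h₂ i _ = _
    rw [coordField_apply p χ₂ h₂ i hy, hχ1, one_smul]
  rw [hYx] at hYb
  have hcc : coordComp p ((extChartAt (𝓡 k) p).symm y) (∑ i, v i • coordVec p y i) =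
      ∑ i, v i • EuclideanSpace.single i (1 : ℝ) := by
    unfold coordComp
    refine (map_sum (mfderiv (𝓡 k) 𝓘(ℝ, EuclideanSpace ℝ (Fin k)) (extChartAt (𝓡 k) p)
      ((extChartAt (𝓡 k) p).symm y)) _ _).trans ?_
    refine Finset.sum_congr rfl fun i _ => ?_
    rw [← coordComp_coordVec p hy i]
    exact (mfderiv (𝓡 k) 𝓘(ℝ, EuclideanSpace ℝ (Fin k)) (extChartAt (𝓡 k) p)
      ((extChartAt (𝓡 k) p).symm y)).map_smul _ _
  rw [hcc] at hYb
  have h6 : (∑ i, v i • EuclideanSpace.single i (1 : ℝ) : EuclideanSpace ℝ (Fin k)) b = v b := by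
    simp [Finset.sum_apply, Pi.single_apply]
  rw [h6] at hYb
  exact_mod_cast hYb

theorem density_pos (p : M) {y : EuclideanSpace ℝ (Fin k)}
    (hy : y ∈ (extChartAt (𝓡 k) p).target) : 0 < C.density p y :=
  abs_pos.2 (C.det_coordMatrix_ne_zero p hy)

end RealCoframe

end Coframe

end TwistedDirac

end

open scoped Manifold ContDiff TensorProduct Topology

noncomputable section

namespace TwistedDirac

/-! ### Integration against the density of a coframe and independence of charts -/

section Integrals

set_option linter.unusedSectionVars false

open MeasureTheory

variable {k : ℕ} {M : Type*} [TopologicalSpace M] [ChartedSpace (EuclideanSpace ℝ (Fin k)) M]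
  [IsManifold (𝓡 k) ∞ M]

variable [T2Space M] [SigmaCompactSpace M]

namespace RealCoframe

variable (C : RealCoframe k M)

/-- The determinant of the coframe on the cut-off coordinate fields. -/
def coordDet (p : M) (χ : ContMDiffMap (𝓡 k) 𝓘(ℝ, ℝ) M ℝ ∞) (hχ : IsCutoff p χ) : Fn k M :=
  Matrix.det (Matrix.of fun a b => contract (coordField p χ hχ b).toCVec (C.e a))

theorem coordDet_apply (p : M) (χ : ContMDiffMap (𝓡 k) 𝓘(ℝ, ℝ) M ℝ ∞) (hχ : IsCutoff p χ)
    {y : EuclideanSpace ℝ (Fin k)} (hy : y ∈ (extChartAt (𝓡 k) p).target)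
    (h1 : χ ((extChartAt (𝓡 k) p).symm y) = 1) :
    C.coordDet p χ hχ ((extChartAt (𝓡 k) p).symm y) = (C.coordMatrix p y).det := by
  change evalHom _ (C.coordDet p χ hχ) = _
  rw [coordDet, RingHom.map_det, ← Complex.ofRealHom_eq_coe, RingHom.map_det]
  congr 1
  ext a b
  refine C.contract_eq_coordMatrix p y ?_ a
  rw [coordField_apply p χ hχ b hy, h1, one_smul]

theorem continuousAt_coord_symm (p : M) {y : EuclideanSpace ℝ (Fin k)}
    (hy : y ∈ (extChartAt (𝓡 k) p).target) : ContinuousAt (extChartAt (𝓡 k) p).symm y :=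
  continuousAt_extChartAt_symm'' hy

/-- The entries of `coordMatrix` are defined point by point through chosen extensions. Near the
given point their determinant agrees with the smooth function `coordDet`. -/
theorem continuousAt_det_coordMatrix (p : M) {y : EuclideanSpace ℝ (Fin k)}
    (hy : y ∈ (extChartAt (𝓡 k) p).target) :
    ContinuousAt (fun y => (C.coordMatrix p y).det) y := by
  obtain ⟨χ, hχ, h1⟩ := exists_cutoff (k := k) p (C := {(extChartAt (𝓡 k) p).symm y})
    isClosed_singleton (by simpa using coord_mem p hy)
  have hc : ContinuousAt (fun z => (C.coordDet p χ hχ ((extChartAt (𝓡 k) p).symm z)).re) y :=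
    Complex.continuous_re.continuousAt.comp
      ((C.coordDet p χ hχ).contMDiff.continuous.continuousAt.comp (continuousAt_coord_symm p hy))
  refine hc.congr ?_
  filter_upwards [(continuousAt_coord_symm p hy).eventually (h1 _ rfl),
    extChartAt_target_mem_nhds' hy] with z hz hzt
  rw [C.coordDet_apply p χ hχ hzt hz, Complex.ofReal_re]

theorem continuousOn_density (p : M) :
    ContinuousOn (C.density p) (extChartAt (𝓡 k) p).target := fun _ hy =>
  (C.continuousAt_det_coordMatrix p hy).abs.continuousWithinAt

/-- The integral of a function against the volume form, over one chart. -/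
def chartInt (p : M) (g : Fn k M) : ℂ :=
  ∫ y in (extChartAt (𝓡 k) p).target, (C.density p y : ℂ) * g ((extChartAt (𝓡 k) p).symm y)

/-- The integrand is continuous on the chart image and vanishes there off the compact image of the
support, so the behaviour of the density near the boundary is irrelevant. -/
theorem integrableOn_chart (p : M) (g : Fn k M) (hg : HasCompactSupport g)
    (hgp : tsupport g ⊆ (chartAt (EuclideanSpace ℝ (Fin k)) p).source) :
    IntegrableOn (fun y => (C.density p y : ℂ) * g ((extChartAt (𝓡 k) p).symm y))
      (extChartAt (𝓡 k) p).target := by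
  have hsrc : tsupport g ⊆ (extChartAt (𝓡 k) p).source := by rwa [extChartAt_source]
  have hK : IsCompact (extChartAt (𝓡 k) p '' tsupport g) :=
    IsCompact.image_of_continuousOn hg ((continuousOn_extChartAt p).mono hsrc)
  have hKt : extChartAt (𝓡 k) p '' tsupport g ⊆ (extChartAt (𝓡 k) p).target := by
    rintro _ ⟨x, hx, rfl⟩
    exact (extChartAt (𝓡 k) p).map_source (hsrc hx)
  have hcont : ContinuousOn (fun y => (C.density p y : ℂ) * g ((extChartAt (𝓡 k) p).symm y))
      (extChartAt (𝓡 k) p).target :=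
    (Complex.continuous_ofReal.comp_continuousOn (C.continuousOn_density p)).mul
      (g.contMDiff.continuous.comp_continuousOn fun y hy =>
        (continuousAt_coord_symm p hy).continuousWithinAt)
  refine ((hcont.mono hKt).integrableOn_compact hK).of_forall_sdiff_eq_zero
    (isOpen_extChartAt_target p).measurableSet ?_
  rintro y ⟨hy, hyK⟩
  have h0 : g ((extChartAt (𝓡 k) p).symm y) = 0 := image_eq_zero_of_notMem_tsupport fun hyg =>
    hyK ⟨_, hyg, (extChartAt (𝓡 k) p).right_inv hy⟩
  rw [h0, mul_zero]

theorem contract_eq_sum_coordComp (q : M) {x : M}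
    (hx : x ∈ (chartAt (EuclideanSpace ℝ (Fin k)) q).source) (Y : RVec k M) (a : Fin k) :
    contract Y.toCVec (C.e a) x =
      ((∑ c, C.coordMatrix q (extChartAt (𝓡 k) q x) a c * coordComp q x (Y x) c : ℝ) : ℂ) := by
  obtain ⟨z, hz, rfl⟩ := exists_coord q hx
  rw [(extChartAt (𝓡 k) q).right_inv hz]
  choose Z hZ using fun c => exists_extension ((extChartAt (𝓡 k) q).symm z) (coordVec q z c)
  have hYZ : Y ((extChartAt (𝓡 k) q).symm z) =
      (∑ c, coordComp q _ (Y ((extChartAt (𝓡 k) q).symm z)) c • Z c)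
        ((extChartAt (𝓡 k) q).symm z) := by
    rw [RVec.sum_apply]
    conv_lhs => rw [← sum_coordVec q hz (Y ((extChartAt (𝓡 k) q).symm z))]
    refine Finset.sum_congr rfl fun c _ => ?_
    rw [← hZ c]
    rfl
  rw [contract_toCVec_congr _ hYZ, RVec.toCVec_sum, contract_sum, sumFn_apply]
  push_cast
  refine Finset.sum_congr rfl fun c _ => ?_
  have h5 : ∀ r : ℝ, (r • Z c).toCVec = (cst (r : ℂ) : Fn k M) • (Z c).toCVec := by
    intro r
    rw [RVec.toCVec_smul]
    ext u x
    exact Complex.real_smul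
  rw [h5, contract_smul]
  change (_ : ℂ) * _ = _
  rw [C.contract_eq_coordMatrix q z (hZ c), cst_apply, mul_comm]

/-- The transition map between two charts. -/
def transition (p q : M) : EuclideanSpace ℝ (Fin k) → EuclideanSpace ℝ (Fin k) :=
  extChartAt (𝓡 k) q ∘ (extChartAt (𝓡 k) p).symm

theorem hasFDerivAt_transition (p q : M) {y : EuclideanSpace ℝ (Fin k)}
    (hy : y ∈ (extChartAt (𝓡 k) p).target)
    (hq : (extChartAt (𝓡 k) p).symm y ∈ (chartAt (EuclideanSpace ℝ (Fin k)) q).source) :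
    ∃ L : EuclideanSpace ℝ (Fin k) →L[ℝ] EuclideanSpace ℝ (Fin k),
      HasFDerivAt (transition p q) L y ∧
      ∀ b, L (EuclideanSpace.single b 1) = coordComp q _ (coordVec p y b) := by
  have : IsManifold (𝓡 k) 1 M := isManifold_one
  have h1 := (mdifferentiableAt_coord_symm p hy).hasMFDerivAt
  have h2 := (mdifferentiableAt_extChartAt (I := 𝓡 k) hq).hasMFDerivAt
  have h3 := HasMFDerivAt.comp y h2 h1
  exact ⟨_, h3.hasFDerivAt, fun b => rfl⟩

/-- The coframe matrices in two charts differ by right multiplication with the Jacobian matrix of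
the transition map. -/
theorem density_transition (p q : M) {y : EuclideanSpace ℝ (Fin k)}
    (hy : y ∈ (extChartAt (𝓡 k) p).target)
    (hq : (extChartAt (𝓡 k) p).symm y ∈ (chartAt (EuclideanSpace ℝ (Fin k)) q).source) :
    C.density p y = |(fderiv ℝ (transition p q) y).det| * C.density q (transition p q y) := by
  obtain ⟨L, hL, hLb⟩ := hasFDerivAt_transition p q hy hq
  rw [hL.fderiv]
  have hmat : C.coordMatrix p y = C.coordMatrix q (transition p q y) *
      LinearMap.toMatrix (EuclideanSpace.basisFun (Fin k) ℝ).toBasis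
        (EuclideanSpace.basisFun (Fin k) ℝ).toBasis (L : _ →ₗ[ℝ] _) := by
    ext a b
    obtain ⟨Y, hY⟩ := exists_extension ((extChartAt (𝓡 k) p).symm y) (coordVec p y b)
    have h1 := C.contract_eq_coordMatrix p y hY a
    rw [C.contract_eq_sum_coordComp q hq Y a] at h1
    have h2 := (Complex.ofReal_injective h1).symm
    rw [h2, Matrix.mul_apply]
    refine Finset.sum_congr rfl fun c _ => ?_
    rw [LinearMap.toMatrix_apply, hY, ← hLb]
    simp [transition]
  rw [density, hmat, Matrix.det_mul, abs_mul, mul_comm, LinearMap.det_toMatrix]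
  rfl

/-- The support conditions confine both integrals to the overlap of the charts, where the change of
variables formula for the transition map applies. No integrability is needed for it. -/
theorem chartInt_eq_of_support (p q : M) (g : Fn k M)
    (hp : ∀ x ∉ (chartAt (EuclideanSpace ℝ (Fin k)) p).source, g x = 0)
    (hq : ∀ x ∉ (chartAt (EuclideanSpace ℝ (Fin k)) q).source, g x = 0) :
    C.chartInt p g = C.chartInt q g := by
  set s : Set (EuclideanSpace ℝ (Fin k)) := (extChartAt (𝓡 k) p).target ∩
    (extChartAt (𝓡 k) p).symm ⁻¹' (chartAt (EuclideanSpace ℝ (Fin k)) q).source with hs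
  set t : Set (EuclideanSpace ℝ (Fin k)) := (extChartAt (𝓡 k) q).target ∩
    (extChartAt (𝓡 k) q).symm ⁻¹' (chartAt (EuclideanSpace ℝ (Fin k)) p).source with ht
  have hsm : MeasurableSet s := by
    refine ((continuousOn_extChartAt_symm p).isOpen_inter_preimage (isOpen_extChartAt_target p)
      (chartAt (EuclideanSpace ℝ (Fin k)) q).open_source).measurableSet
  have himg : transition p q '' s = t := by
    ext z
    constructor
    · rintro ⟨y, ⟨hy, hyq⟩, rfl⟩
      have hyq' : (extChartAt (𝓡 k) p).symm y ∈ (extChartAt (𝓡 k) q).source := by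
        rwa [extChartAt_source]
      refine ⟨(extChartAt (𝓡 k) q).map_source hyq', ?_⟩
      rw [Set.mem_preimage, transition, Function.comp_apply, (extChartAt (𝓡 k) q).left_inv hyq']
      exact coord_mem p hy
    · rintro ⟨hz, hzp⟩
      have hzp' : (extChartAt (𝓡 k) q).symm z ∈ (extChartAt (𝓡 k) p).source := by
        rwa [extChartAt_source]
      refine ⟨extChartAt (𝓡 k) p ((extChartAt (𝓡 k) q).symm z),
        ⟨(extChartAt (𝓡 k) p).map_source hzp', ?_⟩, ?_⟩
      · rw [Set.mem_preimage, (extChartAt (𝓡 k) p).left_inv hzp']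
        exact coord_mem q hz
      · change extChartAt (𝓡 k) q ((extChartAt (𝓡 k) p).symm (extChartAt (𝓡 k) p _)) = z
        rw [(extChartAt (𝓡 k) p).left_inv hzp', (extChartAt (𝓡 k) q).right_inv hz]
  have hback : ∀ y ∈ s, (extChartAt (𝓡 k) q).symm (transition p q y) =
      (extChartAt (𝓡 k) p).symm y := by
    rintro y ⟨hy, hyq⟩
    exact (extChartAt (𝓡 k) q).left_inv (by rwa [extChartAt_source])
  have hinj : Set.InjOn (transition p q) s := by
    intro y hy y' hy' h
    have h1 := hback y hy
    rw [h, hback y' hy'] at h1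
    have h2 := congrArg (extChartAt (𝓡 k) p) h1
    rwa [(extChartAt (𝓡 k) p).right_inv hy.1, (extChartAt (𝓡 k) p).right_inv hy'.1, eq_comm] at h2
  have hcv := integral_image_eq_integral_abs_det_fderiv_smul volume hsm
    (f := transition p q) (f' := fun y => fderiv ℝ (transition p q) y)
    (fun y hy => by
      obtain ⟨L, hL, -⟩ := hasFDerivAt_transition p q hy.1 hy.2
      exact hL.differentiableAt.hasFDerivAt.hasFDerivWithinAt) hinj
    (fun z => (C.density q z : ℂ) * g ((extChartAt (𝓡 k) q).symm z))
  rw [himg] at hcv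
  have h1 : C.chartInt p g = ∫ y in s, (C.density p y : ℂ) * g ((extChartAt (𝓡 k) p).symm y) := by
    refine setIntegral_eq_of_subset_of_forall_sdiff_eq_zero
      (isOpen_extChartAt_target p).measurableSet Set.inter_subset_left ?_
    rintro y ⟨hy, hys⟩
    rw [hq _ fun h => hys ⟨hy, h⟩, mul_zero]
  have h2 : C.chartInt q g = ∫ y in t, (C.density q y : ℂ) * g ((extChartAt (𝓡 k) q).symm y) := by
    refine setIntegral_eq_of_subset_of_forall_sdiff_eq_zero
      (isOpen_extChartAt_target q).measurableSet Set.inter_subset_left ?_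
    rintro y ⟨hy, hys⟩
    rw [hp _ fun h => hys ⟨hy, h⟩, mul_zero]
  rw [h1, h2, hcv]
  refine setIntegral_congr_fun hsm fun y hy => ?_
  change (C.density p y : ℂ) * _ = |(fderiv ℝ (transition p q) y).det| •
    ((C.density q (transition p q y) : ℂ) * g ((extChartAt (𝓡 k) q).symm (transition p q y)))
  rw [hback y hy, C.density_transition p q hy.1 hy.2, Complex.real_smul]
  push_cast
  ring

theorem chartInt_add (p : M) (g h : Fn k M) (hg : HasCompactSupport g) (hh : HasCompactSupport h)
    (hgp : tsupport g ⊆ (chartAt (EuclideanSpace ℝ (Fin k)) p).source)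
    (hhp : tsupport h ⊆ (chartAt (EuclideanSpace ℝ (Fin k)) p).source) :
    C.chartInt p (g + h) = C.chartInt p g + C.chartInt p h := by
  rw [chartInt, chartInt, chartInt, ← integral_add (C.integrableOn_chart p g hg hgp)
    (C.integrableOn_chart p h hh hhp)]
  congr 1
  funext y
  exact mul_add _ _ _

theorem chartInt_cst_mul (p : M) (c : ℂ) (g : Fn k M) :
    C.chartInt p (cst c * g) = c * C.chartInt p g := by
  rw [chartInt, chartInt, ← integral_const_mul]
  congr 1
  funext y
  exact mul_left_comm _ _ _

theorem chartInt_zero (p : M) : C.chartInt p 0 = 0 := by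
  rw [chartInt]
  simp

theorem tsupport_mul_left_subset (f g : Fn k M) : tsupport (f * g : Fn k M) ⊆ tsupport f :=
  tsupport_mul_subset_left

theorem tsupport_mul_right_subset (f g : Fn k M) : tsupport (f * g : Fn k M) ⊆ tsupport g :=
  tsupport_mul_subset_right

theorem chartInt_sum {ι : Type*} (s : Finset ι) (p : M) (g : ι → Fn k M)
    (hg : ∀ i, HasCompactSupport (g i))
    (hgp : ∀ i, tsupport (g i) ⊆ (chartAt (EuclideanSpace ℝ (Fin k)) p).source) :
    HasCompactSupport (∑ i ∈ s, g i : Fn k M) ∧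
    tsupport (∑ i ∈ s, g i : Fn k M) ⊆ (chartAt (EuclideanSpace ℝ (Fin k)) p).source ∧
    C.chartInt p (∑ i ∈ s, g i) = ∑ i ∈ s, C.chartInt p (g i) := by
  classical
  induction s using Finset.induction_on with
  | empty =>
    refine ⟨?_, ?_, ?_⟩
    · exact HasCompactSupport.zero
    · have : tsupport ((∑ i ∈ (∅ : Finset ι), g i : Fn k M) : M → ℂ) = ∅ := tsupport_eq_empty_iff.2 rfl
      rw [this]
      exact Set.empty_subset _
    · simp [chartInt_zero]
  | insert a s ha ih =>
    obtain ⟨h1, h2, h3⟩ := ih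
    rw [Finset.sum_insert ha, Finset.sum_insert ha]
    refine ⟨(hg a).add h1, ?_, ?_⟩
    · exact (tsupport_add (g a) _).trans (Set.union_subset (hgp a) h2)
    · rw [C.chartInt_add p _ _ (hg a) h1 (hgp a) h2, h3]

/-- The partition of unity subordinate to the charts, as complex-valued functions. -/
def chartPart (p : M) : Fn k M := ofRealFn (chartPartition k M p)

theorem tsupport_chartPart (p : M) :
    tsupport (chartPart p : Fn k M) ⊆ (chartAt (EuclideanSpace ℝ (Fin k)) p).source := by
  have h := (SmoothPartitionOfUnity.exists_isSubordinate_chartAt_source (𝓡 k) M).choose_spec p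
  refine Set.Subset.trans (closure_mono ?_) h
  intro x hx hx0
  apply hx
  change ((chartPartition k M p x : ℝ) : ℂ) = 0
  have : chartPartition k M p x = 0 := hx0
  rw [this, Complex.ofReal_zero]

/-- The integral of a function against the volume form of the coframe. -/
def volInt (g : Fn k M) : ℂ := ∑ᶠ p : M, C.chartInt p (chartPart p * g)

theorem integral_eq_volInt (φ : Form k M k) : integral C.e φ = C.volInt (φ C.basis) := by
  rw [integral_eq, volInt]
  refine finsum_congr fun p => ?_
  rw [chartInt]
  congr 1
  funext y
  change _ = (C.density p y : ℂ) * (((chartPartition k M p _ : ℝ) : ℂ) * _)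
  push_cast
  ring

/-- Local finiteness provides one finite set of charts for all functions vanishing off `K`. This
replaces the `finsum` by finite sums over a common index set, from which additivity follows. -/
theorem exists_finset_partition {K : Set M} (hK : IsCompact K) :
    ∃ S : Finset M, ∀ g : Fn k M, (∀ x ∉ K, g x = 0) →
      C.volInt g = ∑ p ∈ S, C.chartInt p (chartPart p * g) ∧ ∑ p ∈ S, chartPart p * g = g := by
  classical
  have hfin := (chartPartition k M).locallyFinite.finite_nonempty_inter_compact hK
  refine ⟨hfin.toFinset, fun g hg => ⟨?_, ?_⟩⟩
  · refine finsum_eq_sum_of_support_subset _ ?_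
    intro p hp
    rw [Set.Finite.coe_toFinset]
    by_contra hne
    apply hp
    have h0 : chartPart p * g = 0 := by
      ext x
      change ((chartPartition k M p x : ℝ) : ℂ) * g x = 0
      by_cases hx : x ∈ K
      · have : chartPartition k M p x = 0 := by
          by_contra h
          exact hne ⟨x, h, hx⟩
        rw [this, Complex.ofReal_zero, zero_mul]
      · rw [hg x hx, mul_zero]
    simp only [h0]
    exact C.chartInt_zero p
  · ext x
    rw [sumFn_apply]
    change ∑ p ∈ _, ((chartPartition k M p x : ℝ) : ℂ) * g x = g x
    rw [← Finset.sum_mul]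
    by_cases hx : x ∈ K
    · have h1 := (chartPartition k M).sum_eq_one (Set.mem_univ x)
      rw [finsum_eq_sum_of_support_subset (s := hfin.toFinset)] at h1
      · rw [← Complex.ofReal_sum, h1, Complex.ofReal_one, one_mul]
      · intro p hp
        rw [Set.Finite.coe_toFinset]
        exact ⟨x, hp, hx⟩
    · rw [hg x hx, mul_zero]

theorem notMem_tsupport_zero (g : Fn k M) : ∀ x ∉ tsupport g, g x = 0 :=
  fun _ hx => image_eq_zero_of_notMem_tsupport hx

theorem hasCompactSupport_chartPart_mul (p : M) (g : Fn k M) (hg : HasCompactSupport g) :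
    HasCompactSupport (chartPart p * g : Fn k M) := HasCompactSupport.mul_left hg

/-- Each piece of the partition is supported in the domain of its own chart and in that of `q`, so
it can be integrated in the chart at `q`, where the pieces add up to `g`. -/
theorem volInt_eq_chartInt (q : M) (g : Fn k M) (hg : HasCompactSupport g)
    (hgq : tsupport g ⊆ (chartAt (EuclideanSpace ℝ (Fin k)) q).source) :
    C.volInt g = C.chartInt q g := by
  obtain ⟨S, hS⟩ := C.exists_finset_partition hg
  obtain ⟨h1, h2⟩ := hS g (notMem_tsupport_zero g)
  rw [h1]
  conv_rhs => rw [← h2]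
  rw [(C.chartInt_sum S q _ (fun p => hasCompactSupport_chartPart_mul p g hg)
    fun p => (tsupport_mul_right_subset _ _).trans hgq).2.2]
  refine Finset.sum_congr rfl fun p _ => C.chartInt_eq_of_support p q _ ?_ ?_
  · intro x hx
    exact notMem_tsupport_zero _ x fun h => hx
      (tsupport_chartPart p (tsupport_mul_left_subset _ _ h))
  · intro x hx
    exact notMem_tsupport_zero _ x fun h => hx (hgq (tsupport_mul_right_subset _ _ h))

theorem volInt_add (g h : Fn k M) (hg : HasCompactSupport g) (hh : HasCompactSupport h) :
    C.volInt (g + h) = C.volInt g + C.volInt h := by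
  obtain ⟨S, hS⟩ := C.exists_finset_partition (IsCompact.union hg hh)
  rw [(hS (g + h) ?_).1, (hS g ?_).1, (hS h ?_).1, ← Finset.sum_add_distrib]
  · refine Finset.sum_congr rfl fun p _ => ?_
    rw [mul_add]
    exact C.chartInt_add p _ _ (hasCompactSupport_chartPart_mul p g hg)
      (hasCompactSupport_chartPart_mul p h hh)
      ((tsupport_mul_left_subset _ _).trans (tsupport_chartPart p))
      ((tsupport_mul_left_subset _ _).trans (tsupport_chartPart p))
  · exact fun x hx => notMem_tsupport_zero h x fun h' => hx (Or.inr h')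
  · exact fun x hx => notMem_tsupport_zero g x fun h' => hx (Or.inl h')
  · intro x hx
    change g x + h x = 0
    rw [notMem_tsupport_zero h x fun h' => hx (Or.inr h'),
      notMem_tsupport_zero g x fun h' => hx (Or.inl h'), add_zero]

theorem volInt_cst_mul (c : ℂ) (g : Fn k M) (hg : HasCompactSupport g) :
    C.volInt (cst c * g) = c * C.volInt g := by
  obtain ⟨S, hS⟩ := C.exists_finset_partition hg
  rw [(hS g (notMem_tsupport_zero g)).1, (hS (cst c * g) ?_).1, Finset.mul_sum]
  · refine Finset.sum_congr rfl fun p _ => ?_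
    rw [mul_left_comm, chartInt_cst_mul]
  · intro x hx
    change c * g x = 0
    rw [notMem_tsupport_zero g x hx, mul_zero]

theorem volInt_zero : C.volInt 0 = 0 := by
  simp [volInt, chartInt_zero]

theorem volInt_sum {ι : Type*} (s : Finset ι) (g : ι → Fn k M)
    (hg : ∀ i, HasCompactSupport (g i)) :
    HasCompactSupport (∑ i ∈ s, g i : Fn k M) ∧
    C.volInt (∑ i ∈ s, g i) = ∑ i ∈ s, C.volInt (g i) := by
  classical
  induction s using Finset.induction_on with
  | empty => exact ⟨HasCompactSupport.zero, by simp [volInt_zero]⟩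
  | insert a s ha ih =>
    rw [Finset.sum_insert ha, Finset.sum_insert ha]
    exact ⟨(hg a).add ih.1, by rw [C.volInt_add _ _ (hg a) ih.1, ih.2]⟩

end RealCoframe

end Integrals

end TwistedDirac

end

open scoped Manifold ContDiff TensorProduct Topology

noncomputable section

namespace TwistedDirac

/-! ### Lie derivatives of forms and their supports -/

section LieDerivatives

set_option linter.unusedSectionVars false

variable {k : ℕ} {M : Type*} [TopologicalSpace M] [ChartedSpace (EuclideanSpace ℝ (Fin k)) M]

theorem lieForm_apply {p : ℕ} (X : CVec k M) (φ : Form k M p) (Y : Fin p → CVec k M) :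
    lieForm X φ Y = X (φ Y) - ∑ i, φ (Function.update Y i ⁅X, Y i⁆) := rfl

theorem form_smul_apply {p : ℕ} (f : Fn k M) (φ : Form k M p) (Y : Fin p → CVec k M) :
    (f • φ) Y = f * φ Y := rfl

theorem form_sum_apply {p : ℕ} {ι : Type*} (s : Finset ι) (φ : ι → Form k M p)
    (Y : Fin p → CVec k M) : (∑ i ∈ s, φ i) Y = ∑ i ∈ s, φ i Y := by
  classical
  induction s using Finset.induction_on with
  | empty => rfl
  | insert a s ha ih => rw [Finset.sum_insert ha, Finset.sum_insert ha, ← ih]; rfl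

theorem lieForm_add_form {p : ℕ} (X : CVec k M) (φ τ : Form k M p) :
    lieForm X (φ + τ) = lieForm X φ + lieForm X τ := by
  ext1 Y
  rw [AlternatingMap.add_apply, lieForm_apply, lieForm_apply, lieForm_apply, AlternatingMap.add_apply,
    map_add]
  simp only [AlternatingMap.add_apply, Finset.sum_add_distrib]
  ring

theorem lieForm_smul_form {p : ℕ} (X : CVec k M) (f : Fn k M) (φ : Form k M p) :
    lieForm X (f • φ) = X f • φ + f • lieForm X φ := by
  ext1 Y
  rw [AlternatingMap.add_apply, lieForm_apply, form_smul_apply, form_smul_apply, form_smul_apply,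
    lieForm_apply, Derivation.leibniz, mul_sub, Finset.mul_sum]
  simp only [form_smul_apply, smul_eq_mul]
  ring

theorem lieForm_sum_form {p : ℕ} {ι : Type*} (s : Finset ι) (X : CVec k M) (φ : ι → Form k M p) :
    lieForm X (∑ i ∈ s, φ i) = ∑ i ∈ s, lieForm X (φ i) :=
  map_sum (AddMonoidHom.mk' (lieForm X) (lieForm_add_form X)) φ s

theorem lieForm_sum_vec {p : ℕ} {ι : Type*} (s : Finset ι) (X : ι → CVec k M) (φ : Form k M p) :
    lieForm (∑ i ∈ s, X i) φ = ∑ i ∈ s, lieForm (X i) φ :=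
  map_sum (AddMonoidHom.mk' (fun X => lieForm X φ) fun X Y => lieForm_add X Y φ) X s

theorem smul_lie_vec (g : Fn k M) (Y Z : CVec k M) : ⁅g • Y, Z⁆ = g • ⁅Y, Z⁆ - Z g • Y := by
  ext1 u
  simp [Derivation.commutator_apply]
  ring

variable [IsManifold (𝓡 k) ∞ M]

theorem toCVec_eq_zero_of_eventually (X : RVec k M) {f : Fn k M} {x : M}
    (h : ∀ᶠ z in 𝓝 x, f z = 0) : X.toCVec f x = 0 := by
  have : ⇑f =ᶠ[𝓝 x] ⇑(0 : Fn k M) := h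
  rw [X.toCVec_congr this, map_zero]
  rfl

/-- A form vanishes outside a set. -/
def VanishesOff {p : ℕ} (K : Set M) (φ : Form k M p) : Prop := ∀ Y, ∀ x ∉ K, φ Y x = 0

theorem VanishesOff.lieForm {p : ℕ} {K : Set M} (hK : IsClosed K) {φ : Form k M p}
    (hφ : VanishesOff K φ) (X : RVec k M) : VanishesOff K (lieForm X.toCVec φ) := by
  intro Y x hx
  rw [lieForm_apply]
  change X.toCVec (φ Y) x - (∑ i, φ (Function.update Y i ⁅X.toCVec, Y i⁆) : Fn k M) x = 0
  rw [sumFn_apply, Finset.sum_eq_zero fun i _ => hφ _ x hx, sub_zero]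
  refine toCVec_eq_zero_of_eventually X ?_
  filter_upwards [hK.isOpen_compl.mem_nhds hx] with z hz using hφ Y z hz

theorem VanishesOff.smul {p : ℕ} {f : Fn k M} {K : Set M} (hf : ∀ x ∉ K, f x = 0)
    (φ : Form k M p) : VanishesOff K (f • φ) := by
  intro Y x hx
  change f x * φ Y x = 0
  rw [hf x hx, zero_mul]

end LieDerivatives

/-! ### Integrals of Lie derivatives and positivity of the integral -/

section Stokes

set_option linter.unusedSectionVars false

open MeasureTheory

variable {k : ℕ} {M : Type*} [TopologicalSpace M] [ChartedSpace (EuclideanSpace ℝ (Fin k)) M]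
  [IsManifold (𝓡 k) ∞ M]

namespace RealCoframe

variable (C : RealCoframe k M)

theorem topForm_ext {φ τ : Form k M k} (h : φ C.basis = τ C.basis) : φ = τ := by
  ext1 Y
  rw [C.topForm_apply φ, C.topForm_apply τ, h]

/-- The volume form of a coframe. -/
def vol : Form k M k := C.basis.det

theorem vol_basis : C.vol C.basis = 1 := C.basis.det_self

theorem eq_smul_vol (φ : Form k M k) : φ = φ C.basis • C.vol := φ.eq_smul_basis_det C.basis

theorem topForm_update (φ : Form k M k) (i : Fin k) (Y : CVec k M) :
    φ (Function.update C.basis i Y) = contract Y (C.e i) * φ C.basis := by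
  conv_lhs => rw [← C.sum_contract_smul Y]
  rw [φ.map_update_sum, Finset.sum_eq_single i]
  · rw [φ.map_update_smul, Function.update_eq_self]
    rfl
  · intro j _ hj
    rw [φ.map_update_smul, φ.map_update_self _ hj.symm, smul_zero]
  · simp

/-- For top forms L_Y φ = d ι_Y φ and ι_{gY} φ = ι_Y (gφ). The proof avoids the exterior derivative:
evaluated on the dual frame, both sides are g L_Y φ + (Y g) φ, because Y g is the sum of the
components of Y times the frame derivatives of g. -/
theorem lieForm_smul_vec (C : RealCoframe k M) (g : Fn k M) (Y : CVec k M) (φ : Form k M k) :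
    lieForm (g • Y) φ = lieForm Y (g • φ) := by
  refine C.topForm_ext ?_
  rw [lieForm_smul_form, AlternatingMap.add_apply, form_smul_apply, form_smul_apply, lieForm_apply,
    lieForm_apply]
  have h : ∀ i, φ (Function.update C.basis i ⁅g • Y, C.basis i⁆) =
      g * φ (Function.update C.basis i ⁅Y, C.basis i⁆) -
        C.basis i g * (contract Y (C.e i) * φ C.basis) := by
    intro i
    rw [smul_lie_vec, φ.map_update_sub, φ.map_update_smul, φ.map_update_smul,
      C.topForm_update φ i Y]
    rfl
  have hY : Y g = ∑ i, contract Y (C.e i) * C.basis i g := by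
    conv_lhs => rw [← C.sum_contract_smul Y]
    rw [sumVec_apply]
    rfl
  simp only [h]
  rw [Finset.sum_sub_distrib, ← Finset.mul_sum, hY, Finset.sum_mul, mul_sub,
    Derivation.smul_apply, smul_eq_mul]
  have : ∀ i, C.basis i g * (contract Y (C.e i) * φ C.basis) =
      contract Y (C.e i) * C.basis i g * φ C.basis := fun i => by ring
  simp only [this]
  ring

variable [T2Space M] [SigmaCompactSpace M]

theorem two_le_infty : (2 : WithTop ℕ∞) ≤ ((⊤ : ℕ∞) : WithTop ℕ∞) :=
  WithTop.coe_le_coe.2 (le_top : (2 : ℕ∞) ≤ ⊤)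

/-- Where the cut-off is locally 1 the bracket vanishes by symmetry of second derivatives; the
factor `h` restricts attention to that region. -/
theorem smul_coordField_lie (q : M) (χ : ContMDiffMap (𝓡 k) 𝓘(ℝ, ℝ) M ℝ ∞) (hχ : IsCutoff q χ)
    (h : Fn k M) (hq : tsupport h ⊆ (chartAt (EuclideanSpace ℝ (Fin k)) q).source)
    (h1 : ∀ x ∈ tsupport h, ∀ᶠ z in 𝓝 x, χ z = 1) (i j : Fin k) :
    h • ⁅(coordField q χ hχ i).toCVec, (coordField q χ hχ j).toCVec⁆ = 0 := by
  ext u x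
  change h x * (⁅(coordField q χ hχ i).toCVec, (coordField q χ hχ j).toCVec⁆ u) x = 0
  by_cases hx : x ∈ tsupport h
  · obtain ⟨y, hy, rfl⟩ := exists_coord q (hq hx)
    rw [Derivation.commutator_apply]
    have key : ∀ i j, (coordField q χ hχ i).toCVec ((coordField q χ hχ j).toCVec u)
        ((extChartAt (𝓡 k) q).symm y) =
        fderiv ℝ (fderiv ℝ (u ∘ (extChartAt (𝓡 k) q).symm)) y (EuclideanSpace.single i 1)
          (EuclideanSpace.single j 1) := by
      intro i j
      rw [coordField_toCVec q χ hχ i _ hy, (h1 _ hx).self_of_nhds, one_smul]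
      have he : ((coordField q χ hχ j).toCVec u ∘ (extChartAt (𝓡 k) q).symm) =ᶠ[𝓝 y]
          fun z => fderiv ℝ (u ∘ (extChartAt (𝓡 k) q).symm) z (EuclideanSpace.single j 1) := by
        filter_upwards [(continuousAt_coord_symm q hy).eventually (h1 _ hx),
          extChartAt_target_mem_nhds' hy] with z hz hzt
        rw [Function.comp_apply, coordField_toCVec q χ hχ j u hzt, hz, one_smul]
      rw [he.fderiv_eq]
      have hd : DifferentiableAt ℝ (fderiv ℝ (u ∘ (extChartAt (𝓡 k) q).symm)) y :=
        ((contDiffAt_coord u q hy).fderiv_right (m := 1)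
          two_le_infty).differentiableAt (by simp)
      rw [fderiv_clm_apply hd (differentiableAt_const _)]
      simp
    change h _ * ((coordField q χ hχ i).toCVec ((coordField q χ hχ j).toCVec u) _ -
      (coordField q χ hχ j).toCVec ((coordField q χ hχ i).toCVec u) _) = 0
    rw [key i j, key j i, ((contDiffAt_coord u q hy).isSymmSndFDerivAt
      (by simpa using two_le_infty)).eq, sub_self,
      mul_zero]
  · rw [notMem_tsupport_zero h x hx, zero_mul]

/-- Integration by parts against the constant function 1. -/
theorem integral_fderiv_eq_zero {F : EuclideanSpace ℝ (Fin k) → ℂ} (hF : Differentiable ℝ F)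
    (hc : HasCompactSupport F) (v : EuclideanSpace ℝ (Fin k))
    (hi : Integrable fun y => fderiv ℝ F y v) : ∫ y, fderiv ℝ F y v = 0 := by
  have h := integral_mul_fderiv_eq_neg_fderiv_mul_of_integrable (μ := volume)
    (f := fun _ : EuclideanSpace ℝ (Fin k) => (1 : ℂ)) (g := F) (v := v)
    (by simp) (by simpa using hi)
    (by simpa using hF.continuous.integrable_of_hasCompactSupport hc)
    (fun _ _ => differentiableAt_const _) (fun y _ => hF y)
  simpa using h

/-- Both sides are the Lie derivative of `h • C.vol` evaluated on the coordinate fields. The bracket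
terms drop out by `smul_coordField_lie`, leaving the coordinate formula for the divergence. -/
theorem lieForm_coordField_basis (q : M) (χ : ContMDiffMap (𝓡 k) 𝓘(ℝ, ℝ) M ℝ ∞)
    (hχ : IsCutoff q χ) (h : Fn k M)
    (hq : tsupport h ⊆ (chartAt (EuclideanSpace ℝ (Fin k)) q).source)
    (h1 : ∀ x ∈ tsupport h, ∀ᶠ z in 𝓝 x, χ z = 1) (i : Fin k) :
    lieForm (coordField q χ hχ i).toCVec (h • C.vol) C.basis * C.coordDet q χ hχ =
      (coordField q χ hχ i).toCVec (h * C.coordDet q χ hχ) := by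
  rw [coordDet, ← C.topForm_apply _ fun b => (coordField q χ hχ b).toCVec, lieForm_apply]
  rw [Finset.sum_eq_zero, sub_zero]
  · rw [form_smul_apply, C.topForm_apply C.vol, vol_basis, one_mul]
  · intro j _
    rw [form_smul_apply, ← smul_eq_mul, ← AlternatingMap.map_update_smul,
      smul_coordField_lie q χ hχ h hq h1]
    exact AlternatingMap.map_update_zero _ _ _

/-- In coordinates the integrand is the partial derivative of sign(det) · h · det, extended by zero
outside the chart image. The sign passes through the derivative because det is continuous without
zeros and its sign is therefore locally constant. -/
theorem chartInt_lieForm_coordField (q : M) (χ : ContMDiffMap (𝓡 k) 𝓘(ℝ, ℝ) M ℝ ∞)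
    (hχ : IsCutoff q χ) (h : Fn k M) (hc : HasCompactSupport h)
    (hq : tsupport h ⊆ (chartAt (EuclideanSpace ℝ (Fin k)) q).source)
    (h1 : ∀ x ∈ tsupport h, ∀ᶠ z in 𝓝 x, χ z = 1) (i : Fin k) :
    C.chartInt q (lieForm (coordField q χ hχ i).toCVec (h • C.vol) C.basis) = 0 := by
  set g := lieForm (coordField q χ hχ i).toCVec (h • C.vol) C.basis with hg
  have hgD := C.lieForm_coordField_basis q χ hχ h hq h1 i
  rw [← hg] at hgD
  have hg0 : ∀ x ∉ tsupport h, g x = 0 :=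
    (VanishesOff.smul (notMem_tsupport_zero h) C.vol).lieForm (isClosed_tsupport h) _ C.basis
  have hgs : tsupport g ⊆ tsupport h := closure_minimal (fun x hx => by
    by_contra hxh
    exact hx (hg0 x hxh)) (isClosed_tsupport h)
  have hgc : HasCompactSupport g := hc.of_isClosed_subset (isClosed_tsupport g) hgs
  have hsrc : tsupport h ⊆ (extChartAt (𝓡 k) q).source := by rwa [extChartAt_source]
  set K := extChartAt (𝓡 k) q '' tsupport h with hKdef
  have hK : IsCompact K :=
    IsCompact.image_of_continuousOn hc ((continuousOn_extChartAt q).mono hsrc)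
  have hKt : K ⊆ (extChartAt (𝓡 k) q).target := by
    rintro _ ⟨x, hx, rfl⟩
    exact (extChartAt (𝓡 k) q).map_source (hsrc hx)
  have hKmem : ∀ y ∈ (extChartAt (𝓡 k) q).target, y ∉ K →
      (extChartAt (𝓡 k) q).symm y ∉ tsupport h := fun y hy hyK hyh =>
    hyK ⟨_, hyh, (extChartAt (𝓡 k) q).right_inv hy⟩
  set F : EuclideanSpace ℝ (Fin k) → ℂ := Set.indicator (extChartAt (𝓡 k) q).target fun y =>
    (Real.sign (C.coordMatrix q y).det : ℂ) *
      (h * C.coordDet q χ hχ : Fn k M) ((extChartAt (𝓡 k) q).symm y) with hF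
  have hFoff : ∀ y ∉ K, F y = 0 := by
    intro y hy
    by_cases hyt : y ∈ (extChartAt (𝓡 k) q).target
    · rw [hF, Set.indicator_of_mem hyt]
      change _ * (h _ * _) = _
      rw [notMem_tsupport_zero h _ (hKmem y hyt hy), zero_mul, mul_zero]
    · rw [hF, Set.indicator_of_notMem hyt]
  have hFloc : ∀ y ∈ K, F =ᶠ[𝓝 y] fun z => (Real.sign (C.coordMatrix q y).det : ℂ) *
      (h * C.coordDet q χ hχ : Fn k M) ((extChartAt (𝓡 k) q).symm z) := by
    intro y hy
    have hcont := C.continuousAt_det_coordMatrix q (hKt hy)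
    have hne := C.det_coordMatrix_ne_zero q (hKt hy)
    have hsign : ∀ᶠ z in 𝓝 y, Real.sign (C.coordMatrix q z).det =
        Real.sign (C.coordMatrix q y).det := by
      rcases lt_or_gt_of_ne hne with hlt | hgt
      · filter_upwards [hcont.eventually (gt_mem_nhds hlt)] with z hz
        rw [Real.sign_of_neg hz, Real.sign_of_neg hlt]
      · filter_upwards [hcont.eventually (lt_mem_nhds hgt)] with z hz
        rw [Real.sign_of_pos hz, Real.sign_of_pos hgt]
    filter_upwards [hsign, extChartAt_target_mem_nhds' (hKt hy)] with z hz hzt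
    rw [hF, Set.indicator_of_mem hzt, hz]
  have hdiffK : ∀ y ∈ K, DifferentiableAt ℝ
      ((h * C.coordDet q χ hχ : Fn k M) ∘ (extChartAt (𝓡 k) q).symm) y := fun y hy =>
    (contDiffAt_coord _ q (hKt hy)).differentiableAt (by simp)
  have hFdiff : Differentiable ℝ F := by
    intro y
    by_cases hy : y ∈ K
    · exact ((hdiffK y hy).const_mul _).congr_of_eventuallyEq (hFloc y hy)
    · refine (differentiableAt_const (0 : ℂ)).congr_of_eventuallyEq ?_
      filter_upwards [hK.isClosed.isOpen_compl.mem_nhds hy] with z hz using hFoff z hz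
  have hsym : ∀ y ∈ K, (extChartAt (𝓡 k) q).symm y ∈ tsupport h := by
    rintro _ ⟨x, hx, rfl⟩
    rwa [(extChartAt (𝓡 k) q).left_inv (hsrc hx)]
  have hFd : (fun y => fderiv ℝ F y (EuclideanSpace.single i 1)) =
      Set.indicator (extChartAt (𝓡 k) q).target fun y =>
        (C.density q y : ℂ) * g ((extChartAt (𝓡 k) q).symm y) := by
    funext y
    by_cases hy : y ∈ K
    · rw [Set.indicator_of_mem (hKt hy), (hFloc y hy).fderiv_eq]
      have hχ1 : χ ((extChartAt (𝓡 k) q).symm y) = 1 := (h1 _ (hsym y hy)).self_of_nhds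
      have h3 := fderiv_const_mul (hdiffK y hy) (Real.sign (C.coordMatrix q y).det : ℂ)
      have h4 := congrArg (fun L => L (EuclideanSpace.single i (1 : ℝ))) h3
      refine h4.trans ?_
      have h5 := coordField_toCVec q χ hχ i (h * C.coordDet q χ hχ) (hKt hy)
      rw [hχ1, one_smul, ← hgD] at h5
      change _ * fderiv ℝ ((h * C.coordDet q χ hχ : Fn k M) ∘ (extChartAt (𝓡 k) q).symm) y
        (EuclideanSpace.single i 1) = _
      rw [← h5]
      change _ * (g _ * C.coordDet q χ hχ _) = _
      rw [C.coordDet_apply q χ hχ (hKt hy) hχ1, density]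
      have hs : ∀ r : ℝ, (|r| : ℝ) = Real.sign r * r := by
        intro r
        rcases lt_trichotomy r 0 with hr | rfl | hr
        · rw [Real.sign_of_neg hr, abs_of_neg hr]; ring
        · simp
        · rw [Real.sign_of_pos hr, abs_of_pos hr]; ring
      rw [hs]
      push_cast
      ring
    · have h0 : F =ᶠ[𝓝 y] fun _ => 0 := by
        filter_upwards [hK.isClosed.isOpen_compl.mem_nhds hy] with z hz using hFoff z hz
      rw [h0.fderiv_eq]
      by_cases hyt : y ∈ (extChartAt (𝓡 k) q).target
      · rw [Set.indicator_of_mem hyt, hg0 _ (hKmem y hyt hy)]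
        simp
      · rw [Set.indicator_of_notMem hyt]
        simp
  have hint : Integrable fun y => fderiv ℝ F y (EuclideanSpace.single i 1) := by
    rw [hFd, integrable_indicator_iff (isOpen_extChartAt_target q).measurableSet]
    exact C.integrableOn_chart q g hgc (hgs.trans hq)
  have := integral_fderiv_eq_zero hFdiff (HasCompactSupport.intro hK hFoff) _ hint
  rw [hFd, integral_indicator (isOpen_extChartAt_target q).measurableSet] at this
  exact this

theorem hasCompactSupport_lieForm_smul_vol (X : RVec k M) (h : Fn k M)
    (hc : HasCompactSupport h) :
    tsupport (lieForm X.toCVec (h • C.vol) C.basis) ⊆ tsupport h ∧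
      HasCompactSupport (lieForm X.toCVec (h • C.vol) C.basis) := by
  have hg0 : ∀ x ∉ tsupport h, lieForm X.toCVec (h • C.vol) C.basis x = 0 :=
    (VanishesOff.smul (notMem_tsupport_zero h) C.vol).lieForm (isClosed_tsupport h) _ C.basis
  have hgs : tsupport (lieForm X.toCVec (h • C.vol) C.basis) ⊆ tsupport h :=
    closure_minimal (fun x hx => by
      by_contra hxh
      exact hx (hg0 x hxh)) (isClosed_tsupport h)
  exact ⟨hgs, hc.of_isClosed_subset (isClosed_tsupport _) hgs⟩

/-- The field is expanded in coordinate fields and `lieForm_smul_vec` moves the coefficient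
functions from the field to the form, which reduces everything to coordinate fields. -/
theorem chartInt_lieForm (q : M) (X : RVec k M) (h : Fn k M) (hc : HasCompactSupport h)
    (hq : tsupport h ⊆ (chartAt (EuclideanSpace ℝ (Fin k)) q).source) :
    C.chartInt q (lieForm X.toCVec (h • C.vol) C.basis) = 0 := by
  obtain ⟨χ₁, χ₂, h₁, h₂, h12, hC⟩ := exists_cutoff_pair q (isClosed_tsupport h) hq
  have hχh : ofRealFn χ₂ * h = h := by
    ext x
    change (χ₂ x : ℂ) * h x = h x
    by_cases hx : x ∈ tsupport h
    · rw [(hC x hx).self_of_nhds, Complex.ofReal_one, one_mul]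
    · rw [notMem_tsupport_zero h x hx, mul_zero]
  have hsum : lieForm X.toCVec (h • C.vol) =
      ∑ i, lieForm (coordField q χ₂ h₂ i).toCVec ((X.toCVec (coordFn q χ₁ h₁ i) * h) • C.vol) := by
    conv_lhs => rw [← hχh, ← smul_smul, ← C.lieForm_smul_vec,
      smul_toCVec_eq_sum X q χ₁ χ₂ h₁ h₂ h12, lieForm_sum_vec]
    refine Finset.sum_congr rfl fun i _ => ?_
    rw [C.lieForm_smul_vec, smul_smul]
  have hs : ∀ i, tsupport (X.toCVec (coordFn q χ₁ h₁ i) * h : Fn k M) ⊆ tsupport h := fun i =>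
    tsupport_mul_right_subset _ _
  have hsc : ∀ i, HasCompactSupport (X.toCVec (coordFn q χ₁ h₁ i) * h : Fn k M) := fun i =>
    HasCompactSupport.mul_left hc
  rw [hsum, form_sum_apply, (C.chartInt_sum Finset.univ q _
    (fun i => (C.hasCompactSupport_lieForm_smul_vol _ _ (hsc i)).2)
    (fun i => ((C.hasCompactSupport_lieForm_smul_vol _ _ (hsc i)).1.trans (hs i)).trans hq)).2.2]
  exact Finset.sum_eq_zero fun i _ => C.chartInt_lieForm_coordField q χ₂ h₂ _ (hsc i)
    ((hs i).trans hq) (fun x hx => hC x (hs i hx)) i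

/-- The integral of the Lie derivative of a compactly supported top form vanishes. -/
theorem integral_lieForm_eq_zero (X : RVec k M) (φ : Form k M k) {K : Set M} (hK : IsCompact K)
    (hφ : VanishesOff K φ) : integral C.e (lieForm X.toCVec φ) = 0 := by
  set f := φ C.basis with hf
  have hfc : HasCompactSupport f := HasCompactSupport.intro hK (hφ C.basis)
  obtain ⟨S, hS⟩ := C.exists_finset_partition hfc
  have h2 := (hS f (notMem_tsupport_zero f)).2
  have hsum : lieForm X.toCVec φ = ∑ p ∈ S, lieForm X.toCVec ((chartPart p * f) • C.vol) := by
    rw [← lieForm_sum_form, ← Finset.sum_smul, h2, hf, ← C.eq_smul_vol]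
  have hc : ∀ p, HasCompactSupport (chartPart p * f : Fn k M) := fun p =>
    hasCompactSupport_chartPart_mul p f hfc
  rw [C.integral_eq_volInt, hsum, form_sum_apply, (C.volInt_sum S _
    fun p => (C.hasCompactSupport_lieForm_smul_vol _ _ (hc p)).2).2]
  refine Finset.sum_eq_zero fun p _ => ?_
  have hp : tsupport (chartPart p * f : Fn k M) ⊆
      (chartAt (EuclideanSpace ℝ (Fin k)) p).source :=
    (tsupport_mul_left_subset _ _).trans (tsupport_chartPart p)
  rw [C.volInt_eq_chartInt p _ (C.hasCompactSupport_lieForm_smul_vol _ _ (hc p)).2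
    ((C.hasCompactSupport_lieForm_smul_vol _ _ (hc p)).1.trans hp)]
  exact C.chartInt_lieForm p X _ (hc p) hp

/-- A nonnegative compactly supported function with vanishing integral is zero. -/
theorem eq_zero_of_volInt_eq_zero (g : Fn k M) (hc : HasCompactSupport g)
    (hre : ∀ x, 0 ≤ (g x).re) (him : ∀ x, (g x).im = 0) (h0 : C.volInt g = 0) : g = 0 := by
  obtain ⟨S, hS⟩ := C.exists_finset_partition hc
  obtain ⟨h1, h2⟩ := hS g (notMem_tsupport_zero g)
  have hreal : ∀ p, C.chartInt p (chartPart p * g) =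
      ((∫ y in (extChartAt (𝓡 k) p).target, C.density p y *
        ((chartPart p * g : Fn k M) ((extChartAt (𝓡 k) p).symm y)).re : ℝ) : ℂ) := by
    intro p
    rw [chartInt, ← integral_complex_ofReal]
    congr 1
    funext y
    have : (chartPart p * g : Fn k M) ((extChartAt (𝓡 k) p).symm y) =
        (((chartPart p * g : Fn k M) ((extChartAt (𝓡 k) p).symm y)).re : ℂ) := by
      refine Complex.ext rfl ?_
      change (((chartPartition k M p _ : ℝ) : ℂ) * g _).im = _
      simp [him]
    conv_lhs => rw [this]
    exact (Complex.ofReal_mul _ _).symm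
  have hnn : ∀ p, ∀ x, 0 ≤ ((chartPart p * g : Fn k M) x).re := by
    intro p x
    change 0 ≤ (((chartPartition k M p x : ℝ) : ℂ) * g x).re
    rw [Complex.re_ofReal_mul]
    exact mul_nonneg ((chartPartition k M).nonneg p x) (hre x)
  have hint_nn : ∀ p, 0 ≤ ∫ y in (extChartAt (𝓡 k) p).target, C.density p y *
        ((chartPart p * g : Fn k M) ((extChartAt (𝓡 k) p).symm y)).re := fun p =>
    integral_nonneg fun y => mul_nonneg (abs_nonneg _) (hnn p _)
  rw [h0] at h1
  simp only [hreal] at h1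
  rw [← Complex.ofReal_sum] at h1
  -- A vanishing sum of nonnegative chart contributions has vanishing terms.
  have h3 : ∀ p ∈ S, ∫ y in (extChartAt (𝓡 k) p).target, C.density p y *
        ((chartPart p * g : Fn k M) ((extChartAt (𝓡 k) p).symm y)).re = 0 :=
    (Finset.sum_eq_zero_iff_of_nonneg fun p _ => hint_nn p).1 (by exact_mod_cast h1.symm)
  rw [← h2]
  refine Finset.sum_eq_zero fun p hp => ?_
  have hps : tsupport (chartPart p * g : Fn k M) ⊆
      (chartAt (EuclideanSpace ℝ (Fin k)) p).source :=
    (tsupport_mul_left_subset _ _).trans (tsupport_chartPart p)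
  have hI := C.integrableOn_chart p _ (hasCompactSupport_chartPart_mul p g hc) hps
  have hIre : IntegrableOn (fun y => C.density p y *
      ((chartPart p * g : Fn k M) ((extChartAt (𝓡 k) p).symm y)).re)
      (extChartAt (𝓡 k) p).target := by
    refine hI.re.congr (Filter.Eventually.of_forall fun y => ?_)
    exact Complex.re_ofReal_mul _ _
  have hae := (setIntegral_eq_zero_iff_of_nonneg_ae
    (Filter.Eventually.of_forall fun y => mul_nonneg (abs_nonneg _) (hnn p _)) hIre).1 (h3 p hp)
  -- Continuity on an open set upgrades "almost everywhere" to "everywhere"; afterwards the positive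
  -- density is cancelled.
  have heq := Measure.eqOn_open_of_ae_eq hae (isOpen_extChartAt_target p)
    ((C.continuousOn_density p).mul (Complex.continuous_re.comp_continuousOn
      ((chartPart p * g : Fn k M).contMDiff.continuous.comp_continuousOn fun y hy =>
        (continuousAt_coord_symm p hy).continuousWithinAt))) continuousOn_const
  ext x
  by_cases hx : x ∈ tsupport (chartPart p * g : Fn k M)
  · obtain ⟨y, hy, rfl⟩ := exists_coord p (hps hx)
    have h4 : C.density p y *
      ((chartPart p * g : Fn k M) ((extChartAt (𝓡 k) p).symm y)).re = 0 := heq hy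
    refine Complex.ext ((mul_eq_zero.1 h4).resolve_left (C.density_pos p hy).ne') ?_
    change (((chartPartition k M p _ : ℝ) : ℂ) * g _).im = _
    simp [him]
  · exact notMem_tsupport_zero _ x hx

end RealCoframe

end Stokes

end TwistedDirac

end

open scoped Manifold ContDiff TensorProduct Topology

noncomputable section

namespace TwistedDirac

/-! ### Deformed bilinear operations -/

section Antidiagonal

set_option linter.unusedSectionVars false

open Finset.HasAntidiagonal

variable {Z : Type*} [AddCommMonoid Z]

theorem sum_antidiagonal_assoc (n : ℕ) (f : ℕ → ℕ → ℕ → Z) :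
    ∑ p ∈ antidiagonal n, ∑ q ∈ antidiagonal p.1, f q.1 q.2 p.2 =
      ∑ p ∈ antidiagonal n, ∑ q ∈ antidiagonal p.2, f p.1 q.1 q.2 := by
  rw [Finset.sum_sigma', Finset.sum_sigma']
  refine Finset.sum_nbij' (fun x => ⟨(x.2.1, x.2.2 + x.1.2), (x.2.2, x.1.2)⟩)
    (fun x => ⟨(x.1.1 + x.2.1, x.2.2), (x.1.1, x.2.1)⟩) ?_ ?_ ?_ ?_ ?_
  · rintro ⟨⟨a, b⟩, ⟨c, d⟩⟩ h
    rw [Finset.mem_sigma, mem_antidiagonal, mem_antidiagonal] at h ⊢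
    simp only at h ⊢
    refine ⟨by omega, ?_⟩
    first | rfl | trivial
  · rintro ⟨⟨a, b⟩, ⟨c, d⟩⟩ h
    rw [Finset.mem_sigma, mem_antidiagonal, mem_antidiagonal] at h ⊢
    simp only at h ⊢
    refine ⟨by omega, ?_⟩
    first | rfl | trivial
  · rintro ⟨⟨a, b⟩, ⟨c, d⟩⟩ h
    simp only [Finset.mem_sigma, mem_antidiagonal] at h
    obtain ⟨-, rfl⟩ := h
    rfl
  · rintro ⟨⟨a, b⟩, ⟨c, d⟩⟩ h
    simp only [Finset.mem_sigma, mem_antidiagonal] at h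
    obtain ⟨-, rfl⟩ := h
    rfl
  · rintro ⟨⟨a, b⟩, ⟨c, d⟩⟩ _
    rfl

theorem sum_antidiagonal_left_comm (n : ℕ) (f : ℕ → ℕ → ℕ → Z) :
    ∑ p ∈ antidiagonal n, ∑ q ∈ antidiagonal p.2, f p.1 q.1 q.2 =
      ∑ p ∈ antidiagonal n, ∑ q ∈ antidiagonal p.2, f q.1 p.1 q.2 := by
  rw [← sum_antidiagonal_assoc, ← sum_antidiagonal_assoc n fun a b c => f b a c]
  refine Finset.sum_congr rfl fun p _ => ?_
  exact (Finset.Nat.sum_antidiagonal_swap (n := p.1) (f := fun q => f q.1 q.2 p.2)).symm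

end Antidiagonal

section Twist

set_option linter.unusedSectionVars false

open Finset.HasAntidiagonal

variable {k : ℕ} {M : Type*} [TopologicalSpace M] [ChartedSpace (EuclideanSpace ℝ (Fin k)) M]

theorem cst_mul_cst (c d : ℂ) : (cst c * cst d : Fn k M) = cst (c * d) := rfl

theorem cst_one : (cst 1 : Fn k M) = 1 := rfl

theorem cst_zero : (cst 0 : Fn k M) = 0 := rfl

theorem cst_add (c d : ℂ) : (cst (c + d) : Fn k M) = cst c + cst d := rfl

theorem cst_sum {ι : Type*} (s : Finset ι) (c : ι → ℂ) :
    (cst (∑ i ∈ s, c i) : Fn k M) = ∑ i ∈ s, cst (c i) :=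
  map_sum (AddMonoidHom.mk' (cst : ℂ → Fn k M) cst_add) c s

variable {U W Y Q Z : Type*} [AddCommGroup U] [Module (Fn k M) U] [AddCommGroup W]
  [Module (Fn k M) W] [AddCommGroup Y] [Module (Fn k M) Y] [AddCommGroup Q] [Module (Fn k M) Q]
  [AddCommGroup Z] [Module (Fn k M) Z]

/-- An action of vector fields that is linear over the constants and in which commuting vector
fields act by commuting operators. -/
structure IsAct (act : CVec k M → U → U) : Prop where
  add_vec : ∀ X X' u, act (X + X') u = act X u + act X' u
  smul_vec : ∀ (c : ℝ) X u, act (c • X) u = (cst (c : ℂ) : Fn k M) • act X u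
  add : ∀ X u v, act X (u + v) = act X u + act X v
  smul : ∀ X (c : ℂ) u, act X ((cst c : Fn k M) • u) = (cst c : Fn k M) • act X u
  comm : ∀ X X' u, ⁅X, X'⁆ = 0 → act X (act X' u) = act X' (act X u)

namespace IsAct

variable {act : CVec k M → U → U} (h : IsAct act)
include h

theorem zero (X : CVec k M) : act X 0 = 0 := by simpa using h.add X 0 0

theorem sum {ι : Type*} (s : Finset ι) (X : CVec k M) (u : ι → U) :
    act X (∑ i ∈ s, u i) = ∑ i ∈ s, act X (u i) :=
  map_sum (AddMonoidHom.mk' (act X) (h.add X)) u s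

theorem sum_vec {ι : Type*} (s : Finset ι) (X : ι → CVec k M) (u : U) :
    act (∑ i ∈ s, X i) u = ∑ i ∈ s, act (X i) u :=
  map_sum (AddMonoidHom.mk' (fun X => act X u) fun X X' => h.add_vec X X' u) X s

theorem sub_vec (X X' : CVec k M) (u : U) : act (X - X') u = act X u - act X' u :=
  map_sub (AddMonoidHom.mk' (fun X => act X u) fun X X' => h.add_vec X X' u) X X'

theorem sub (X : CVec k M) (u v : U) : act X (u - v) = act X u - act X v :=
  map_sub (AddMonoidHom.mk' (act X) (h.add X)) u v

theorem pi (ι : Type*) :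
    IsAct (fun (X : CVec k M) (u : ι → U) i => act X (u i)) where
  add_vec X X' u := funext fun i => h.add_vec X X' (u i)
  smul_vec c X u := funext fun i => h.smul_vec c X (u i)
  add X u v := funext fun i => h.add X (u i) (v i)
  smul X c u := funext fun i => h.smul X c (u i)
  comm X X' u hX := funext fun i => h.comm X X' (u i) hX

end IsAct

variable (k M) in
/-- Biadditive maps that are homogeneous over the constants. -/
structure IsBil (B : U → W → Z) : Prop where
  add_left : ∀ u u' w, B (u + u') w = B u w + B u' w
  add_right : ∀ u w w', B u (w + w') = B u w + B u w'
  smul_left : ∀ (c : ℂ) u w, B ((cst c : Fn k M) • u) w = (cst c : Fn k M) • B u w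
  smul_right : ∀ (c : ℂ) u w, B u ((cst c : Fn k M) • w) = (cst c : Fn k M) • B u w

namespace IsBil

variable {B : U → W → Z} (h : IsBil k M B)
include h

theorem sum_left {ι : Type*} (s : Finset ι) (u : ι → U) (w : W) :
    B (∑ i ∈ s, u i) w = ∑ i ∈ s, B (u i) w :=
  map_sum (AddMonoidHom.mk' (fun u => B u w) fun u u' => h.add_left u u' w) u s

theorem sum_right {ι : Type*} (s : Finset ι) (u : U) (w : ι → W) :
    B u (∑ i ∈ s, w i) = ∑ i ∈ s, B u (w i) :=
  map_sum (AddMonoidHom.mk' (B u) (h.add_right u)) w s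

theorem zero_left (w : W) : B 0 w = 0 := by simpa using h.add_left 0 0 w

theorem zero_right (u : U) : B u 0 = 0 := by simpa using h.add_right u 0 0

theorem sub_left (u u' : U) (w : W) : B (u - u') w = B u w - B u' w :=
  map_sub (AddMonoidHom.mk' (fun u => B u w) fun u u' => h.add_left u u' w) u u'

end IsBil

/-- The Leibniz rule for a bilinear operation and a vector field. -/
def Leib (actU : CVec k M → U → U) (actW : CVec k M → W → W) (actZ : CVec k M → Z → Z)
    (B : U → W → Z) (X : CVec k M) : Prop :=
  ∀ u w, actZ X (B u w) = B (actU X u) w + B u (actW X w)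

/-- The undeformed extension of a bilinear operation to formal power series. -/
def conv {U W Z : Type*} [AddCommMonoid Z] (B : U → W → Z) (u : Formal U) (w : Formal W) :
    Formal Z := fun n => ∑ q ∈ antidiagonal n, B (u q.1) (w q.2)

/-- A constant, as a formal power series. -/
def Formal.const {U : Type*} [Zero U] (u : U) : Formal U := fun n => if n = 0 then u else 0

variable [IsManifold (𝓡 k) ∞ M] (F : AbelianTwist k M)
variable {actU : CVec k M → U → U} {actW : CVec k M → W → W} {actY : CVec k M → Y → Y}
  {actQ : CVec k M → Q → Q} {actZ : CVec k M → Z → Z} {B : U → W → Z}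

namespace AbelianTwist

/-- The coefficients of the exponential in the twist. -/
def coef (r : ℕ) : ℂ := (Complex.I / 2) ^ r / (r.factorial : ℂ)

theorem star_apply {U W : Type*} {actU : CVec k M → U → U} {actW : CVec k M → W → W}
    (B : U → W → Z) (u : Formal U) (w : Formal W) (n : ℕ) :
    F.star actU actW B u w n = ∑ p ∈ antidiagonal n, ∑ q ∈ antidiagonal p.2,
      (cst (coef p.1) : Fn k M) • F.iter actU actW B p.1 (u q.1) (w q.2) := rfl

theorem iter_succ {U W : Type*} {actU : CVec k M → U → U} {actW : CVec k M → W → W}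
    {B : U → W → Z} (r : ℕ) (u : U) (w : W) :
    F.iter actU actW B (r + 1) u w = ∑ α, ∑ β, (cst (F.Θ α β : ℂ) : Fn k M) •
        F.iter actU actW B r (actU (F.X α).toCVec u) (actW (F.X β).toCVec w) := rfl

theorem isBil_iter (hU : IsAct actU) (hW : IsAct actW) (hB : IsBil k M B) (r : ℕ) :
    IsBil k M (F.iter actU actW B r) := by
  induction r with
  | zero => exact hB
  | succ r ih =>
    constructor
    · intro u u' w
      simp only [iter_succ, hU.add, ih.add_left, smul_add, Finset.sum_add_distrib]
    · intro u w w'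
      simp only [iter_succ, hW.add, ih.add_right, smul_add, Finset.sum_add_distrib]
    · intro c u w
      simp only [iter_succ, hU.smul, ih.smul_left, Finset.smul_sum, smul_smul, mul_comm]
    · intro c u w
      simp only [iter_succ, hW.smul, ih.smul_right, Finset.smul_sum, smul_smul, mul_comm]

theorem leib_iter (hU : IsAct actU) (hW : IsAct actW) (hZ : IsAct actZ)
    {X : CVec k M} (hX : ∀ α, ⁅X, (F.X α).toCVec⁆ = 0) (hL : Leib actU actW actZ B X) (r : ℕ) :
    Leib actU actW actZ (F.iter actU actW B r) X := by
  induction r with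
  | zero => exact hL
  | succ r ih =>
    intro u w
    simp only [iter_succ]
    rw [hZ.sum, ← Finset.sum_add_distrib]
    refine Finset.sum_congr rfl fun α _ => ?_
    rw [hZ.sum, ← Finset.sum_add_distrib]
    refine Finset.sum_congr rfl fun β _ => ?_
    rw [hZ.smul, ih, hU.comm _ _ _ (hX α), hW.comm _ _ _ (hX β), smul_add]

theorem star_congr_iter {U W U' W' Z' : Type*} [AddCommGroup Z'] [Module (Fn k M) Z']
    {actU : CVec k M → U → U} {actW : CVec k M → W → W} {B : U → W → Z}
    {actU' : CVec k M → U' → U'} {actW' : CVec k M → W' → W'} {B' : U' → W' → Z'}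
    (f : U → U') (g : W → W') (h : Z →+ Z')
    (hc : ∀ (c : ℂ) z, h ((cst c : Fn k M) • z) = (cst c : Fn k M) • h z)
    (hf : ∀ X : RVec k M, ∀ u, f (actU X.toCVec u) = actU' X.toCVec (f u))
    (hg : ∀ X : RVec k M, ∀ w, g (actW X.toCVec w) = actW' X.toCVec (g w))
    (hB : ∀ u w, h (B u w) = B' (f u) (g w)) (r : ℕ) (u : U) (w : W) :
    h (F.iter actU actW B r u w) = F.iter actU' actW' B' r (f u) (g w) := by
  induction r generalizing u w with
  | zero => exact hB u w
  | succ r ih =>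
    simp only [iter_succ, map_sum, hc, ih, hf, hg]

/-- Deformed operations are natural in equivariant maps. -/
theorem map_star {U W U' W' Z' : Type*} [AddCommGroup Z'] [Module (Fn k M) Z']
    {actU : CVec k M → U → U} {actW : CVec k M → W → W} {B : U → W → Z}
    {actU' : CVec k M → U' → U'} {actW' : CVec k M → W' → W'} {B' : U' → W' → Z'}
    (f : U → U') (g : W → W') (h : Z →+ Z')
    (hc : ∀ (c : ℂ) z, h ((cst c : Fn k M) • z) = (cst c : Fn k M) • h z)
    (hf : ∀ X : RVec k M, ∀ u, f (actU X.toCVec u) = actU' X.toCVec (f u))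
    (hg : ∀ X : RVec k M, ∀ w, g (actW X.toCVec w) = actW' X.toCVec (g w))
    (hB : ∀ u w, h (B u w) = B' (f u) (g w)) (u : Formal U) (w : Formal W) (n : ℕ) :
    h (F.star actU actW B u w n) =
      F.star actU' actW' B' (fun n => f (u n)) (fun n => g (w n)) n := by
  rw [star_apply, star_apply]
  simp only [map_sum, hc, F.star_congr_iter f g h hc hf hg hB]

theorem star_add_left (hU : IsAct actU) (hW : IsAct actW) (hB : IsBil k M B)
    (u u' : Formal U) (w : Formal W) :
    F.star actU actW B (u + u') w = F.star actU actW B u w + F.star actU actW B u' w := by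
  funext n
  rw [Pi.add_apply, star_apply, star_apply, star_apply, ← Finset.sum_add_distrib]
  refine Finset.sum_congr rfl fun p _ => ?_
  rw [← Finset.sum_add_distrib]
  refine Finset.sum_congr rfl fun q _ => ?_
  rw [Pi.add_apply, (F.isBil_iter hU hW hB _).add_left, smul_add]

theorem star_sum_left {ι : Type*} (s : Finset ι) (hU : IsAct actU) (hW : IsAct actW)
    (hB : IsBil k M B) (u : ι → Formal U) (w : Formal W) :
    F.star actU actW B (∑ i ∈ s, u i) w = ∑ i ∈ s, F.star actU actW B (u i) w :=
  map_sum (AddMonoidHom.mk' (fun u => F.star actU actW B u w)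
    fun u u' => F.star_add_left hU hW hB u u' w) u s

theorem star_add_right (hU : IsAct actU) (hW : IsAct actW) (hB : IsBil k M B)
    (u : Formal U) (w w' : Formal W) :
    F.star actU actW B u (w + w') = F.star actU actW B u w + F.star actU actW B u w' := by
  funext n
  rw [Pi.add_apply, star_apply, star_apply, star_apply, ← Finset.sum_add_distrib]
  refine Finset.sum_congr rfl fun p _ => ?_
  rw [← Finset.sum_add_distrib]
  refine Finset.sum_congr rfl fun q _ => ?_
  rw [Pi.add_apply, (F.isBil_iter hU hW hB _).add_right, smul_add]

theorem star_sum_right {ι : Type*} (s : Finset ι) (hU : IsAct actU) (hW : IsAct actW)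
    (hB : IsBil k M B) (u : Formal U) (w : ι → Formal W) :
    F.star actU actW B u (∑ i ∈ s, w i) = ∑ i ∈ s, F.star actU actW B u (w i) :=
  map_sum (AddMonoidHom.mk' (F.star actU actW B u) (F.star_add_right hU hW hB u)) w s

theorem star_sub_right (hU : IsAct actU) (hW : IsAct actW) (hB : IsBil k M B)
    (u : Formal U) (w w' : Formal W) :
    F.star actU actW B u (w - w') = F.star actU actW B u w - F.star actU actW B u w' :=
  map_sub (AddMonoidHom.mk' (F.star actU actW B u) (F.star_add_right hU hW hB u)) w w'

/-- The order zero part of the exponential is `conv`. In the remaining terms the twist generator has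
been applied at least once, which is where invariance of an argument can be used. -/
theorem star_sub_conv (u : Formal U) (w : Formal W) (n : ℕ) :
    F.star actU actW B u w n - conv B u w n =
      ∑ p ∈ (antidiagonal n).erase (0, n), ∑ q ∈ antidiagonal p.2,
        (cst (coef p.1) : Fn k M) • F.iter actU actW B p.1 (u q.1) (w q.2) := by
  rw [star_apply, ← Finset.add_sum_erase _ _ (show (0, n) ∈ antidiagonal n by simp)]
  have h0 : (cst (coef 0) : Fn k M) = 1 := by
    have : coef 0 = 1 := by simp [coef]
    rw [this, cst_one]
  simp only [h0, one_smul]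
  exact add_sub_cancel_left _ _

theorem fst_pos_of_mem_erase {n : ℕ} {p : ℕ × ℕ} (hp : p ∈ (antidiagonal n).erase (0, n)) :
    ∃ r, p.1 = r + 1 := by
  rcases p with ⟨a, b⟩
  simp only [Finset.mem_erase, mem_antidiagonal, ne_eq, Prod.mk.injEq, not_and] at hp
  refine ⟨a - 1, ?_⟩
  have : a ≠ 0 := by
    rintro rfl
    exact hp.1 rfl (by omega)
  change a = a - 1 + 1
  omega

/-- If the twist acts trivially, the deformed operation is the undeformed one. -/
theorem star_eq_conv (u : Formal U) (w : Formal W)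
    (h : ∀ r i j, F.iter actU actW B (r + 1) (u i) (w j) = 0) :
    F.star actU actW B u w = conv B u w := by
  funext n
  rw [← sub_eq_zero, star_sub_conv]
  refine Finset.sum_eq_zero fun p hp => Finset.sum_eq_zero fun q _ => ?_
  obtain ⟨r, hr⟩ := fst_pos_of_mem_erase hp
  rw [hr, h, smul_zero]

theorem iter_succ_eq_zero_left (hU : IsAct actU) (hW : IsAct actW) (hB : IsBil k M B) {u : U}
    (hu : ∀ α, actU (F.X α).toCVec u = 0) (r : ℕ) (w : W) :
    F.iter actU actW B (r + 1) u w = 0 := by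
  rw [iter_succ]
  refine Finset.sum_eq_zero fun α _ => Finset.sum_eq_zero fun β _ => ?_
  rw [hu, (F.isBil_iter hU hW hB r).zero_left, smul_zero]

/-! ### Associativity -/

section Assoc

variable (k M) in
/-- The operator `T ↦ T ∘ (∑ Θ^{αβ} X_α ⊗ X_β)` on functions of three variables, where `X_α`, `X_β`
act through the maps `a`, `b` of the set of arguments. -/
def pairOp (F : AbelianTwist k M) {A : Type*} (a b : CVec k M → A → A) :
    Module.End (Fn k M) (A → Z) where
  toFun T x := ∑ α, ∑ β, (cst (F.Θ α β : ℂ) : Fn k M) • T (a (F.X α).toCVec (b (F.X β).toCVec x))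
  map_add' T T' := by
    funext x
    simp only [Pi.add_apply, smul_add, Finset.sum_add_distrib]
  map_smul' f T := by
    funext x
    simp only [Pi.smul_apply, RingHom.id_apply, Finset.smul_sum, smul_smul, mul_comm]

theorem pairOp_apply {A : Type*} (a b : CVec k M → A → A) (T : A → Z) (x : A) :
    pairOp k M F a b T x = ∑ α, ∑ β, (cst (F.Θ α β : ℂ) : Fn k M) •
      T (a (F.X α).toCVec (b (F.X β).toCVec x)) := rfl

theorem commute_pairOp {A : Type*} (a b c d : CVec k M → A → A)
    (h : ∀ α β γ δ x, c (F.X γ).toCVec (d (F.X δ).toCVec (a (F.X α).toCVec (b (F.X β).toCVec x))) =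
      a (F.X α).toCVec (b (F.X β).toCVec (c (F.X γ).toCVec (d (F.X δ).toCVec x)))) :
    Commute (pairOp (Z := Z) k M F a b) (pairOp k M F c d) := by
  refine LinearMap.ext fun T => funext fun x => ?_
  change pairOp k M F a b (pairOp k M F c d T) x = pairOp k M F c d (pairOp k M F a b T) x
  simp only [pairOp_apply, Finset.smul_sum, smul_smul]
  have e1 : ∀ f : Fin F.m → Fin F.m → Fin F.m → Fin F.m → Z,
      ∑ α, ∑ β, ∑ γ, ∑ δ, f α β γ δ = ∑ γ, ∑ δ, ∑ α, ∑ β, f α β γ δ := by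
    intro f
    rw [Finset.sum_congr rfl fun α _ => Finset.sum_comm, Finset.sum_comm]
    refine Finset.sum_congr rfl fun γ _ => ?_
    rw [Finset.sum_congr rfl fun α _ => Finset.sum_comm, Finset.sum_comm]
  rw [e1]
  refine Finset.sum_congr rfl fun γ _ => Finset.sum_congr rfl fun δ _ => Finset.sum_congr rfl
    fun α _ => Finset.sum_congr rfl fun β _ => ?_
  rw [mul_comm, h]

variable (k M) in
/-- The coefficients of the exponential of an operator. -/
def expCoef (p : Module.End (Fn k M) Z) (r : ℕ) : Module.End (Fn k M) Z :=
  (cst (coef r) : Fn k M) • p ^ r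

theorem coef_mul_choose (n : ℕ) {a b : ℕ} (h : a + b = n) :
    coef n * (n.choose a : ℂ) = coef a * coef b := by
  subst h
  have h1 : ((a + b).choose a : ℂ) * (a.factorial * b.factorial) = (a + b).factorial := by
    exact_mod_cast (by
      have := Nat.choose_mul_factorial_mul_factorial (Nat.le_add_right a b)
      rwa [Nat.add_sub_cancel_left, mul_assoc] at this)
  have ha : (a.factorial : ℂ) ≠ 0 := by exact_mod_cast a.factorial_ne_zero
  have hb : (b.factorial : ℂ) ≠ 0 := by exact_mod_cast b.factorial_ne_zero
  have hab : ((a + b).factorial : ℂ) ≠ 0 := by exact_mod_cast (a + b).factorial_ne_zero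
  unfold coef
  rw [pow_add]
  field_simp
  rw [← h1]
  ring

/-- The law exp(p + q) = exp p · exp q for commuting operators, order by order, from the binomial
theorem. -/
theorem expCoef_add {p q : Module.End (Fn k M) Z} (h : Commute p q) (n : ℕ) :
    expCoef k M (p + q) n = ∑ r ∈ antidiagonal n, expCoef k M p r.1 * expCoef k M q r.2 := by
  unfold expCoef
  rw [h.add_pow', Finset.smul_sum]
  refine Finset.sum_congr rfl fun r hr => ?_
  rw [smul_mul_smul_comm, cst_mul_cst, ← coef_mul_choose n (mem_antidiagonal.1 hr), ← cst_mul_cst,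
    ← smul_smul]
  congr 1
  have : (cst ((n.choose r.1 : ℕ) : ℂ) : Fn k M) = ((n.choose r.1 : ℕ) : Fn k M) := by
    induction n.choose r.1 with
    | zero => simpa using cst_zero
    | succ m ih => rw [Nat.cast_succ, Nat.cast_succ, cst_add, ih, cst_one]
  rw [this, Nat.cast_smul_eq_nsmul]

/-- The term of order `r` in the exponential of the twist. -/
def term (F : AbelianTwist k M) (actU : CVec k M → U → U) (actW : CVec k M → W → W)
    (B : U → W → Z) (r : ℕ) (u : U) (w : W) : Z :=
  (cst (coef r) : Fn k M) • F.iter actU actW B r u w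

theorem isBil_term (hU : IsAct actU) (hW : IsAct actW) (hB : IsBil k M B) (r : ℕ) :
    IsBil k M (F.term actU actW B r) := by
  have h := F.isBil_iter hU hW hB r
  constructor
  · intro u u' w
    rw [term, h.add_left, smul_add]; rfl
  · intro u w w'
    rw [term, h.add_right, smul_add]; rfl
  · intro c u w
    rw [term, h.smul_left, smul_comm]; rfl
  · intro c u w
    rw [term, h.smul_right, smul_comm]; rfl

-- By the Leibniz rule a vector field acting on `B₁ w y` acts on the second plus the third slot. The
-- twist between `u` and this product is therefore p₁₂ + p₁₃ as an operator on functions of three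
-- variables.
variable (actU actW actY) in
theorem iter_right_eq (hU : IsAct actU) (hQ : IsAct actQ)
    {B₁ : W → Y → Q} {B₂ : U → Q → Z} (h₂ : IsBil k M B₂)
    (hL : ∀ α, Leib actW actY actQ B₁ (F.X α).toCVec) (r : ℕ) (u : U) (w : W) (y : Y) :
    F.iter actU actQ B₂ r u (B₁ w y) =
      ((pairOp k M F (fun X x => (actU X x.1, x.2)) (fun X x => (x.1, actW X x.2.1, x.2.2)) +
        pairOp k M F (fun X x => (actU X x.1, x.2)) (fun X x => (x.1, x.2.1, actY X x.2.2)) :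
          Module.End (Fn k M) (U × W × Y → Z)) ^ r)
        (fun x : U × W × Y => B₂ x.1 (B₁ x.2.1 x.2.2)) (u, w, y) := by
  induction r generalizing u w y with
  | zero => rfl
  | succ r ih =>
    rw [pow_succ', iter_succ]
    simp only [hL _ w y, (F.isBil_iter hU hQ h₂ r).add_right, ih, smul_add,
      Finset.sum_add_distrib]
    rfl

variable (actU actW actY) in
theorem iter_left_eq (hU : IsAct actQ) (hY : IsAct actY)
    {B₃ : U → W → Q} {B₄ : Q → Y → Z} (h₄ : IsBil k M B₄)
    (hL : ∀ α, Leib actU actW actQ B₃ (F.X α).toCVec) (r : ℕ) (u : U) (w : W) (y : Y) :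
    F.iter actQ actY B₄ r (B₃ u w) y =
      ((pairOp k M F (fun X x => (actU X x.1, x.2)) (fun X x => (x.1, x.2.1, actY X x.2.2)) +
        pairOp k M F (fun X x => (x.1, actW X x.2.1, x.2.2))
          (fun X x => (x.1, x.2.1, actY X x.2.2)) : Module.End (Fn k M) (U × W × Y → Z)) ^ r)
        (fun x : U × W × Y => B₄ (B₃ x.1 x.2.1) x.2.2) (u, w, y) := by
  induction r generalizing u w y with
  | zero => rfl
  | succ r ih =>
    rw [pow_succ', iter_succ]
    simp only [hL _ u w, (F.isBil_iter hU hY h₄ r).add_left, ih, smul_add,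
      Finset.sum_add_distrib]
    rfl

theorem pairOp_pow_right {B₁ : W → Y → Q} {B₂ : U → Q → Z} (h₂ : IsBil k M B₂) (r : ℕ) :
    ((pairOp k M F (fun X x => (x.1, actW X x.2.1, x.2.2))
      (fun X x => (x.1, x.2.1, actY X x.2.2)) : Module.End (Fn k M) (U × W × Y → Z)) ^ r)
        (fun x : U × W × Y => B₂ x.1 (B₁ x.2.1 x.2.2)) =
      fun x => B₂ x.1 (F.iter actW actY B₁ r x.2.1 x.2.2) := by
  induction r with
  | zero => rfl
  | succ r ih =>
    rw [pow_succ', Module.End.mul_apply, ih]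
    funext x
    rw [pairOp_apply, iter_succ]
    simp only [h₂.sum_right, h₂.smul_right]

theorem pairOp_pow_left {B₃ : U → W → Q} {B₄ : Q → Y → Z} (h₄ : IsBil k M B₄) (r : ℕ) :
    ((pairOp k M F (fun X x => (actU X x.1, x.2)) (fun X x => (x.1, actW X x.2.1, x.2.2)) :
      Module.End (Fn k M) (U × W × Y → Z)) ^ r)
        (fun x : U × W × Y => B₄ (B₃ x.1 x.2.1) x.2.2) =
      fun x => B₄ (F.iter actU actW B₃ r x.1 x.2.1) x.2.2 := by
  induction r with
  | zero => rfl
  | succ r ih =>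
    rw [pow_succ', Module.End.mul_apply, ih]
    funext x
    rw [pairOp_apply, iter_succ]
    simp only [h₄.sum_left, h₄.smul_left]

/-- This is the cocycle identity of an Abelian twist. The operators p₁₂, p₁₃, p₂₃ commute because
the X's do, and both bracketings are exp(p₁₂ + p₁₃ + p₂₃) applied to the undeformed triple product.
-/
theorem sum_term_assoc {R : Type*} [AddCommGroup R] [Module (Fn k M) R]
    {actR : CVec k M → R → R}
    (hU : IsAct actU) (hW : IsAct actW) (hY : IsAct actY) (hQ : IsAct actQ) (hR : IsAct actR)
    {B₁ : W → Y → Q} {B₂ : U → Q → Z} {B₃ : U → W → R} {B₄ : R → Y → Z}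
    (h₂ : IsBil k M B₂) (h₄ : IsBil k M B₄)
    (hL₁ : ∀ X : RVec k M, Leib actW actY actQ B₁ X.toCVec)
    (hL₃ : ∀ X : RVec k M, Leib actU actW actR B₃ X.toCVec)
    (hass : ∀ u w y, B₂ u (B₁ w y) = B₄ (B₃ u w) y) (n : ℕ) (u : U) (w : W) (y : Y) :
    ∑ r ∈ antidiagonal n, F.term actU actQ B₂ r.1 u (F.term actW actY B₁ r.2 w y) =
      ∑ r ∈ antidiagonal n, F.term actR actY B₄ r.1 (F.term actU actW B₃ r.2 u w) y := by
  have hT : (fun x : U × W × Y => B₄ (B₃ x.1 x.2.1) x.2.2) =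
      fun x : U × W × Y => B₂ x.1 (B₁ x.2.1 x.2.2) := funext fun x => (hass _ _ _).symm
  set p₁₂ : Module.End (Fn k M) (U × W × Y → Z) := pairOp k M F
    (fun X x => (actU X x.1, x.2)) (fun X x => (x.1, actW X x.2.1, x.2.2)) with hp₁₂
  set p₁₃ : Module.End (Fn k M) (U × W × Y → Z) := pairOp k M F
    (fun X x => (actU X x.1, x.2)) (fun X x => (x.1, x.2.1, actY X x.2.2)) with hp₁₃
  set p₂₃ : Module.End (Fn k M) (U × W × Y → Z) := pairOp k M F
    (fun X x => (x.1, actW X x.2.1, x.2.2)) (fun X x => (x.1, x.2.1, actY X x.2.2)) with hp₂₃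
  have c₁₂ : Commute p₁₂ p₂₃ := F.commute_pairOp _ _ _ _ fun α β γ δ x => by
    simp only [hW.comm _ _ _ (F.comm β γ)]
  have c₁₃ : Commute p₁₃ p₂₃ := F.commute_pairOp _ _ _ _ fun α β γ δ x => by
    simp only [hY.comm _ _ _ (F.comm β δ)]
  have c' : Commute p₁₃ p₁₂ := F.commute_pairOp _ _ _ _ fun α β γ δ x => by
    simp only [hU.comm _ _ _ (F.comm α γ)]
  have e1 := congrArg (fun p => p (fun x : U × W × Y => B₂ x.1 (B₁ x.2.1 x.2.2)) (u, w, y))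
    (expCoef_add (c₁₂.add_left c₁₃) n)
  have e2 := congrArg (fun p => p (fun x : U × W × Y => B₂ x.1 (B₁ x.2.1 x.2.2)) (u, w, y))
    (expCoef_add (c'.add_left c₁₂.symm) n)
  have e3 : p₁₂ + p₁₃ + p₂₃ = p₁₃ + p₂₃ + p₁₂ := by abel
  rw [e3] at e1
  have e4 := e1.symm.trans e2
  rw [LinearMap.sum_apply, Finset.sum_apply, LinearMap.sum_apply, Finset.sum_apply] at e4
  refine Eq.trans (Finset.sum_congr rfl fun r _ => ?_) (e4.trans (Finset.sum_congr rfl fun r _ => ?_))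
  · change _ = (expCoef k M (p₁₂ + p₁₃) r.1 (expCoef k M p₂₃ r.2 _)) (u, w, y)
    unfold expCoef
    rw [LinearMap.smul_apply, LinearMap.smul_apply, LinearMap.map_smul, hp₂₃,
      F.pairOp_pow_right h₂, hp₁₂, hp₁₃]
    rw [term, term, (F.isBil_iter hU hQ h₂ _).smul_right,
      F.iter_right_eq actU actW actY hU hQ h₂
        (fun α => F.leib_iter hW hY hQ (F.comm α) (hL₁ _) r.2)]
    rfl
  · change (expCoef k M (p₁₃ + p₂₃) r.1 (expCoef k M p₁₂ r.2 _)) (u, w, y) = _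
    unfold expCoef
    rw [LinearMap.smul_apply, LinearMap.smul_apply, LinearMap.map_smul, ← hT, hp₁₂,
      F.pairOp_pow_left h₄, hp₂₃, hp₁₃]
    rw [term, term, (F.isBil_iter hR hY h₄ _).smul_left,
      F.iter_left_eq actU actW actY hR hY h₄
        (fun α => F.leib_iter hU hW hR (F.comm α) (hL₃ _) r.2)]
    rfl

/-- Deformed operations are associative if the undeformed ones are. -/
theorem star_assoc {R : Type*} [AddCommGroup R] [Module (Fn k M) R] {actR : CVec k M → R → R}
    (hU : IsAct actU) (hW : IsAct actW) (hY : IsAct actY) (hQ : IsAct actQ) (hR : IsAct actR)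
    {B₁ : W → Y → Q} {B₂ : U → Q → Z} {B₃ : U → W → R} {B₄ : R → Y → Z}
    (h₂ : IsBil k M B₂) (h₄ : IsBil k M B₄)
    (hL₁ : ∀ X : RVec k M, Leib actW actY actQ B₁ X.toCVec)
    (hL₃ : ∀ X : RVec k M, Leib actU actW actR B₃ X.toCVec)
    (hass : ∀ u w y, B₂ u (B₁ w y) = B₄ (B₃ u w) y)
    (u : Formal U) (w : Formal W) (y : Formal Y) :
    F.star actU actQ B₂ u (F.star actW actY B₁ w y) =
      F.star actR actY B₄ (F.star actU actW B₃ u w) y := by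
  funext n
  have b2 := fun r => F.isBil_term hU hQ h₂ r
  have b4 := fun r => F.isBil_term hR hY h₄ r
  have l1 : F.star actU actQ B₂ u (F.star actW actY B₁ w y) n =
      ∑ p ∈ antidiagonal n, ∑ q ∈ antidiagonal p.2, ∑ t ∈ antidiagonal q.2,
        ∑ v ∈ antidiagonal t.2, F.term actU actQ B₂ p.1 (u q.1)
          (F.term actW actY B₁ t.1 (w v.1) (y v.2)) := by
    change ∑ p ∈ antidiagonal n, ∑ q ∈ antidiagonal p.2, F.term actU actQ B₂ p.1 (u q.1)
      (∑ t ∈ antidiagonal q.2, ∑ v ∈ antidiagonal t.2, F.term actW actY B₁ t.1 (w v.1) (y v.2)) = _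
    simp only [(b2 _).sum_right]
  have r1 : F.star actR actY B₄ (F.star actU actW B₃ u w) y n =
      ∑ p ∈ antidiagonal n, ∑ q ∈ antidiagonal p.2, ∑ t ∈ antidiagonal q.1,
        ∑ v ∈ antidiagonal t.2, F.term actR actY B₄ p.1
          (F.term actU actW B₃ t.1 (u v.1) (w v.2)) (y q.2) := by
    change ∑ p ∈ antidiagonal n, ∑ q ∈ antidiagonal p.2, F.term actR actY B₄ p.1
      (∑ t ∈ antidiagonal q.1, ∑ v ∈ antidiagonal t.2, F.term actU actW B₃ t.1 (u v.1) (w v.2))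
        (y q.2) = _
    simp only [(b4 _).sum_left]
  -- Regrouping brings the orders of the two twists together; `sum_term_assoc` then applies with the
  -- coefficients of the three arguments fixed.
  have l2 : ∀ p : ℕ × ℕ, ∑ q ∈ antidiagonal p.2, ∑ t ∈ antidiagonal q.2,
        ∑ v ∈ antidiagonal t.2, F.term actU actQ B₂ p.1 (u q.1)
          (F.term actW actY B₁ t.1 (w v.1) (y v.2)) =
      ∑ q ∈ antidiagonal p.2, ∑ t ∈ antidiagonal q.2,
        ∑ v ∈ antidiagonal t.2, F.term actU actQ B₂ p.1 (u t.1)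
          (F.term actW actY B₁ q.1 (w v.1) (y v.2)) := fun p =>
    sum_antidiagonal_left_comm p.2 fun a b c => ∑ v ∈ antidiagonal c,
      F.term actU actQ B₂ p.1 (u a) (F.term actW actY B₁ b (w v.1) (y v.2))
  have r2 : ∀ p : ℕ × ℕ, ∑ q ∈ antidiagonal p.2, ∑ t ∈ antidiagonal q.1,
        ∑ v ∈ antidiagonal t.2, F.term actR actY B₄ p.1
          (F.term actU actW B₃ t.1 (u v.1) (w v.2)) (y q.2) =
      ∑ q ∈ antidiagonal p.2, ∑ t ∈ antidiagonal q.2,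
        ∑ v ∈ antidiagonal t.2, F.term actR actY B₄ p.1
          (F.term actU actW B₃ q.1 (u t.1) (w v.1)) (y v.2) := fun p => by
    rw [sum_antidiagonal_assoc p.2 fun a b c => ∑ v ∈ antidiagonal b,
      F.term actR actY B₄ p.1 (F.term actU actW B₃ a (u v.1) (w v.2)) (y c)]
    refine Finset.sum_congr rfl fun q _ => ?_
    exact sum_antidiagonal_assoc q.2 fun a b c =>
      F.term actR actY B₄ p.1 (F.term actU actW B₃ q.1 (u a) (w b)) (y c)
  rw [l1, r1]
  simp only [l2, r2]
  rw [← sum_antidiagonal_assoc n fun a b c => ∑ t ∈ antidiagonal c, ∑ v ∈ antidiagonal t.2,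
      F.term actU actQ B₂ a (u t.1) (F.term actW actY B₁ b (w v.1) (y v.2)),
    ← sum_antidiagonal_assoc n fun a b c => ∑ t ∈ antidiagonal c, ∑ v ∈ antidiagonal t.2,
      F.term actR actY B₄ a (F.term actU actW B₃ b (u t.1) (w v.1)) (y v.2)]
  refine Finset.sum_congr rfl fun p _ => ?_
  rw [Finset.sum_comm, Finset.sum_comm (s := antidiagonal p.1)]
  refine Finset.sum_congr rfl fun t _ => ?_
  rw [Finset.sum_comm, Finset.sum_comm (s := antidiagonal p.1)]
  refine Finset.sum_congr rfl fun v _ => ?_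
  exact F.sum_term_assoc hU hW hY hQ hR h₂ h₄ hL₁ hL₃ hass p.1 _ _ _

end Assoc

end AbelianTwist

end Twist

end TwistedDirac

end

open scoped Manifold ContDiff TensorProduct Topology

noncomputable section

namespace TwistedDirac

/-! ### The actions of vector fields and the bilinear operations -/

section Actions

set_option linter.unusedSectionVars false

variable {k : ℕ} {M : Type*} [TopologicalSpace M] [ChartedSpace (EuclideanSpace ℝ (Fin k)) M]

theorem real_smul_fn (c : ℝ) (f : Fn k M) : c • f = (cst (c : ℂ) : Fn k M) • f := by
  ext x
  exact Complex.real_smul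

theorem cst_smul_vec (c : ℝ) (X : CVec k M) : c • X = (cst (c : ℂ) : Fn k M) • X := by
  ext1 f
  exact real_smul_fn c (X f)

theorem nsmul_fn_cancel {n : ℕ} (hn : n ≠ 0) {f g : Fn k M} (h : n • f = n • g) : f = g := by
  rw [← Nat.cast_smul_eq_nsmul ℝ, ← Nat.cast_smul_eq_nsmul ℝ] at h
  have h1 := congrArg (fun u => (n : ℝ)⁻¹ • u) h
  have hn' : (n : ℝ) ≠ 0 := by exact_mod_cast hn
  simpa only [smul_smul, inv_mul_cancel₀ hn', one_smul] using h1

/-- Derivations are only assumed real linear. The imaginary unit is annihilated because i² = -1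
gives 2i · X(i) = 0. -/
theorem vec_cst (X : CVec k M) (c : ℂ) : X (cst c) = 0 := by
  have hr : ∀ a : ℝ, X (cst (a : ℂ)) = 0 := fun a => by
    have : (cst (a : ℂ) : Fn k M) = a • 1 := by
      rw [real_smul_fn, smul_eq_mul, mul_one]
    rw [this, Derivation.map_smul, Derivation.map_one_eq_zero, smul_zero]
  have hI : X (cst Complex.I) = 0 := by
    have h := X.leibniz (cst Complex.I) (cst Complex.I)
    rw [cst_mul_cst, Complex.I_mul_I] at h
    have h1 := hr (-1)
    rw [Complex.ofReal_neg, Complex.ofReal_one] at h1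
    rw [h1, ← two_nsmul, smul_eq_mul] at h
    have h2 : (2 : ℕ) • (cst Complex.I * X (cst Complex.I)) =
      (2 : ℕ) • (cst Complex.I * (0 : Fn k M)) := by rw [← h, mul_zero, smul_zero]
    have h3 := congrArg (fun f => cst (-Complex.I) * f) (nsmul_fn_cancel two_ne_zero h2)
    simpa only [← mul_assoc, cst_mul_cst, neg_mul, Complex.I_mul_I, neg_neg, cst_one, one_mul,
      mul_zero] using h3
  have : (cst c : Fn k M) = cst (c.re : ℂ) + cst (c.im : ℂ) * cst Complex.I := by
    rw [cst_mul_cst, ← cst_add, Complex.re_add_im]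
  rw [this, map_add, Derivation.leibniz, hr, hr, hI]
  simp

theorem vec_cst_mul (X : CVec k M) (c : ℂ) (f : Fn k M) : X (cst c * f) = cst c * X f := by
  rw [Derivation.leibniz, vec_cst, smul_zero, add_zero, smul_eq_mul]

theorem vec_comm {X X' : CVec k M} (h : ⁅X, X'⁆ = 0) (f : Fn k M) : X (X' f) = X' (X f) := by
  have := congrArg (fun D : CVec k M => D f) h
  rw [Derivation.commutator_apply] at this
  exact sub_eq_zero.1 this

theorem lie_lie_comm {X X' : CVec k M} (h : ⁅X, X'⁆ = 0) (u : CVec k M) :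
    ⁅X, ⁅X', u⁆⁆ = ⁅X', ⁅X, u⁆⁆ := by
  ext1 f
  simp only [Derivation.commutator_apply, map_sub]
  rw [vec_comm h (u f), vec_comm h f]
  abel

theorem isAct_fn : IsAct (fun (X : CVec k M) (f : Fn k M) => X f) where
  add_vec _ _ _ := rfl
  smul_vec c X f := real_smul_fn c (X f)
  add X f g := map_add X f g
  smul X c f := vec_cst_mul X c f
  comm _ _ f h := vec_comm h f

theorem isAct_lieVec : IsAct (lieVec (k := k) (M := M)) where
  add_vec X X' u := add_lie X X' u
  smul_vec c X u := by
    rw [← cst_smul_vec]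
    exact smul_lie c X u
  add X u v := lie_add X u v
  smul X c u := by
    ext1 f
    change X (cst c * u f) - cst c * u (X f) = cst c * (X (u f) - u (X f))
    rw [vec_cst_mul, mul_sub]
  comm _ _ u h := lie_lie_comm h u

/-- Double insertions in distinct slots are symmetric in the two fields; in a single slot the
symmetry is the Jacobi identity. -/
theorem lieForm_comm {p : ℕ} {X X' : CVec k M} (h : ⁅X, X'⁆ = 0) (φ : Form k M p) :
    lieForm X (lieForm X' φ) = lieForm X' (lieForm X φ) := by
  ext1 Y
  simp only [lieForm_apply, map_sub, map_sum, Finset.sum_sub_distrib]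
  rw [vec_comm h]
  have key : ∑ i, ∑ j, φ (Function.update (Function.update Y i ⁅X, Y i⁆) j
        ⁅X', Function.update Y i ⁅X, Y i⁆ j⁆) =
      ∑ i, ∑ j, φ (Function.update (Function.update Y i ⁅X', Y i⁆) j
        ⁅X, Function.update Y i ⁅X', Y i⁆ j⁆) := by
    rw [Finset.sum_comm]
    refine Finset.sum_congr rfl fun i _ => Finset.sum_congr rfl fun j _ => ?_
    rcases eq_or_ne i j with rfl | hij
    · rw [Function.update_self, Function.update_self, Function.update_idem, Function.update_idem,
        lie_lie_comm h]
    · rw [Function.update_of_ne hij, Function.update_of_ne hij.symm, Function.update_comm hij]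
  rw [key]
  abel

theorem isAct_lieForm (p : ℕ) : IsAct (lieForm (k := k) (M := M) (p := p)) where
  add_vec X X' u := lieForm_add X X' u
  smul_vec c X u := lieForm_cst_smul c X u
  add X u v := lieForm_add_form X u v
  smul X c u := by
    ext1 Y
    change X (cst c * u Y) - ∑ i, cst c * u (Function.update Y i ⁅X, Y i⁆) =
      cst c * (X (u Y) - ∑ i, u (Function.update Y i ⁅X, Y i⁆))
    rw [vec_cst_mul, mul_sub, Finset.mul_sum]
  comm _ _ u h := lieForm_comm h u

theorem isAct_lieSpinor : IsAct (lieSpinor (k := k) (M := M)) := isAct_fn.pi _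

theorem isAct_lieSpinorForm : IsAct (lieSpinorForm (k := k) (M := M)) := (isAct_lieForm 1).pi _

theorem isAct_lieMatFn : IsAct (lieMatFn (k := k) (M := M)) := (isAct_fn.pi _).pi _

theorem isAct_lieMatForm (p : ℕ) : IsAct (lieMatForm (k := k) (M := M) (p := p)) :=
  ((isAct_lieForm p).pi _).pi _

theorem leib_smul_form {p : ℕ} (X : CVec k M) :
    Leib (fun X f => X f) lieForm lieForm (fun (f : Fn k M) (φ : Form k M p) => f • φ) X :=
  fun f φ => lieForm_smul_form X f φ

theorem leib_contract (X : CVec k M) :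
    Leib lieVec lieForm (fun X f => X f) (contract (k := k) (M := M)) X := by
  intro v φ
  change X (φ fun _ => v) = φ (fun _ => ⁅X, v⁆) + lieForm X φ fun _ => v
  rw [lieForm_apply, Fin.sum_univ_one]
  have : Function.update (fun _ : Fin 1 => v) 0 ⁅X, v⁆ = fun _ => ⁅X, v⁆ := by
    funext i
    rw [Subsingleton.elim i 0, Function.update_self]
  rw [this]
  abel

theorem leib_apply (X : CVec k M) :
    Leib lieVec (fun X f => X f) (fun X f => X f) (fun (v : CVec k M) (f : Fn k M) => v f) X := by
  intro v f
  change X (v f) = ⁅X, v⁆ f + v (X f)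
  rw [Derivation.commutator_apply]
  abel

theorem leib_mul (X : CVec k M) :
    Leib (fun X f => X f) (fun X f => X f) (fun X f => X f)
      (fun (f g : Fn k M) => f * g) X := by
  intro f g
  change X (f * g) = X f * g + f * X g
  rw [Derivation.leibniz, smul_eq_mul, smul_eq_mul]
  ring

end Actions

/-! ### The Leibniz rule for wedge products and the matrix-valued operations -/

section Wedge

set_option linter.unusedSectionVars false

variable {k : ℕ} {M : Type*} [TopologicalSpace M] [ChartedSpace (EuclideanSpace ℝ (Fin k)) M]

theorem wedge_apply {p q : ℕ} (φ : Form k M p) (τ : Form k M q) (Y : Fin (p + q) → CVec k M) :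
    wedge φ τ Y = LinearMap.mul' (Fn k M) (Fn k M)
      (AlternatingMap.domCoprod' (φ ⊗ₜ[Fn k M] τ) fun i => Y (finSumFinEquiv i)) := rfl

theorem wedge_add_left {p q : ℕ} (φ φ' : Form k M p) (τ : Form k M q) :
    wedge (φ + φ') τ = wedge φ τ + wedge φ' τ := by
  ext1 Y
  rw [AlternatingMap.add_apply]
  simp only [wedge_apply]
  rw [TensorProduct.add_tmul, map_add, AlternatingMap.add_apply, map_add]

theorem wedge_add_right {p q : ℕ} (φ : Form k M p) (τ τ' : Form k M q) :
    wedge φ (τ + τ') = wedge φ τ + wedge φ τ' := by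
  ext1 Y
  rw [AlternatingMap.add_apply]
  simp only [wedge_apply]
  rw [TensorProduct.tmul_add, map_add, AlternatingMap.add_apply, map_add]

theorem wedge_smul_left {p q : ℕ} (f : Fn k M) (φ : Form k M p) (τ : Form k M q) :
    wedge (f • φ) τ = f • wedge φ τ := by
  ext1 Y
  rw [AlternatingMap.smul_apply]
  simp only [wedge_apply]
  rw [← TensorProduct.smul_tmul', map_smul, AlternatingMap.smul_apply, map_smul]

theorem wedge_smul_right {p q : ℕ} (f : Fn k M) (φ : Form k M p) (τ : Form k M q) :
    wedge φ (f • τ) = f • wedge φ τ := by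
  ext1 Y
  rw [AlternatingMap.smul_apply]
  simp only [wedge_apply]
  rw [TensorProduct.tmul_smul, map_smul, AlternatingMap.smul_apply, map_smul]

/-- The wedge product as a sum over all permutations. -/
theorem factorial_smul_wedge {p q : ℕ} (φ : Form k M p) (τ : Form k M q)
    (Y : Fin (p + q) → CVec k M) :
    (p.factorial * q.factorial) • wedge φ τ Y =
      ∑ σ : Equiv.Perm (Fin p ⊕ Fin q), (Equiv.Perm.sign σ : ℤ) •
        (φ (fun i => Y (finSumFinEquiv (σ (Sum.inl i)))) *
          τ (fun i => Y (finSumFinEquiv (σ (Sum.inr i))))) := by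
  have h := congrArg (fun a => LinearMap.mul' (Fn k M) (Fn k M)
    (a fun i => Y (finSumFinEquiv i))) (MultilinearMap.domCoprod_alternization_eq φ τ)
  simp only [Fintype.card_fin] at h
  rw [AlternatingMap.smul_apply, map_nsmul] at h
  refine h.symm.trans ?_
  rw [MultilinearMap.alternatization_apply, map_sum]
  refine Finset.sum_congr rfl fun σ _ => ?_
  rw [Units.smul_def, map_zsmul]
  rfl

/-- Inserting a bracket into slot `l` changes only the factor whose arguments include that slot. -/
theorem lie_mul_aux {p q : ℕ} (X : CVec k M) (φ : Form k M p) (τ : Form k M q)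
    (Y : Fin (p + q) → CVec k M) (e : Fin p ⊕ Fin q ≃ Fin (p + q)) :
    X (φ (fun i => Y (e (Sum.inl i))) * τ (fun i => Y (e (Sum.inr i)))) -
      ∑ l, φ (fun i => Function.update Y l ⁅X, Y l⁆ (e (Sum.inl i))) *
        τ (fun i => Function.update Y l ⁅X, Y l⁆ (e (Sum.inr i))) =
    lieForm X φ (fun i => Y (e (Sum.inl i))) * τ (fun i => Y (e (Sum.inr i))) +
      φ (fun i => Y (e (Sum.inl i))) * lieForm X τ (fun i => Y (e (Sum.inr i))) := by
  rw [← e.sum_comp, Fintype.sum_sum_type, lieForm_apply, lieForm_apply, Derivation.leibniz]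
  have h1 : ∀ (a i : Fin p) v, Function.update Y (e (Sum.inl a)) v (e (Sum.inl i)) =
      Function.update (fun i => Y (e (Sum.inl i))) a v i := fun a i v => by
    simp only [Function.update_apply, e.injective.eq_iff, Sum.inl.injEq]
  have h2 : ∀ (a i : Fin q) v, Function.update Y (e (Sum.inr a)) v (e (Sum.inr i)) =
      Function.update (fun i => Y (e (Sum.inr i))) a v i := fun a i v => by
    simp only [Function.update_apply, e.injective.eq_iff, Sum.inr.injEq]
  have h3 : ∀ (a : Fin p) (i : Fin q) v, Function.update Y (e (Sum.inl a)) v (e (Sum.inr i)) =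
      Y (e (Sum.inr i)) := fun a i v => by
    rw [Function.update_of_ne (e.injective.ne Sum.inr_ne_inl)]
  have h4 : ∀ (a : Fin q) (i : Fin p) v, Function.update Y (e (Sum.inr a)) v (e (Sum.inl i)) =
      Y (e (Sum.inl i)) := fun a i v => by
    rw [Function.update_of_ne (e.injective.ne Sum.inl_ne_inr)]
  simp only [h1, h2, h3, h4, ← Finset.sum_mul, ← Finset.mul_sum, smul_eq_mul]
  ring

/-- After multiplication by p! q! the shuffle sum becomes a sum over all permutations, in which the
rule holds term by term. The factorials are cancelled afterwards. -/
theorem leib_wedge {p q : ℕ} (X : CVec k M) :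
    Leib lieForm lieForm lieForm (wedge (k := k) (M := M) (p := p) (q := q)) X := by
  intro φ τ
  ext1 Y
  refine nsmul_fn_cancel (mul_ne_zero p.factorial_ne_zero q.factorial_ne_zero) ?_
  rw [AlternatingMap.add_apply, smul_add, factorial_smul_wedge, factorial_smul_wedge,
    lieForm_apply, smul_sub, ← map_nsmul, factorial_smul_wedge, Finset.smul_sum]
  simp only [factorial_smul_wedge]
  rw [Finset.sum_comm, map_sum, ← Finset.sum_sub_distrib, ← Finset.sum_add_distrib]
  refine Finset.sum_congr rfl fun σ _ => ?_
  rw [map_zsmul, ← Finset.smul_sum, ← smul_sub, ← smul_add]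
  congr 1
  exact lie_mul_aux X φ τ Y (σ.trans finSumFinEquiv)

/-! ### Operations on matrices and spinors -/

theorem isBil_mul : IsBil k M (fun f g : Fn k M => f * g) where
  add_left := add_mul
  add_right := mul_add
  smul_left _ _ _ := mul_assoc _ _ _
  smul_right _ _ _ := mul_left_comm _ _ _

theorem isBil_smul {W : Type*} [AddCommGroup W] [Module (Fn k M) W] :
    IsBil k M (fun (f : Fn k M) (w : W) => f • w) where
  add_left := add_smul
  add_right := smul_add
  smul_left _ _ _ := mul_smul _ _ _
  smul_right _ _ _ := smul_comm _ _ _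

theorem isBil_contract : IsBil k M (contract (k := k) (M := M)) where
  add_left u u' φ := contract_add u u' φ
  add_right _ _ _ := rfl
  smul_left c u φ := contract_smul (cst c) u φ
  smul_right _ _ _ := rfl

theorem isBil_apply : IsBil k M (fun (v : CVec k M) (f : Fn k M) => v f) where
  add_left _ _ _ := rfl
  add_right v f g := map_add v f g
  smul_left _ _ _ := rfl
  smul_right _ v f := vec_cst_mul v _ f

section Pointwise

variable {U W Z : Type*} [AddCommGroup U] [Module (Fn k M) U] [AddCommGroup W]
  [Module (Fn k M) W] [AddCommGroup Z] [Module (Fn k M) Z] {B : U → W → Z}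
  {actU : CVec k M → U → U} {actW : CVec k M → W → W} {actZ : CVec k M → Z → Z}

theorem IsBil.pi_right (h : IsBil k M B) (ι : Type*) :
    IsBil k M (fun (u : U) (w : ι → W) i => B u (w i)) where
  add_left u u' w := funext fun i => h.add_left u u' (w i)
  add_right u w w' := funext fun i => h.add_right u (w i) (w' i)
  smul_left c u w := funext fun i => h.smul_left c u (w i)
  smul_right c u w := funext fun i => h.smul_right c u (w i)

theorem IsBil.pi_left (h : IsBil k M B) (ι : Type*) :
    IsBil k M (fun (u : ι → U) (w : W) i => B (u i) w) where
  add_left u u' w := funext fun i => h.add_left (u i) (u' i) w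
  add_right u w w' := funext fun i => h.add_right (u i) w w'
  smul_left c u w := funext fun i => h.smul_left c (u i) w
  smul_right c u w := funext fun i => h.smul_right c (u i) w

/-- The dot product built from a bilinear operation. -/
theorem IsBil.sum_pi (h : IsBil k M B) (ι : Type*) [Fintype ι] :
    IsBil k M (fun (u : ι → U) (w : ι → W) => ∑ l, B (u l) (w l)) where
  add_left u u' w := by simp only [Pi.add_apply, h.add_left, Finset.sum_add_distrib]
  add_right u w w' := by simp only [Pi.add_apply, h.add_right, Finset.sum_add_distrib]
  smul_left c u w := by simp only [Pi.smul_apply, h.smul_left, Finset.smul_sum]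
  smul_right c u w := by simp only [Pi.smul_apply, h.smul_right, Finset.smul_sum]

theorem Leib.sum_pi {X : CVec k M} (h : Leib actU actW actZ B X) (hZ : IsAct actZ) (ι : Type*)
    [Fintype ι] :
    Leib (fun X (u : ι → U) i => actU X (u i)) (fun X (w : ι → W) i => actW X (w i)) actZ
      (fun u w => ∑ l, B (u l) (w l)) X :=
  fun u w => by
    rw [hZ.sum, ← Finset.sum_add_distrib]
    exact Finset.sum_congr rfl fun l _ => h (u l) (w l)

end Pointwise

/-! ### The particular operations -/

/-- A one-form times a column of functions. -/
def formSpinor (φ : Form k M 1) (f : Spinor k M) : SpinorForm k M := fun i => f i • φ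

/-- A one-form times a matrix of functions. -/
def formMat (φ : Form k M 1) (h : MatFn k M) : MatForm k M 1 := fun i j => h i j • φ

/-- Contraction of a matrix of one-forms with a vector field. -/
def contractMat (v : CVec k M) (A : MatForm k M 1) : MatFn k M := fun i j => contract v (A i j)

/-- Matrix of functions times column of functions. -/
def mulVecFn (m : MatFn k M) (ψ : Spinor k M) : Spinor k M := fun i => ∑ l, m i l * ψ l

theorem isBil_formSpinor : IsBil k M (formSpinor (k := k) (M := M)) where
  add_left φ φ' f := funext fun i => smul_add (f i) φ φ'
  add_right φ f f' := funext fun i => add_smul (f i) (f' i) φ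
  smul_left c φ f := funext fun i => smul_comm (f i) (cst c : Fn k M) φ
  smul_right c φ f := funext fun i => mul_smul (cst c) (f i) φ

theorem isBil_formMat : IsBil k M (formMat (k := k) (M := M)) where
  add_left φ φ' f := funext fun i => funext fun j => smul_add (f i j) φ φ'
  add_right φ f f' := funext fun i => funext fun j => add_smul (f i j) (f' i j) φ
  smul_left c φ f := funext fun i => funext fun j => smul_comm (f i j) (cst c : Fn k M) φ
  smul_right c φ f := funext fun i => funext fun j => mul_smul (cst c) (f i j) φ

theorem isBil_outerForm : IsBil k M (outerForm (k := k) (M := M)) where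
  add_left θ θ' f := funext fun i => funext fun j => smul_add (f j) (θ i) (θ' i)
  add_right θ f f' := funext fun i => funext fun j => add_smul (f j) (f' j) (θ i)
  smul_left c θ f := funext fun i => funext fun j => smul_comm (f j) (cst c : Fn k M) (θ i)
  smul_right c θ f := funext fun i => funext fun j => mul_smul (cst c) (f j) (θ i)

theorem isBil_contractSpinor : IsBil k M (contractSpinor (k := k) (M := M)) :=
  isBil_contract.pi_right _

theorem isBil_contractMat : IsBil k M (contractMat (k := k) (M := M)) :=
  (isBil_contract.pi_right _).pi_right _

theorem isBil_lieSpinor : IsBil k M (lieSpinor (k := k) (M := M)) := isBil_apply.pi_right _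

theorem isBil_mulVecFn : IsBil k M (mulVecFn (k := k) (M := M)) :=
  (isBil_mul.sum_pi (Fin k)).pi_left (Fin k)

theorem isBil_mulMatForm : IsBil k M (mulMatForm (k := k) (M := M)) where
  add_left m m' A := funext fun i => funext fun j => by
    simp only [mulMatForm, Pi.add_apply, add_smul, Finset.sum_add_distrib]
  add_right m A A' := funext fun i => funext fun j => by
    simp only [mulMatForm, Pi.add_apply, smul_add, Finset.sum_add_distrib]
  smul_left c m A := funext fun i => funext fun j => by
    simp only [mulMatForm, Pi.smul_apply, smul_assoc, Finset.smul_sum]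
  smul_right c m A := funext fun i => funext fun j => by
    simp only [mulMatForm, Pi.smul_apply, Finset.smul_sum, smul_comm (cst c : Fn k M)]

theorem isBil_wedgeMat {p q : ℕ} : IsBil k M (wedgeMat (k := k) (M := M) (p := p) (q := q)) where
  add_left A A' C := funext fun i => funext fun j => by
    simp only [wedgeMat, Pi.add_apply, wedge_add_left, Finset.sum_add_distrib]
  add_right A C C' := funext fun i => funext fun j => by
    simp only [wedgeMat, Pi.add_apply, wedge_add_right, Finset.sum_add_distrib]
  smul_left c A C := funext fun i => funext fun j => by
    simp only [wedgeMat, Pi.smul_apply, wedge_smul_left, Finset.smul_sum]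
  smul_right c A C := funext fun i => funext fun j => by
    simp only [wedgeMat, Pi.smul_apply, wedge_smul_right, Finset.smul_sum]

theorem leib_smul_form_swap {p : ℕ} (X : CVec k M) :
    Leib lieForm (fun X f => X f) lieForm (fun (φ : Form k M p) (f : Fn k M) => f • φ) X :=
  fun φ f => (lieForm_smul_form X f φ).trans (add_comm _ _)

theorem leib_formSpinor (X : CVec k M) : Leib lieForm lieSpinor lieSpinorForm formSpinor X :=
  fun φ f => funext fun i => leib_smul_form_swap X φ (f i)

theorem leib_formMat (X : CVec k M) : Leib lieForm lieMatFn lieMatForm formMat X :=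
  fun φ f => funext fun i => funext fun j => leib_smul_form_swap X φ (f i j)

theorem leib_outer (X : CVec k M) : Leib lieSpinor lieSpinor lieMatFn outer X :=
  fun ψ χ => funext fun i => funext fun j => leib_mul X (ψ i) (χ j)

theorem leib_contractMat (X : CVec k M) : Leib lieVec lieMatForm lieMatFn contractMat X :=
  fun v A => funext fun i => funext fun j => leib_contract X v (A i j)

theorem leib_lieSpinor (X : CVec k M) : Leib lieVec lieSpinor lieSpinor lieSpinor X :=
  fun v ψ => funext fun i => leib_apply X v (ψ i)

theorem leib_mulVecFn (X : CVec k M) : Leib lieMatFn lieSpinor lieSpinor mulVecFn X :=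
  fun m ψ => funext fun i => (leib_mul X).sum_pi isAct_fn (Fin k) (m i) ψ

theorem leib_mulSpinor (X : CVec k M) : Leib lieMatForm lieSpinor lieSpinorForm mulSpinor X :=
  fun A ψ => funext fun i => (leib_smul_form_swap X).sum_pi (isAct_lieForm 1) (Fin k) (A i) ψ

theorem leib_mulMatForm (X : CVec k M) : Leib lieMatFn lieMatForm lieMatForm mulMatForm X :=
  fun m A => funext fun i => funext fun j =>
    (leib_smul_form X).sum_pi (isAct_lieForm 1) (Fin k) (m i) fun l => A l j

theorem leib_wedgeMat {p q : ℕ} (X : CVec k M) :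
    Leib lieMatForm lieMatForm lieMatForm (wedgeMat (k := k) (M := M) (p := p) (q := q)) X :=
  fun A C => funext fun i => funext fun j =>
    (leib_wedge X).sum_pi (isAct_lieForm _) (Fin k) (A i) fun l => C l j

end Wedge

end TwistedDirac

end

open scoped Manifold ContDiff TensorProduct Topology

noncomputable section

namespace TwistedDirac

/-! ### Semi-Killing twists -/

section Splitting

/-- A tensor that vanishes in the quotient by a subspace splits off its components along a
projection modulo the subspace. -/
theorem exists_splitting {V : Type*} [AddCommGroup V] [Module ℝ V] (K : Submodule ℝ V) {m : ℕ}
    (Θ : Matrix (Fin m) (Fin m) ℝ) (X : Fin m → V)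
    (h : ∑ α, ∑ β, Θ α β • (X α ⊗ₜ[ℝ] X β) ∈
      LinearMap.range (TensorProduct.map LinearMap.id K.subtype) ⊔
        LinearMap.range (TensorProduct.map K.subtype LinearMap.id)) :
    ∃ c : Matrix (Fin m) (Fin m) ℝ, (∀ α, X α - ∑ b, c α b • X b ∈ K) ∧
      ∀ b b', ∑ α, ∑ β, Θ α β * c α b * c β b' = 0 := by
  -- `φ` extends a linear section of `L` from the range of `L` to the whole quotient. Since `L ∘ φ`
  -- fixes the classes of the `X α`, the coordinates of `φ [X α]` are coefficients expressing these
  -- classes through each other.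
  set L : (Fin m → ℝ) →ₗ[ℝ] V ⧸ K := Fintype.linearCombination ℝ fun α => K.mkQ (X α) with hL
  obtain ⟨s, hs⟩ := L.rangeRestrict.exists_rightInverse_of_surjective
    (LinearMap.range_eq_top.2 L.surjective_rangeRestrict)
  obtain ⟨φ, hφ⟩ := LinearMap.exists_extend s
  have hmem : ∀ α, K.mkQ (X α) ∈ LinearMap.range L := fun α =>
    ⟨Pi.single α 1, by simp [hL, Fintype.linearCombination_apply_single]⟩
  have hφL : ∀ α, L (φ (K.mkQ (X α))) = K.mkQ (X α) := fun α => by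
    have h1 : φ (K.mkQ (X α)) = s ⟨K.mkQ (X α), hmem α⟩ :=
      LinearMap.congr_fun hφ ⟨K.mkQ (X α), hmem α⟩
    have h2 := LinearMap.congr_fun hs ⟨K.mkQ (X α), hmem α⟩
    rw [h1]
    exact congrArg Subtype.val h2
  refine ⟨fun α b => φ (K.mkQ (X α)) b, fun α => ?_, fun b b' => ?_⟩
  · rw [← Submodule.Quotient.mk_eq_zero, ← Submodule.mkQ_apply, map_sub, map_sum, sub_eq_zero,
      ← hφL α, hL, Fintype.linearCombination_apply]
    simp only [map_smul]
  -- The hypothesis kills the tensor in the tensor square of the quotient; applying the functionals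
  -- `φ_b ⊗ φ_b'` turns this into the relation for the coefficients.
  · have hq : TensorProduct.map K.mkQ K.mkQ (∑ α, ∑ β, Θ α β • (X α ⊗ₜ[ℝ] X β)) = 0 := by
      obtain ⟨y, ⟨y', rfl⟩, z, ⟨z', rfl⟩, hyz⟩ := Submodule.mem_sup.1 h
      rw [← hyz, map_add, ← LinearMap.comp_apply, ← LinearMap.comp_apply,
        ← TensorProduct.map_comp, ← TensorProduct.map_comp]
      have : K.mkQ ∘ₗ K.subtype = 0 := by
        ext x
        simp
      rw [this, TensorProduct.map_zero_right, TensorProduct.map_zero_left]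
      simp
    have h1 := congrArg (TensorProduct.lid ℝ ℝ ∘ TensorProduct.map
      (LinearMap.proj b ∘ₗ φ) (LinearMap.proj b' ∘ₗ φ)) hq
    simp only [Function.comp_apply, map_sum, map_smul, TensorProduct.map_tmul, map_zero,
      LinearMap.comp_apply, LinearMap.proj_apply, TensorProduct.lid_tmul, smul_eq_mul] at h1
    rw [← h1]
    simp only [mul_assoc]

end Splitting

/-! ### Triangular equations for formal power series -/

section Recursion

/-- A triangular operator on formal power series with surjective leading part is surjective. -/
theorem triangular_surjective {U W : Type*} [AddCommGroup U] [AddCommGroup W] (t : U →+ W)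
    (ht : Function.Surjective t) (T : Formal U →+ Formal W)
    (hT : ∀ u n, (∀ m < n, u m = 0) → T u n = t (u n)) : Function.Surjective T := by
  intro w
  choose g hg using ht
  let R : ℕ → Formal U → W := fun n u => T u n - t (u n)
  -- The remainder at order `n` depends on lower coefficients only: triangularity is applied to the
  -- difference of two series. This makes the recursive choice of `u n` well founded.
  have hR : ∀ n u v, (∀ m < n, u m = v m) → R n u = R n v := fun n u v h => by
    have h1 := hT (u - v) n fun m hm => by rw [Pi.sub_apply, h m hm, sub_self]
    rw [map_sub, Pi.sub_apply, Pi.sub_apply, map_sub] at h1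
    change T u n - t (u n) = T v n - t (v n)
    rw [sub_eq_sub_iff_add_eq_add, add_comm, ← sub_eq_sub_iff_add_eq_add, ← neg_sub, ← h1, neg_sub]
  let u : ℕ → U := fun n => Nat.strongRec (motive := fun _ => U)
    (fun n ih => g (w n - R n fun m => if h : m < n then ih m h else 0)) n
  have hu : ∀ n, u n = g (w n - R n fun m => if m < n then u m else 0) := fun n => by
    change Nat.strongRec (motive := fun _ => U) _ n = _
    rw [Nat.strongRec_eq]
    rfl
  refine ⟨u, funext fun n => ?_⟩
  have h1 : t (u n) = w n - R n u := by
    rw [hu n, hg]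
    congr 1
    exact hR n _ _ fun m hm => if_pos hm
  change t (u n) = w n - (T u n - t (u n)) at h1
  rw [sub_sub_eq_add_sub, eq_sub_iff_add_eq, add_comm, add_right_cancel_iff] at h1
  exact h1

/-- A triangular operator on formal power series with injective leading part is injective. -/
theorem triangular_injective {U W : Type*} [AddCommGroup U] [AddCommGroup W] (t : U →+ W)
    (ht : Function.Injective t) (T : Formal U →+ Formal W)
    (hT : ∀ u n, (∀ m < n, u m = 0) → T u n = t (u n)) : Function.Injective T := by
  rw [injective_iff_map_eq_zero] at ht ⊢
  intro u h
  funext n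
  induction n using Nat.strong_induction_on with
  | _ n ih =>
    have h1 := hT u n ih
    rw [h] at h1
    exact ht _ h1.symm

end Recursion

/-! ### Deformed operations with invariant arguments -/

section Twist

set_option linter.unusedSectionVars false

open Finset.HasAntidiagonal

variable {k : ℕ} {M : Type*} [TopologicalSpace M] [ChartedSpace (EuclideanSpace ℝ (Fin k)) M]
  [IsManifold (𝓡 k) ∞ M]
variable {U W Z : Type*} [AddCommGroup U] [Module (Fn k M) U] [AddCommGroup W]
  [Module (Fn k M) W] [AddCommGroup Z] [Module (Fn k M) Z]
variable {actU : CVec k M → U → U} {actW : CVec k M → W → W} {actZ : CVec k M → Z → Z}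
  {B : U → W → Z}

namespace AbelianTwist

variable (F : AbelianTwist k M)

/-- The real vector fields in a set that commute with the vector fields of the twist. -/
def IsSplit (κ : Set (RVec k M)) : Prop :=
  (∀ K ∈ κ, ∀ α, ⁅K.toCVec, (F.X α).toCVec⁆ = 0) ∧
  ∃ c : Matrix (Fin F.m) (Fin F.m) ℝ, (∀ α, F.X α - ∑ b, c α b • F.X b ∈ κ) ∧
      ∀ b b', ∑ α, ∑ β, F.Θ α β * c α b * c β b' = 0

variable {F} {κ : Set (RVec k M)}

theorem toCVec_sum_smul {m : ℕ} (c : Fin m → ℝ) (X : Fin m → RVec k M) :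
    (∑ b, c b • X b).toCVec = ∑ b, c b • (X b).toCVec := by
  rw [RVec.toCVec_sum]
  simp only [RVec.toCVec_smul]

/-- The splitting of the twist into terms with one invariant leg. -/
theorem iter_succ_split (hU : IsAct actU) (hW : IsAct actW) (hB : IsBil k M B)
    {c : Matrix (Fin F.m) (Fin F.m) ℝ} (hc : ∀ b b', ∑ α, ∑ β, F.Θ α β * c α b * c β b' = 0)
    (r : ℕ) (u : U) (w : W) :
    F.iter actU actW B (r + 1) u w = ∑ α, ∑ β, (cst (F.Θ α β : ℂ) : Fn k M) •
      (F.iter actU actW B r (actU (F.X α - ∑ b, c α b • F.X b).toCVec u)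
          (actW (F.X β).toCVec w) +
        F.iter actU actW B r (actU (∑ b, c α b • F.X b).toCVec u)
          (actW (F.X β - ∑ b, c β b • F.X b).toCVec w)) := by
  have hb := F.isBil_iter hU hW hB r
  -- With X = K + C in both legs, this is the C ⊗ C part, which vanishes by the relation on `c`.
  have h0 : ∑ α, ∑ β, (cst (F.Θ α β : ℂ) : Fn k M) •
      F.iter actU actW B r (actU (∑ b, c α b • F.X b).toCVec u)
        (actW (∑ b, c β b • F.X b).toCVec w) = 0 := by
    simp only [toCVec_sum_smul, hU.sum_vec, hW.sum_vec, hU.smul_vec, hW.smul_vec, hb.sum_left,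
      hb.sum_right, hb.smul_left, hb.smul_right, Finset.smul_sum, smul_smul, cst_mul_cst]
    have e : ∀ f : Fin F.m → Fin F.m → Fin F.m → Fin F.m → Z,
        ∑ α, ∑ β, ∑ b, ∑ b', f α β b b' = ∑ b, ∑ b', ∑ α, ∑ β, f α β b b' := by
      intro f
      rw [Finset.sum_congr rfl fun α _ => Finset.sum_comm, Finset.sum_comm]
      refine Finset.sum_congr rfl fun b _ => ?_
      rw [Finset.sum_congr rfl fun α _ => Finset.sum_comm, Finset.sum_comm]
    rw [e]
    refine Finset.sum_eq_zero fun b _ => Finset.sum_eq_zero fun b' _ => ?_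
    simp only [← Finset.sum_smul]
    have h2 : ∑ α, ∑ β, (cst ((F.Θ α β : ℂ) * ((c α b : ℂ) * (c β b' : ℂ))) : Fn k M) = 0 := by
      simp only [← cst_sum]
      rw [← cst_zero]
      congr 1
      rw [← Complex.ofReal_zero, ← hc b b']
      push_cast
      simp only [mul_assoc]
    rw [h2, zero_smul]
  have h1 : ∀ α β, F.iter actU actW B r (actU (F.X α).toCVec u) (actW (F.X β).toCVec w) =
      (F.iter actU actW B r (actU (F.X α - ∑ b, c α b • F.X b).toCVec u) (actW (F.X β).toCVec w) +
        F.iter actU actW B r (actU (∑ b, c α b • F.X b).toCVec u)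
          (actW (F.X β - ∑ b, c β b • F.X b).toCVec w)) +
        F.iter actU actW B r (actU (∑ b, c α b • F.X b).toCVec u)
          (actW (∑ b, c β b • F.X b).toCVec w) := fun α β => by
    rw [add_assoc, ← hb.add_right, ← hW.add_vec, ← RVec.toCVec_add, sub_add_cancel, ← hb.add_left,
      ← hU.add_vec, ← RVec.toCVec_add, sub_add_cancel]
  rw [iter_succ]
  simp only [h1, smul_add _ (_ + _), Finset.sum_add_distrib]
  rw [h0, add_zero]

/-- The twist acts trivially on a pair of invariant arguments. -/
theorem iter_succ_eq_zero (hF : F.IsSplit κ) (hU : IsAct actU) (hW : IsAct actW)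
    (hB : IsBil k M B) {u : U} {w : W} (hu : ∀ K ∈ κ, actU K.toCVec u = 0)
    (hw : ∀ K ∈ κ, actW K.toCVec w = 0) (r : ℕ) : F.iter actU actW B (r + 1) u w = 0 := by
  obtain ⟨-, c, hK, hc⟩ := hF
  rw [iter_succ_split hU hW hB hc]
  refine Finset.sum_eq_zero fun α _ => Finset.sum_eq_zero fun β _ => ?_
  have hb := F.isBil_iter hU hW hB r
  rw [hu _ (hK α), hw _ (hK β), hb.zero_left, hb.zero_right, add_zero, smul_zero]

theorem star_eq_conv_of_invariant (hF : F.IsSplit κ) (hU : IsAct actU) (hW : IsAct actW)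
    (hB : IsBil k M B) {u : Formal U} {w : Formal W} (hu : ∀ K ∈ κ, ∀ n, actU K.toCVec (u n) = 0)
    (hw : ∀ K ∈ κ, ∀ n, actW K.toCVec (w n) = 0) : F.star actU actW B u w = conv B u w :=
  F.star_eq_conv u w fun r i j => iter_succ_eq_zero hF hU hW hB (fun K h => hu K h i)
    (fun K h => hw K h j) r

variable (k M) in
/-- Properties stable under linear combinations with constant coefficients. -/
structure IsStable (P : Z → Prop) : Prop where
  smul : ∀ (c : ℂ) z, P z → P ((cst c : Fn k M) • z)
  zero : P 0
  add : ∀ z z', P z → P z' → P (z + z')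

theorem IsStable.sum {P : Z → Prop} (hP : IsStable k M P) {ι : Type*} (s : Finset ι) {z : ι → Z}
    (hz : ∀ i, P (z i)) : P (∑ i ∈ s, z i) :=
  Finset.sum_induction _ P hP.add hP.zero fun i _ => hz i

/-- Sums of derivatives along invariant directions. -/
def invDeriv (κ : Set (RVec k M)) (actZ : CVec k M → Z → Z) (P : Z → Prop) : AddSubgroup Z :=
  AddSubgroup.closure {z | ∃ K ∈ κ, ∃ z', P z' ∧ z = actZ K.toCVec z'}

theorem smul_mem_invDeriv {P : Z → Prop} (hZ : IsAct actZ) (hP : IsStable k M P)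
    (c : ℂ) {z : Z}
    (hz : z ∈ invDeriv κ actZ P) : (cst c : Fn k M) • z ∈ invDeriv κ actZ P := by
  induction hz using AddSubgroup.closure_induction with
  | mem x h =>
    obtain ⟨K, hK, z', hz', rfl⟩ := h
    exact AddSubgroup.subset_closure ⟨K, hK, _, hP.smul c _ hz', (hZ.smul _ c z').symm⟩
  | zero => rw [smul_zero]; exact zero_mem _
  | add x y _ _ hx hy => rw [smul_add]; exact add_mem hx hy
  | neg x _ hx => rw [smul_neg]; exact neg_mem hx

/-- Terms whose invariant field acts on `w` vanish. In the others it acts on `u`; as it commutes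
with the X's and annihilates `w`, the Leibniz rule pulls it out in front of the whole expression. -/
theorem iter_succ_mem_right (hF : F.IsSplit κ) (hU : IsAct actU) (hW : IsAct actW)
    (hZ : IsAct actZ) (hB : IsBil k M B) (hL : ∀ X : RVec k M, Leib actU actW actZ B X.toCVec)
    {P : Z → Prop} (hP : IsStable k M P) {u : U} {w : W}
    (hw : ∀ K ∈ κ, actW K.toCVec w = 0) (r : ℕ)
    (hu : ∀ w', P (F.iter actU actW B r u w')) :
    F.iter actU actW B (r + 1) u w ∈ invDeriv κ actZ P := by
  obtain ⟨hcomm, c, hK, hc⟩ := hF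
  rw [iter_succ_split hU hW hB hc]
  refine sum_mem fun α _ => sum_mem fun β _ => smul_mem_invDeriv hZ hP _ ?_
  have hb := F.isBil_iter hU hW hB r
  rw [hw _ (hK β), hb.zero_right, add_zero]
  set K := F.X α - ∑ b, c α b • F.X b with hKdef
  have h1 := F.leib_iter hU hW hZ (hcomm K (hK α)) (hL K) r u (actW (F.X β).toCVec w)
  rw [hW.comm _ _ _ (hcomm K (hK α) β), hw K (hK α), hW.zero, hb.zero_right, add_zero] at h1
  rw [← h1]
  exact AddSubgroup.subset_closure ⟨K, hK α, _, hu _, rfl⟩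

/-- The mirror image of `iter_succ_mem_right`, with one more point: the surviving terms carry C u in
place of u, and C u is still annihilated by K because K commutes with the X's of which C is a
combination. -/
theorem iter_succ_mem_left (hF : F.IsSplit κ) (hU : IsAct actU) (hW : IsAct actW)
    (hZ : IsAct actZ) (hB : IsBil k M B) (hL : ∀ X : RVec k M, Leib actU actW actZ B X.toCVec)
    {P : Z → Prop} (hP : IsStable k M P) {u : U} {w : W}
    (hu : ∀ K ∈ κ, actU K.toCVec u = 0) (r : ℕ)
    (hw : ∀ u', P (F.iter actU actW B r u' w)) :
    F.iter actU actW B (r + 1) u w ∈ invDeriv κ actZ P := by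
  obtain ⟨hcomm, c, hK, hc⟩ := hF
  rw [iter_succ_split hU hW hB hc]
  refine sum_mem fun α _ => sum_mem fun β _ => smul_mem_invDeriv hZ hP _ ?_
  have hb := F.isBil_iter hU hW hB r
  rw [hu _ (hK α), hb.zero_left, zero_add]
  set K := F.X β - ∑ b, c β b • F.X b with hKdef
  set C := ∑ b, c α b • F.X b with hCdef
  have hCK : actU K.toCVec (actU C.toCVec u) = 0 := by
    rw [hCdef, toCVec_sum_smul, hU.sum_vec, hU.sum]
    refine Finset.sum_eq_zero fun b _ => ?_
    rw [hU.smul_vec, hU.smul, hU.comm _ _ _ (hcomm K (hK β) b), hu K (hK β), hU.zero, smul_zero]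
  have h1 := F.leib_iter hU hW hZ (hcomm K (hK β)) (hL K) r (actU C.toCVec u) w
  rw [hCK, hb.zero_left, zero_add] at h1
  rw [← h1]
  exact AddSubgroup.subset_closure ⟨K, hK β, _, hw _, rfl⟩

theorem star_sub_conv_mem_right (hF : F.IsSplit κ) (hU : IsAct actU) (hW : IsAct actW)
    (hZ : IsAct actZ) (hB : IsBil k M B) (hL : ∀ X : RVec k M, Leib actU actW actZ B X.toCVec)
    {P : Z → Prop} (hP : IsStable k M P) {u : Formal U} {w : Formal W}
    (hw : ∀ K ∈ κ, ∀ n, actW K.toCVec (w n) = 0)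
    (hu : ∀ r n w', P (F.iter actU actW B r (u n) w')) (n : ℕ) :
    F.star actU actW B u w n - conv B u w n ∈ invDeriv κ actZ P := by
  rw [star_sub_conv]
  refine sum_mem fun p hp => sum_mem fun q _ => smul_mem_invDeriv hZ hP _ ?_
  obtain ⟨r, hr⟩ := fst_pos_of_mem_erase hp
  rw [hr]
  exact iter_succ_mem_right hF hU hW hZ hB hL hP (fun K h => hw K h _) r (hu r _)

theorem star_sub_conv_mem_left (hF : F.IsSplit κ) (hU : IsAct actU) (hW : IsAct actW)
    (hZ : IsAct actZ) (hB : IsBil k M B) (hL : ∀ X : RVec k M, Leib actU actW actZ B X.toCVec)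
    {P : Z → Prop} (hP : IsStable k M P) {u : Formal U} {w : Formal W}
    (hu : ∀ K ∈ κ, ∀ n, actU K.toCVec (u n) = 0)
    (hw : ∀ r n u', P (F.iter actU actW B r u' (w n))) (n : ℕ) :
    F.star actU actW B u w n - conv B u w n ∈ invDeriv κ actZ P := by
  rw [star_sub_conv]
  refine sum_mem fun p hp => sum_mem fun q _ => smul_mem_invDeriv hZ hP _ ?_
  obtain ⟨r, hr⟩ := fst_pos_of_mem_erase hp
  rw [hr]
  exact iter_succ_mem_left hF hU hW hZ hB hL hP (fun K h => hu K h _) r fun u' => hw r _ u'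

/-- A property of the left argument that passes to the values passes to all deformed terms. -/
theorem iter_of_left {U W : Type*} {actU : CVec k M → U → U} {actW : CVec k M → W → W}
    {B : U → W → Z} {PU : U → Prop} {P : Z → Prop} (hP : IsStable k M P)
    (hact : ∀ X : RVec k M, ∀ u, PU u → PU (actU X.toCVec u)) (hB : ∀ u w, PU u → P (B u w))
    (r : ℕ) (u : U) (hu : PU u) (w : W) : P (F.iter actU actW B r u w) := by
  induction r generalizing u w with
  | zero => exact hB u w hu
  | succ r ih =>
    rw [iter_succ]
    exact hP.sum _ fun α => hP.sum _ fun β => hP.smul _ _ (ih _ (hact _ _ hu) _)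

theorem iter_of_right {U W : Type*} {actU : CVec k M → U → U} {actW : CVec k M → W → W}
    {B : U → W → Z} {PW : W → Prop} {P : Z → Prop} (hP : IsStable k M P)
    (hact : ∀ X : RVec k M, ∀ w, PW w → PW (actW X.toCVec w)) (hB : ∀ u w, PW w → P (B u w))
    (r : ℕ) (u : U) (w : W) (hw : PW w) : P (F.iter actU actW B r u w) := by
  induction r generalizing u w with
  | zero => exact hB u w hw
  | succ r ih =>
    rw [iter_succ]
    exact hP.sum _ fun α => hP.sum _ fun β => hP.smul _ _ (ih _ _ (hact _ _ hw))

theorem star_of_iter {U W : Type*} {actU : CVec k M → U → U} {actW : CVec k M → W → W}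
    {B : U → W → Z} {P : Z → Prop} (hP : IsStable k M P) {u : Formal U} {w : Formal W}
    (h : ∀ r i j, P (F.iter actU actW B r (u i) (w j))) (n : ℕ) : P (F.star actU actW B u w n) := by
  rw [star_apply]
  exact hP.sum _ fun p => hP.sum _ fun q => hP.smul _ _ (h _ _ _)

/-- The leading term of a deformed operation in its left argument. -/
theorem star_leading_left (hU : IsAct actU) (hW : IsAct actW) (hB : IsBil k M B) {u : Formal U}
    (w : Formal W) {n : ℕ} (h : ∀ m < n, u m = 0) :
    F.star actU actW B u w n = B (u n) (w 0) := by
  have h0 : (cst (coef 0) : Fn k M) = 1 := by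
    have : coef 0 = 1 := by simp [coef]
    rw [this, cst_one]
  have hz : ∀ r m, m < n → ∀ w', (cst (coef r) : Fn k M) • F.iter actU actW B r (u m) w' = 0 :=
    fun r m hm w' => by rw [h m hm, (F.isBil_iter hU hW hB r).zero_left, smul_zero]
  rw [star_apply, Finset.sum_eq_single (0, n), Finset.sum_eq_single (n, 0), h0, one_smul]
  · rfl
  · rintro ⟨a, b⟩ hq hne
    have hq' : a + b = n := mem_antidiagonal.1 hq
    refine hz _ _ (show a < n from lt_of_le_of_ne (by omega) fun ha => hne ?_) _
    rw [Prod.mk.injEq]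
    omega
  · exact fun hn => absurd (mem_antidiagonal.2 (add_zero n)) hn
  · rintro ⟨r, b⟩ hp hne
    refine Finset.sum_eq_zero ?_
    rintro ⟨a, c⟩ hq
    have hp' : r + b = n := mem_antidiagonal.1 hp
    have hq' : a + c = b := mem_antidiagonal.1 hq
    refine hz _ _ (show a < n from lt_of_le_of_ne (by omega) fun ha => hne ?_) _
    rw [Prod.mk.injEq]
    omega
  · exact fun hn => absurd (mem_antidiagonal.2 (zero_add n)) hn

/-- The leading term of a deformed operation in its right argument. -/
theorem star_leading_right (hU : IsAct actU) (hW : IsAct actW) (hB : IsBil k M B) (u : Formal U)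
    {w : Formal W} {n : ℕ} (h : ∀ m < n, w m = 0) :
    F.star actU actW B u w n = B (u 0) (w n) := by
  have h0 : (cst (coef 0) : Fn k M) = 1 := by
    have : coef 0 = 1 := by simp [coef]
    rw [this, cst_one]
  have hz : ∀ r m, m < n → ∀ u', (cst (coef r) : Fn k M) • F.iter actU actW B r u' (w m) = 0 :=
    fun r m hm u' => by rw [h m hm, (F.isBil_iter hU hW hB r).zero_right, smul_zero]
  rw [star_apply, Finset.sum_eq_single (0, n), Finset.sum_eq_single (0, n), h0, one_smul]
  · rfl
  · rintro ⟨a, b⟩ hq hne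
    have hq' : a + b = n := mem_antidiagonal.1 hq
    refine hz _ _ (show b < n from lt_of_le_of_ne (by omega) fun ha => hne ?_) _
    rw [Prod.mk.injEq]
    omega
  · exact fun hn => absurd (mem_antidiagonal.2 (zero_add n)) hn
  · rintro ⟨r, b⟩ hp hne
    refine Finset.sum_eq_zero ?_
    rintro ⟨a, c⟩ hq
    have hp' : r + b = n := mem_antidiagonal.1 hp
    have hq' : a + c = b := mem_antidiagonal.1 hq
    refine hz _ _ (show c < n from lt_of_le_of_ne (by omega) fun ha => hne ?_) _
    rw [Prod.mk.injEq]
    omega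
  · exact fun hn => absurd (mem_antidiagonal.2 (zero_add n)) hn

/-- A deformed product with a constant is the undeformed one. -/
theorem star_const_left (hU : IsAct actU) (hW : IsAct actW) (hB : IsBil k M B) {u : U}
    (hu : ∀ α, actU (F.X α).toCVec u = 0) (w : Formal W) :
    F.star actU actW B (Formal.const u) w = fun n => B u (w n) := by
  rw [F.star_eq_conv]
  · funext n
    rw [conv, Finset.sum_eq_single (0, n)]
    · rfl
    · rintro ⟨a, b⟩ hq hne
      have hq' : a + b = n := mem_antidiagonal.1 hq
      have ha : a ≠ 0 := fun ha => hne (by rw [Prod.mk.injEq]; omega)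
      rw [Formal.const, if_neg ha, hB.zero_left]
    · exact fun hn => absurd (mem_antidiagonal.2 (zero_add n)) hn
  · intro r i j
    refine F.iter_succ_eq_zero_left hU hW hB (fun α => ?_) r _
    rw [Formal.const]
    split_ifs
    · exact hu α
    · exact hU.zero _

end AbelianTwist

end Twist

end TwistedDirac

end

open scoped Manifold ContDiff TensorProduct Topology

noncomputable section

namespace TwistedDirac

open Finset.HasAntidiagonal

/-! ### The geometry of the vielbein -/

section Gamma

variable {δ : SpacetimeDim} (γ : GammaMatrices δ)

theorem GammaMatrices.trace_mul (a b : Fin δ.dim) :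
    (γ.gamma a * γ.gamma b).trace = (δ.dim : ℂ) * eta a b := by
  have h := congrArg Matrix.trace (γ.clifford a b)
  rw [Matrix.trace_add, Matrix.trace_mul_comm (γ.gamma b), Matrix.trace_smul, Matrix.trace_one,
    Fintype.card_fin, smul_eq_mul] at h
  linear_combination h / 2

theorem GammaMatrices.gamma_zero_sq : γ.gamma 0 * γ.gamma 0 = 1 := by
  have h := γ.clifford 0 0
  rw [← two_smul ℂ (γ.gamma 0 * γ.gamma 0), eta, if_pos rfl, if_pos rfl, mul_one] at h
  exact smul_right_injective _ (two_ne_zero (α := ℂ)) h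

theorem eta_self_sq {k : ℕ} (a : Fin (k + 1)) : (eta a a : ℂ) * eta a a = 1 := by
  rw [eta, if_pos rfl]
  split_ifs <;> norm_num

theorem GammaMatrices.up_eq (a : Fin δ.dim) : γ.up a = eta a a • γ.gamma a := by
  rw [GammaMatrices.up, Finset.sum_eq_single a]
  · intro b _ hb
    rw [eta, if_neg hb.symm, zero_smul]
  · exact fun h => absurd (Finset.mem_univ a) h

theorem GammaMatrices.up_mul (a : Fin δ.dim) : γ.up a * γ.gamma a = 1 := by
  have h := γ.clifford a a
  rw [← two_smul ℂ (γ.gamma a * γ.gamma a), mul_smul] at h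
  have h1 : γ.gamma a * γ.gamma a = eta a a • 1 :=
    smul_right_injective _ (two_ne_zero (α := ℂ)) h
  rw [γ.up_eq, smul_mul_assoc, h1, smul_smul, eta_self_sq, one_smul]

theorem SpacetimeDim.dim_ne_zero (δ : SpacetimeDim) : (δ.dim : ℂ) ≠ 0 := by
  exact Nat.cast_ne_zero.2 (Nat.succ_ne_zero δ.spatial)

end Gamma

section Cartan

set_option linter.unusedSectionVars false

variable {δ : SpacetimeDim} {M : Type*} [TopologicalSpace M]
  [ChartedSpace (EuclideanSpace ℝ (Fin δ.dim)) M]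

/-- The gamma matrices are linearly independent. -/
theorem GammaMatrices.independent (γ : GammaMatrices δ) {Z : Type*} [AddCommGroup Z]
    [Module (Fn δ.dim M) Z] (z : Fin δ.dim → Z)
    (h : ∀ i j, ∑ a, (cst (γ.gamma a i j) : Fn δ.dim M) • z a = 0) : z = 0 := by
  funext b
  -- Multiplying by `γ_b` and taking the trace isolates the coefficient of `γ_b`, since traces of
  -- products of distinct gammas vanish.
  have h1 : ∑ j, ∑ i, (cst (γ.gamma b j i) : Fn δ.dim M) •
      ∑ a, (cst (γ.gamma a i j) : Fn δ.dim M) • z a = 0 :=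
    Finset.sum_eq_zero fun j _ => Finset.sum_eq_zero fun i _ => by rw [h, smul_zero]
  have h2 : ∑ a, (cst ((γ.gamma b * γ.gamma a).trace) : Fn δ.dim M) • z a = 0 := by
    rw [← h1]
    simp only [Matrix.trace, Matrix.diag_apply, Matrix.mul_apply, cst_sum, Finset.smul_sum,
      Finset.sum_smul, smul_smul, cst_mul_cst]
    rw [Finset.sum_comm]
    refine Finset.sum_congr rfl fun j _ => ?_
    exact Finset.sum_comm
  rw [Finset.sum_eq_single b] at h2
  · rw [γ.trace_mul] at h2
    have h3 := congrArg (fun w => (cst ((δ.dim : ℂ)⁻¹ * eta b b) : Fn δ.dim M) • w) h2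
    simp only [smul_smul, cst_mul_cst, smul_zero] at h3
    have h4 : (δ.dim : ℂ)⁻¹ * eta b b * ((δ.dim : ℂ) * eta b b) = 1 := by
      rw [mul_mul_mul_comm, inv_mul_cancel₀ δ.dim_ne_zero, eta_self_sq, mul_one]
    rwa [h4, cst_one, one_smul] at h3
  · intro a _ ha
    rw [γ.trace_mul, eta, if_neg ha.symm, mul_zero, cst_zero, zero_smul]
  · exact fun hb => absurd (Finset.mem_univ b) hb

variable [IsManifold (𝓡 δ.dim) ∞ M] {γ : GammaMatrices δ}

theorem valueAt_gammaForm (V : Fin δ.dim → Form δ.dim M 1) (Y : RVec δ.dim M) (x : M) :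
    valueAt (gammaForm γ V) Y x = ∑ a, contract Y.toCVec (V a) x • γ.gamma a := by
  ext i j
  rw [valueAt, Matrix.of_apply, Matrix.sum_apply]
  change contract Y.toCVec (∑ a, (cst (γ.gamma a i j) : Fn δ.dim M) • V a) x = _
  rw [isBil_contract.sum_right, sumFn_apply]
  refine Finset.sum_congr rfl fun a _ => ?_
  rw [(isBil_contract (k := δ.dim) (M := M)).smul_right, Matrix.smul_apply, smul_eq_mul, mul_comm]
  rfl

namespace CartanGeometry

variable (G : CartanGeometry M γ)

theorem lieForm_V {K : RVec δ.dim M} (hK : K ∈ G.killing) (a : Fin δ.dim) (n : ℕ) :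
    lieForm K.toCVec (G.V a n) = 0 := by
  have h := (hK n).1
  refine congrFun (γ.independent (M := M) (fun a => lieForm K.toCVec (G.V a n)) fun i j => ?_) a
  have h1 : lieForm K.toCVec (∑ a, (cst (γ.gamma a i j) : Fn δ.dim M) • G.V a n) = 0 :=
    congrFun (congrFun h i) j
  rw [lieForm_sum_form] at h1
  exact (Finset.sum_congr rfl fun a _ => ((isAct_lieForm 1).smul _ _ _).symm).trans h1

/-- The reality condition on V and the adjoint rule for the gammas have the same form, so every
component equals its conjugate once the gammas are separated by traces. -/
theorem V_im (a : Fin δ.dim) (n : ℕ) (Y : RVec δ.dim M) (x : M) :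
    (contract Y.toCVec (G.V a n) x).im = 0 := by
  have h := G.V_real n Y x
  rw [valueAt_gammaForm, Matrix.conjTranspose_sum, Finset.mul_sum, Finset.sum_mul,
    ← sub_eq_zero, ← Finset.sum_sub_distrib] at h
  have h1 : ∑ b, (star (contract Y.toCVec (G.V b n) x) - contract Y.toCVec (G.V b n) x) •
      γ.gamma b = 0 := by
    have h2 := congrArg (fun A => γ.gamma 0 * A * γ.gamma 0) h
    simp only [mul_zero, zero_mul, Finset.mul_sum, Finset.sum_mul] at h2
    rw [← h2]
    refine Finset.sum_congr rfl fun b _ => ?_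
    rw [Matrix.conjTranspose_smul, γ.adjoint]
    have e : γ.gamma 0 * (γ.gamma 0 * γ.gamma b * γ.gamma 0) * γ.gamma 0 = γ.gamma b := by
      rw [mul_assoc (γ.gamma 0) (γ.gamma b), ← mul_assoc, γ.gamma_zero_sq, one_mul, mul_assoc,
        γ.gamma_zero_sq, mul_one]
    rw [mul_smul_comm, smul_mul_assoc, ← sub_smul, mul_smul_comm, smul_mul_assoc, e]
  have h3 := congrArg (fun A => (γ.gamma a * A).trace) h1
  simp only [Finset.mul_sum, Matrix.trace_sum, mul_smul_comm, Matrix.trace_smul, γ.trace_mul,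
    mul_zero, Matrix.trace_zero] at h3
  rw [Finset.sum_eq_single a] at h3
  · have h4 : (eta a a : ℂ) ≠ 0 := fun h0 => by simpa [h0] using eta_self_sq a
    have h5 := (smul_eq_zero.1 h3).resolve_right (mul_ne_zero δ.dim_ne_zero h4)
    exact Complex.conj_eq_iff_im.1 (sub_eq_zero.1 h5)
  · intro b _ hb
    rw [eta, if_neg hb.symm, mul_zero, smul_zero]
  · exact fun hb => absurd (Finset.mem_univ a) hb

/-- The classical vielbein as a real coframe. -/
def coframe₀ : RealCoframe δ.dim M where
  e a := G.V a 0
  bij := G.coframe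
  real a Y x := G.V_im a 0 Y x

variable (F : AbelianTwist δ.dim M)

/-- The Killing vector fields commuting with the twist. -/
def centralKilling : Set (RVec δ.dim M) :=
  {K | K ∈ G.killing ∧ ∀ α, ⁅K.toCVec, (F.X α).toCVec⁆ = 0}

-- The Killing parts given by `exists_splitting` are constant combinations of the X's and therefore
-- commute with them.
variable {F} in
theorem isSplit (hF : G.IsSemiKilling F) : F.IsSplit (G.centralKilling F) := by
  obtain ⟨c, hc, hΘ⟩ := exists_splitting G.killing F.Θ F.X hF
  refine ⟨fun K hK => hK.2, c, fun α => ⟨hc α, fun β => ?_⟩, hΘ⟩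
  have : (F.X α - ∑ b, c α b • F.X b).toCVec =
      (F.X α).toCVec - ∑ b, c α b • (F.X b).toCVec := by
    rw [RVec.toCVec_sub, AbelianTwist.toCVec_sum_smul]
  have h0 : ∀ b, lieVec (F.X b).toCVec (F.X β).toCVec = 0 := fun b => F.comm b β
  change lieVec _ _ = 0
  rw [this, isAct_lieVec.sub_vec, isAct_lieVec.sum_vec, h0, zero_sub, neg_eq_zero]
  exact Finset.sum_eq_zero fun b _ => by rw [isAct_lieVec.smul_vec, h0, smul_zero]

/-! ### The inverse vielbeins -/

/-- The components `ι⋆_E V^b` of a vector field. -/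
def starComponents : Formal (CVec δ.dim M) →+ Formal (Fin δ.dim → Fn δ.dim M) :=
  AddMonoidHom.mk' (fun E n b => F.star lieVec lieForm contract E (G.V b) n) fun E E' => by
    funext n b
    exact congrFun (F.star_add_left isAct_lieVec (isAct_lieForm 1) isBil_contract E E' (G.V b)) n

/-- The components of a vector field with respect to the classical vielbein. -/
def components₀ : CVec δ.dim M →+ (Fin δ.dim → Fn δ.dim M) :=
  AddMonoidHom.mk' (fun v b => contract v (G.V b 0)) fun v w => by
    funext b
    exact contract_add v w _

/-- When all lower coefficients vanish, the order `n` component is the classical contraction with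
the coframe `V a 0`, which is bijective by assumption. -/
theorem starComponents_bijective : Function.Bijective (G.starComponents F) := by
  have h : ∀ (u : Formal (CVec δ.dim M)) (n : ℕ), (∀ m < n, u m = 0) →
      G.starComponents F u n = G.components₀ (u n) := fun u n hu => by
    funext b
    exact F.star_leading_left isAct_lieVec (isAct_lieForm 1) isBil_contract _ hu
  exact ⟨triangular_injective G.components₀ G.coframe.1 _ h,
    triangular_surjective G.components₀ G.coframe.2 _ h⟩

variable {F} in
theorem isStarInverse_iff {E : Fin δ.dim → Formal (CVec δ.dim M)} : G.IsStarInverse F E ↔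
    ∀ a, G.starComponents F (E a) = fun n b => if n = 0 ∧ a = b then 1 else 0 := by
  constructor
  · intro h a
    funext n b
    exact h a b n
  · intro h a b n
    exact congrFun (congrFun (h a) n) b

theorem existsUnique_isStarInverse :
    ∃! E : Fin δ.dim → Formal (CVec δ.dim M), G.IsStarInverse F E := by
  have hb := G.starComponents_bijective F
  choose E hE using fun a : Fin δ.dim => hb.2 fun n b => if n = 0 ∧ a = b then 1 else 0
  refine ⟨E, G.isStarInverse_iff.2 hE, fun E' hE' => funext fun a => hb.1 ?_⟩
  rw [hE, G.isStarInverse_iff.1 hE']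

/-- The trivial twist. -/
def _root_.TwistedDirac.AbelianTwist.trivial (k : ℕ) (M : Type*) [TopologicalSpace M]
    [ChartedSpace (EuclideanSpace ℝ (Fin k)) M] [IsManifold (𝓡 k) ∞ M] : AbelianTwist k M where
  m := 0
  Θ := 0
  antisymm := by simp
  X := Fin.elim0
  comm α := α.elim0

theorem _root_.TwistedDirac.AbelianTwist.star_trivial {k : ℕ} {M : Type*} [TopologicalSpace M]
    [ChartedSpace (EuclideanSpace ℝ (Fin k)) M] [IsManifold (𝓡 k) ∞ M] {U W Z : Type*}
    [AddCommGroup U] [Module (Fn k M) U] [AddCommGroup W] [Module (Fn k M) W]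
    [AddCommGroup Z] [Module (Fn k M) Z] (actU : CVec k M → U → U) (actW : CVec k M → W → W)
    (B : U → W → Z) (u : Formal U) (w : Formal W) :
    (AbelianTwist.trivial k M).star actU actW B u w = conv B u w :=
  AbelianTwist.star_eq_conv _ u w fun _ _ _ => rfl

/-- A twist without vector fields makes the undeformed inverse a special case of the star inverse,
so one existence and uniqueness proof serves both. -/
theorem isInverse_iff {E : Fin δ.dim → Formal (CVec δ.dim M)} :
    G.IsInverse E ↔ G.IsStarInverse (AbelianTwist.trivial δ.dim M) E := by
  refine forall_congr' fun a => forall_congr' fun b => forall_congr' fun n => ?_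
  rw [AbelianTwist.star_trivial]
  rfl

variable {G} {E : Fin δ.dim → Formal (CVec δ.dim M)}

/-- Differentiating ι_E V = δ along K leaves ι_{L_K E} V = 0, because L_K V = 0. A field with
vanishing components is zero. -/
theorem IsInverse.lieVec_eq_zero (hE : G.IsInverse E) {K : RVec δ.dim M} (hK : K ∈ G.killing)
    (a : Fin δ.dim) (n : ℕ) : lieVec K.toCVec (E a n) = 0 := by
  have hinj := (G.starComponents_bijective (AbelianTwist.trivial δ.dim M)).1
  refine congrFun (hinj (a₁ := fun n => lieVec K.toCVec (E a n)) (a₂ := 0) ?_) n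
  rw [map_zero]
  funext n b
  change (AbelianTwist.trivial δ.dim M).star lieVec lieForm contract
    (fun n => lieVec K.toCVec (E a n)) (G.V b) n = 0
  rw [AbelianTwist.star_trivial]
  have h := congrArg (fun f => K.toCVec f) (hE a b n)
  simp only [map_sum] at h
  refine Eq.trans (Finset.sum_congr rfl fun p _ => ?_) (h.trans ?_)
  · have h1 := leib_contract K.toCVec (E a p.1) (G.V b p.2)
    rw [G.lieForm_V hK, isBil_contract.zero_right, add_zero] at h1
    exact h1.symm
  · split_ifs
    · exact vec_cst _ 1
    · exact map_zero _

/-- E and V are both invariant, so their contraction is not deformed. Together with uniqueness this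
identifies the two inverse vielbeins. -/
theorem IsInverse.isStarInverse (hE : G.IsInverse E) (hF : G.IsSemiKilling F) :
    G.IsStarInverse F E := by
  intro a b n
  rw [AbelianTwist.star_eq_conv_of_invariant (G.isSplit hF) isAct_lieVec (isAct_lieForm 1)
    isBil_contract (fun K hK n => hE.lieVec_eq_zero hK.1 a n) fun K hK n => G.lieForm_V hK.1 b n]
  exact hE a b n

/-! ### Expansion of spinor-valued forms in the vielbein -/

variable (G) in
/-- The spinor-valued form `V^a ⋆ f_a`. -/
def starSum : Formal (Fin δ.dim → Spinor δ.dim M) →+ Formal (SpinorForm δ.dim M) :=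
  AddMonoidHom.mk' (fun f => ∑ a, F.star lieForm lieSpinor formSpinor (G.V a) fun n => f n a)
    fun f f' => by
      rw [← Finset.sum_add_distrib]
      exact Finset.sum_congr rfl fun a _ =>
        F.star_add_right (isAct_lieForm 1) isAct_lieSpinor isBil_formSpinor _ _ _

variable (G) in
/-- The spinor-valued form `V^a f_a` at order zero. -/
def sum₀ : (Fin δ.dim → Spinor δ.dim M) →+ SpinorForm δ.dim M :=
  AddMonoidHom.mk' (fun f => ∑ a, formSpinor (G.V a 0) (f a)) fun f f' => by
    rw [← Finset.sum_add_distrib]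
    exact Finset.sum_congr rfl fun a _ => isBil_formSpinor.add_right _ _ _

variable (G) in
theorem sum₀_surjective : Function.Surjective (G.sum₀) := by
  intro θ
  refine ⟨fun a i => contract (G.coframe₀.basis a) (θ i), ?_⟩
  funext i
  change (∑ a, formSpinor (G.V a 0) fun i => contract (G.coframe₀.basis a) (θ i)) i = θ i
  rw [Finset.sum_apply]
  ext1 Y
  rw [form_sum_apply, form_one_apply (θ i), ← G.coframe₀.sum_contract_smul (Y 0), contract_sum]
  refine Finset.sum_congr rfl fun a _ => ?_
  rw [contract_smul]
  change contract (G.coframe₀.basis a) (θ i) * G.V a 0 Y = _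
  rw [form_one_apply, mul_comm]
  rfl

variable (G) in
theorem starSum_surjective : Function.Surjective (G.starSum F) := by
  refine triangular_surjective G.sum₀ G.sum₀_surjective _ fun f n hf => ?_
  change (∑ a, F.star lieForm lieSpinor formSpinor (G.V a) fun n => f n a) n = _
  rw [Finset.sum_apply]
  exact Finset.sum_congr rfl fun a _ => F.star_leading_right (isAct_lieForm 1) isAct_lieSpinor
    isBil_formSpinor _ fun m hm => congrFun (hf m hm) a

-- Associativity rewrites ι⋆_{E_a}(V^b ⋆ f_b) as (ι⋆_{E_a} V^b) ⋆ f_b, and a star product with the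
-- constant δ_a^b is the ordinary one.
variable {F} in
theorem IsStarInverse.contract_starSum (hE : G.IsStarInverse F E)
    (f : Formal (Fin δ.dim → Spinor δ.dim M)) (a : Fin δ.dim) :
    F.star lieVec lieSpinorForm contractSpinor (E a) (G.starSum F f) = fun n => f n a := by
  change F.star lieVec lieSpinorForm contractSpinor (E a)
    (∑ b, F.star lieForm lieSpinor formSpinor (G.V b) fun n => f n b) = _
  rw [F.star_sum_right _ isAct_lieVec isAct_lieSpinorForm isBil_contractSpinor]
  have h1 : ∀ b, F.star lieVec lieSpinorForm contractSpinor (E a)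
      (F.star lieForm lieSpinor formSpinor (G.V b) fun n => f n b) =
      F.star (fun X f => X f) lieSpinor (fun (g : Fn δ.dim M) (ψ : Spinor δ.dim M) => g • ψ)
        (F.star lieVec lieForm contract (E a) (G.V b)) fun n => f n b := fun b =>
    F.star_assoc isAct_lieVec (isAct_lieForm 1) isAct_lieSpinor isAct_lieSpinorForm isAct_fn
      isBil_contractSpinor isBil_smul (fun X => leib_formSpinor _) (fun X => leib_contract _)
      (fun v φ ψ => funext fun i => by
        change contract v (ψ i • φ) = contract v φ * ψ i
        rw [mul_comm]; rfl) _ _ _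
  have h2 : ∀ b, F.star lieVec lieForm contract (E a) (G.V b) =
      Formal.const (if a = b then 1 else 0) := fun b => by
    funext n
    rw [hE a b n, Formal.const]
    by_cases hn : n = 0 <;> simp [hn]
  simp only [h1, h2]
  have h3 : ∀ b, F.star (fun X f => X f) lieSpinor
      (fun (g : Fn δ.dim M) (ψ : Spinor δ.dim M) => g • ψ)
        (Formal.const (if a = b then 1 else 0)) (fun n => f n b) =
      fun n => (if a = b then 1 else 0 : Fn δ.dim M) • f n b := fun b =>
    F.star_const_left isAct_fn isAct_lieSpinor isBil_smul (fun α => by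
      split_ifs
      · exact vec_cst _ 1
      · exact map_zero _) _
  simp only [h3]
  funext n
  rw [Finset.sum_apply, Finset.sum_eq_single a]
  · rw [if_pos rfl, one_smul]
  · intro b _ hb
    rw [if_neg hb.symm, zero_smul]
  · exact fun ha => absurd (Finset.mem_univ a) ha

/-- A spinor-valued form is recovered from its star-contractions with the vielbein. -/
theorem IsStarInverse.sum_star_contract (hE : G.IsStarInverse F E)
    (θ : Formal (SpinorForm δ.dim M)) :
    ∑ a, F.star lieForm lieSpinor formSpinor (G.V a)
      (F.star lieVec lieSpinorForm contractSpinor (E a) θ) = θ := by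
  -- It is enough that some expansion V^a ⋆ f_a exists: contraction with E_a then returns its
  -- coefficients.
  obtain ⟨f, rfl⟩ := G.starSum_surjective F θ
  refine Finset.sum_congr rfl fun a _ => ?_
  rw [hE.contract_starSum]

end CartanGeometry

end Cartan

end TwistedDirac

end

open scoped Manifold ContDiff TensorProduct Topology

noncomputable section

namespace TwistedDirac

open Finset.HasAntidiagonal

/-! ### Comparison of the contraction, deformed and classical Dirac operators -/

section ConstMul

set_option linter.unusedSectionVars false

variable {k : ℕ} {M : Type*} [TopologicalSpace M] [ChartedSpace (EuclideanSpace ℝ (Fin k)) M]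

/-- Constant matrices act additively on spinors. -/
def constMulHom (Γ : Matrix (Fin k) (Fin k) ℂ) : Spinor k M →+ Spinor k M :=
  AddMonoidHom.mk' (constMul Γ) fun ψ χ => funext fun i => by
    simp only [constMul, Pi.add_apply, mul_add, Finset.sum_add_distrib]

theorem constMulHom_apply (Γ : Matrix (Fin k) (Fin k) ℂ) (ψ : Spinor k M) :
    constMulHom Γ ψ = constMul Γ ψ := rfl

theorem constMul_smul (Γ : Matrix (Fin k) (Fin k) ℂ) (f : Fn k M) (ψ : Spinor k M) :
    constMul Γ (f • ψ) = f • constMul Γ ψ := funext fun i => by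
  simp only [constMul, Pi.smul_apply, smul_eq_mul, Finset.mul_sum]
  exact Finset.sum_congr rfl fun j _ => mul_left_comm _ _ _

theorem lieSpinor_constMul (X : CVec k M) (Γ : Matrix (Fin k) (Fin k) ℂ) (ψ : Spinor k M) :
    lieSpinor X (constMul Γ ψ) = constMul Γ (lieSpinor X ψ) := funext fun i => by
  simp only [constMul, lieSpinor, map_sum, vec_cst_mul]

theorem lieForm_dFn (X : CVec k M) (f : Fn k M) : lieForm X (dFn f) = dFn (X f) := by
  ext1 Y
  have h := leib_contract X (Y 0) (dFn f)
  rw [form_one_apply, form_one_apply (dFn (X f))]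
  have h1 : contract (Y 0) (lieForm X (dFn f)) = X (contract (Y 0) (dFn f)) -
      contract (lieVec X (Y 0)) (dFn f) := eq_sub_of_add_eq' h.symm
  rw [h1]
  change X (Y 0 f) - ⁅X, Y 0⁆ f = Y 0 (X f)
  rw [Derivation.commutator_apply]
  abel

theorem contractSpinor_mulSpinor (v : CVec k M) (A : MatForm k M 1) (ψ : Spinor k M) :
    contractSpinor v (mulSpinor A ψ) = mulVecFn (contractMat v A) ψ := funext fun i => by
  change contract v (∑ l, ψ l • A i l) = ∑ l, contract v (A i l) * ψ l
  rw [isBil_contract.sum_right]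
  exact Finset.sum_congr rfl fun l _ => mul_comm _ _

/-- The first order differential operator with given coefficients. -/
def diracOp {ι : Type*} [Fintype ι] (Γ : ι → Matrix (Fin k) (Fin k) ℂ) (v : ι → CVec k M)
    (m : ι → MatFn k M) : Spinor k M → Spinor k M :=
  fun χ => ∑ a, constMul (Γ a) (lieSpinor (v a) χ - mulVecFn (m a) χ)

variable {ι : Type*} [Fintype ι] (Γ : ι → Matrix (Fin k) (Fin k) ℂ)

/-- Constant matrices commute with the Lie derivative, so the commutator only differentiates the
coefficients. The twist therefore acts on the frame fields and connection matrices instead of on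
operators. -/
theorem lieOp_diracOp (X : CVec k M) (v : ι → CVec k M) (m : ι → MatFn k M) :
    lieOp X (diracOp Γ v m) =
      diracOp Γ (fun a => lieVec X (v a)) fun a => lieMatFn X (m a) := by
  funext χ
  change lieSpinor X (∑ a, constMul (Γ a) (lieSpinor (v a) χ - mulVecFn (m a) χ)) -
    ∑ a, constMul (Γ a) (lieSpinor (v a) (lieSpinor X χ) - mulVecFn (m a) (lieSpinor X χ)) =
    ∑ a, constMul (Γ a) (lieSpinor (lieVec X (v a)) χ - mulVecFn (lieMatFn X (m a)) χ)
  rw [isAct_lieSpinor.sum, ← Finset.sum_sub_distrib]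
  refine Finset.sum_congr rfl fun a _ => ?_
  rw [lieSpinor_constMul, isAct_lieSpinor.sub, leib_lieSpinor X (v a) χ, leib_mulVecFn X (m a) χ,
    ← constMulHom_apply, ← constMulHom_apply, ← constMulHom_apply, ← map_sub]
  congr 1
  abel

variable [IsManifold (𝓡 k) ∞ M] (F : AbelianTwist k M)

theorem iter_diracOp (r : ℕ) (v : ι → CVec k M) (m : ι → MatFn k M) (χ : Spinor k M) :
    F.iter lieOp lieSpinor (fun D χ => D χ) r (diracOp Γ v m) χ =
      ∑ a, constMul (Γ a) (F.iter lieVec lieSpinor lieSpinor r (v a) χ -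
        F.iter lieMatFn lieSpinor mulVecFn r (m a) χ) := by
  induction r generalizing v m χ with
  | zero => rfl
  | succ r ih =>
    simp only [AbelianTwist.iter_succ, lieOp_diracOp, ih]
    simp only [← Finset.sum_sub_distrib, ← smul_sub, ← constMulHom_apply, map_sum]
    simp only [constMulHom_apply, constMul_smul, Finset.smul_sum]
    exact (Finset.sum_congr rfl fun α _ => Finset.sum_comm).trans Finset.sum_comm

theorem star_diracOp (v : ι → Formal (CVec k M)) (m : ι → Formal (MatFn k M))
    (χ : Formal (Spinor k M)) (n : ℕ) :
    F.star lieOp lieSpinor (fun D χ => D χ) (fun n => diracOp Γ (fun a => v a n) fun a => m a n)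
        χ n =
      ∑ a, constMul (Γ a) (F.star lieVec lieSpinor lieSpinor (v a) χ n -
        F.star lieMatFn lieSpinor mulVecFn (m a) χ n) := by
  simp only [AbelianTwist.star_apply, iter_diracOp]
  simp only [← Finset.sum_sub_distrib, ← smul_sub, ← constMulHom_apply, map_sum]
  simp only [constMulHom_apply, constMul_smul, Finset.smul_sum]
  exact (Finset.sum_congr rfl fun p _ => Finset.sum_comm).trans Finset.sum_comm

end ConstMul

section Cartan

set_option linter.unusedSectionVars false

variable {δ : SpacetimeDim} {M : Type*} [TopologicalSpace M]
  [ChartedSpace (EuclideanSpace ℝ (Fin δ.dim)) M] [IsManifold (𝓡 δ.dim) ∞ M]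
  {γ : GammaMatrices δ}

namespace CartanGeometry

variable {G : CartanGeometry M γ} {F : AbelianTwist δ.dim M}
  {E : Fin δ.dim → Formal (CVec δ.dim M)}

variable (G) in
theorem classicalCoeff_eq (E : Fin δ.dim → Formal (CVec δ.dim M)) (n : ℕ) :
    G.classicalCoeff E n = diracOp (fun a => Complex.I • γ.up a) (fun a => E a n)
      fun a => conv contractMat (E a) G.Ω n := by
  funext ψ
  refine Finset.sum_congr rfl fun a _ => ?_
  congr 2
  simp only [contractSpinor_mulSpinor]
  exact (isBil_mulVecFn.sum_left _ _ _).symm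

/-- The term dψ gives E ⋆ ψ, because d commutes with Lie derivatives and ι_v dψ = vψ. The term Ω ⋆ ψ
gives (ι⋆_E Ω) ⋆ ψ by associativity, and here the star in the contraction drops out since E and Ω
are both invariant. -/
theorem star_contractSpinor_covDiff (hE : G.IsInverse E) (hF : G.IsSemiKilling F) (a : Fin δ.dim)
    (ψ : Formal (Spinor δ.dim M)) :
    F.star lieVec lieSpinorForm contractSpinor (E a) (G.covDiff F ψ) =
      F.star lieVec lieSpinor lieSpinor (E a) ψ -
        F.star lieMatFn lieSpinor mulVecFn (conv contractMat (E a) G.Ω) ψ := by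
  have h1 : F.star lieVec lieSpinor lieSpinor (E a) ψ =
      F.star lieVec lieSpinorForm contractSpinor (E a) fun n i => dFn (ψ n i) := by
    funext n
    exact F.map_star id (fun (ψ : Spinor δ.dim M) i => dFn (ψ i)) (AddMonoidHom.id _)
      (fun _ _ => rfl) (fun _ _ => rfl)
      (fun X ψ => funext fun i => (lieForm_dFn X.toCVec (ψ i)).symm) (fun _ _ => rfl) (E a) ψ n
  have h2 : F.star lieVec lieSpinorForm contractSpinor (E a)
        (F.star lieMatForm lieSpinor mulSpinor G.Ω ψ) =
      F.star lieMatFn lieSpinor mulVecFn (F.star lieVec lieMatForm contractMat (E a) G.Ω) ψ :=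
    F.star_assoc isAct_lieVec (isAct_lieMatForm 1) isAct_lieSpinor isAct_lieSpinorForm
      isAct_lieMatFn isBil_contractSpinor isBil_mulVecFn (fun X => leib_mulSpinor _)
      (fun X => leib_contractMat _) contractSpinor_mulSpinor _ _ _
  have h3 : F.star lieVec lieMatForm contractMat (E a) G.Ω = conv contractMat (E a) G.Ω :=
    AbelianTwist.star_eq_conv_of_invariant (G.isSplit hF) isAct_lieVec (isAct_lieMatForm 1)
      isBil_contractMat (fun K hK n => hE.lieVec_eq_zero hK.1 a n) fun K hK n => (hK.1 n).2
  rw [h1, ← h3, ← h2, ← F.star_sub_right isAct_lieVec isAct_lieSpinorForm isBil_contractSpinor]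
  rfl

/-- The contraction and the deformed Dirac operators agree. -/
theorem contrDirac_eq_deformedDirac (hE : G.IsInverse E) (hF : G.IsSemiKilling F) :
    G.contrDirac F E = G.deformedDirac F E := by
  funext ψ n
  have h : G.classicalCoeff E = fun n => diracOp (fun a => Complex.I • γ.up a) (fun a => E a n)
      fun a => conv contractMat (E a) G.Ω n := funext (G.classicalCoeff_eq E)
  rw [deformedDirac, h, star_diracOp, contrDirac]
  refine Finset.sum_congr rfl fun a _ => ?_
  rw [star_contractSpinor_covDiff hE hF]
  rfl

theorem lieMatFn_conv_eq_zero (hE : G.IsInverse E) {K : RVec δ.dim M} (hK : K ∈ G.killing)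
    (a : Fin δ.dim) (n : ℕ) : lieMatFn K.toCVec (conv contractMat (E a) G.Ω n) = 0 := by
  rw [conv, isAct_lieMatFn.sum]
  refine Finset.sum_eq_zero fun q _ => ?_
  rw [leib_contractMat K.toCVec, hE.lieVec_eq_zero hK, (hK q.2).2, isBil_contractMat.zero_left,
    isBil_contractMat.zero_right, add_zero]

/-- For a Killing twist the Dirac operator is undeformed. -/
theorem deformedDirac_eq_classicalDirac (hE : G.IsInverse E) (hF : G.IsKilling F) :
    G.deformedDirac F E = G.classicalDirac E := by
  funext ψ
  refine F.star_eq_conv (U := Spinor δ.dim M → Spinor δ.dim M) _ _ fun r i j => ?_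
  rw [G.classicalCoeff_eq, iter_diracOp]
  refine Finset.sum_eq_zero fun a _ => ?_
  rw [F.iter_succ_eq_zero_left isAct_lieVec isAct_lieSpinor isBil_lieSpinor
      (fun α => hE.lieVec_eq_zero (hF α) a i),
    F.iter_succ_eq_zero_left isAct_lieMatFn isAct_lieSpinor isBil_mulVecFn
      (fun α => lieMatFn_conv_eq_zero hE (hF α) a i), sub_zero, ← constMulHom_apply, map_zero]

end CartanGeometry

end Cartan

end TwistedDirac

end

open scoped Manifold ContDiff TensorProduct Topology

noncomputable section

namespace TwistedDirac

open Finset.HasAntidiagonal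

/-! ### Removing star products under the integral -/

section Support

set_option linter.unusedSectionVars false

variable {k : ℕ} {M : Type*} [TopologicalSpace M] [ChartedSpace (EuclideanSpace ℝ (Fin k)) M]

theorem VanishesOff.mono {p : ℕ} {K K' : Set M} (h : K ⊆ K') {φ : Form k M p}
    (hφ : VanishesOff K φ) : VanishesOff K' φ := fun Y x hx => hφ Y x fun hK => hx (h hK)

theorem VanishesOff.zero {p : ℕ} {K : Set M} : VanishesOff K (0 : Form k M p) := fun _ _ _ => rfl

theorem VanishesOff.add {p : ℕ} {K : Set M} {φ τ : Form k M p} (hφ : VanishesOff K φ)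
    (hτ : VanishesOff K τ) : VanishesOff K (φ + τ) := fun Y x hx => by
  change φ Y x + τ Y x = 0
  rw [hφ Y x hx, hτ Y x hx, add_zero]

theorem VanishesOff.sum {p : ℕ} {K : Set M} {ι : Type*} (s : Finset ι) {φ : ι → Form k M p}
    (hφ : ∀ i, VanishesOff K (φ i)) : VanishesOff K (∑ i ∈ s, φ i) :=
  Finset.sum_induction _ _ (fun _ _ => VanishesOff.add) VanishesOff.zero fun i _ => hφ i

theorem VanishesOff.smul_form {p : ℕ} {K : Set M} {φ : Form k M p} (hφ : VanishesOff K φ)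
    (f : Fn k M) : VanishesOff K (f • φ) := fun Y x hx => by
  change f x * φ Y x = 0
  rw [hφ Y x hx, mul_zero]

theorem VanishesOff.of_mul {p : ℕ} {f : Fn k M} {K : Set M} (hf : ∀ x ∉ K, f x = 0)
    (φ : Form k M p) : VanishesOff K (f • φ) := fun Y x hx => by
  change f x * φ Y x = 0
  rw [hf x hx, zero_mul]

theorem VanishesOff.wedge {p q : ℕ} {K : Set M} {φ : Form k M p} (hφ : VanishesOff K φ)
    (τ : Form k M q) : VanishesOff K (wedge φ τ) := fun Y x hx => by
  have h := DFunLike.congr_fun (factorial_smul_wedge φ τ Y) x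
  rw [← Nat.cast_smul_eq_nsmul ℝ, sumFn_apply, Finset.sum_eq_zero] at h
  · have h1 : ((p.factorial * q.factorial : ℕ) : ℝ) • (TwistedDirac.wedge φ τ Y x) = 0 := h
    exact (smul_eq_zero.1 h1).resolve_left
      (Nat.cast_ne_zero.2 (mul_ne_zero p.factorial_ne_zero q.factorial_ne_zero))
  · intro σ _
    rw [← Int.cast_smul_eq_zsmul ℝ]
    change ((Equiv.Perm.sign σ : ℤ) : ℝ) • (φ _ x * τ _ x) = 0
    rw [hφ _ x hx, zero_mul, smul_zero]

/-- A matrix-valued form with compact support. -/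
def CptForm {p : ℕ} (A : MatForm k M p) : Prop :=
  ∃ K : Set M, IsCompact K ∧ ∀ i j, VanishesOff K (A i j)

/-- A matrix-valued function with compact support. -/
def CptMat (h : MatFn k M) : Prop := ∃ K : Set M, IsCompact K ∧ ∀ i j, ∀ x ∉ K, h i j x = 0

/-- A Dirac field with compact support. -/
def CptSpinor (ψ : Spinor k M) : Prop := ∃ K : Set M, IsCompact K ∧ ∀ i, ∀ x ∉ K, ψ i x = 0

namespace CptForm

variable {p : ℕ} {A C : MatForm k M p}

theorem zero : CptForm (0 : MatForm k M p) := ⟨∅, isCompact_empty, fun _ _ => VanishesOff.zero⟩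

theorem add (hA : CptForm A) (hC : CptForm C) : CptForm (A + C) := by
  obtain ⟨K, hK, h⟩ := hA
  obtain ⟨K', hK', h'⟩ := hC
  exact ⟨K ∪ K', hK.union hK', fun i j => ((h i j).mono Set.subset_union_left).add
    ((h' i j).mono Set.subset_union_right)⟩

theorem smul (hA : CptForm A) (f : Fn k M) : CptForm (f • A) := by
  obtain ⟨K, hK, h⟩ := hA
  exact ⟨K, hK, fun i j => (h i j).smul_form f⟩

theorem neg (hA : CptForm A) : CptForm (-A) := by
  obtain ⟨K, hK, h⟩ := hA
  refine ⟨K, hK, fun i j Y x hx => ?_⟩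
  change -(A i j Y x) = 0
  rw [h i j Y x hx, neg_zero]

theorem wedgeMat {q : ℕ} (hA : CptForm A) (C : MatForm k M q) :
    CptForm (TwistedDirac.wedgeMat A C) := by
  obtain ⟨K, hK, h⟩ := hA
  exact ⟨K, hK, fun i j => VanishesOff.sum _ fun l => (h i l).wedge _⟩

end CptForm

namespace CptMat

variable {h h' : MatFn k M}

theorem zero : CptMat (0 : MatFn k M) := ⟨∅, isCompact_empty, fun _ _ _ _ => rfl⟩

theorem add (hh : CptMat h) (hh' : CptMat h') : CptMat (h + h') := by
  obtain ⟨K, hK, e⟩ := hh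
  obtain ⟨K', hK', e'⟩ := hh'
  refine ⟨K ∪ K', hK.union hK', fun i j x hx => ?_⟩
  change h i j x + h' i j x = 0
  rw [e i j x fun hx' => hx (Or.inl hx'), e' i j x fun hx' => hx (Or.inr hx'), add_zero]

theorem smul (hh : CptMat h) (f : Fn k M) : CptMat (f • h) := by
  obtain ⟨K, hK, e⟩ := hh
  refine ⟨K, hK, fun i j x hx => ?_⟩
  change f x * h i j x = 0
  rw [e i j x hx, mul_zero]

theorem formMat (hh : CptMat h) (φ : Form k M 1) : CptForm (formMat φ h) := by
  obtain ⟨K, hK, e⟩ := hh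
  exact ⟨K, hK, fun i j => VanishesOff.of_mul (e i j) φ⟩

theorem mulMatForm (hh : CptMat h) (A : MatForm k M 1) : CptForm (mulMatForm h A) := by
  obtain ⟨K, hK, e⟩ := hh
  exact ⟨K, hK, fun i j => VanishesOff.sum _ fun l => VanishesOff.of_mul (e i l) _⟩

end CptMat

theorem CptSpinor.outer {χ : Spinor k M} (hχ : CptSpinor χ) (ψ : Spinor k M) :
    CptMat (outer ψ χ) := by
  obtain ⟨K, hK, e⟩ := hχ
  refine ⟨K, hK, fun i j x hx => ?_⟩
  change ψ i x * χ j x = 0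
  rw [e j x hx, mul_zero]

theorem CptSpinor.of_hasCompactSupport {ψ : Spinor k M} (h : ∀ i, HasCompactSupport (ψ i)) :
    CptSpinor ψ :=
  ⟨⋃ i, tsupport (ψ i), isCompact_iUnion h, fun i x hx => by
    by_contra h0
    exact hx (Set.mem_iUnion.2 ⟨i, subset_tsupport _ h0⟩)⟩

variable [IsManifold (𝓡 k) ∞ M] [T2Space M]

theorem toCVec_vanishes (X : RVec k M) {f : Fn k M} {K : Set M} (hK : IsCompact K)
    (hf : ∀ x ∉ K, f x = 0) : ∀ x ∉ K, X.toCVec f x = 0 := fun x hx => by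
  refine toCVec_eq_zero_of_eventually X ?_
  filter_upwards [hK.isClosed.isOpen_compl.mem_nhds hx] with y hy
  exact hf y hy

theorem CptForm.lie {p : ℕ} {A : MatForm k M p} (hA : CptForm A) (X : RVec k M) :
    CptForm (lieMatForm X.toCVec A) := by
  obtain ⟨K, hK, h⟩ := hA
  exact ⟨K, hK, fun i j => (h i j).lieForm hK.isClosed X⟩

theorem CptMat.lie {h : MatFn k M} (hh : CptMat h) (X : RVec k M) :
    CptMat (lieMatFn X.toCVec h) := by
  obtain ⟨K, hK, e⟩ := hh
  exact ⟨K, hK, fun i j => toCVec_vanishes X hK (e i j)⟩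

theorem CptSpinor.lie {ψ : Spinor k M} (hψ : CptSpinor ψ) (X : RVec k M) :
    CptSpinor (lieSpinor X.toCVec ψ) := by
  obtain ⟨K, hK, e⟩ := hψ
  exact ⟨K, hK, fun i => toCVec_vanishes X hK (e i)⟩

theorem isStable_cptForm (p : ℕ) : AbelianTwist.IsStable k M (CptForm (k := k) (M := M) (p := p)) where
  smul c _ hz := hz.smul (cst c)
  zero := CptForm.zero
  add _ _ hz hz' := hz.add hz'

theorem isStable_cptMat : AbelianTwist.IsStable k M (CptMat (k := k) (M := M)) where
  smul c _ hz := hz.smul (cst c)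
  zero := CptMat.zero
  add _ _ hz hz' := hz.add hz'

variable (F : AbelianTwist k M)

theorem CptForm.iter_wedgeMat {p q : ℕ} {A : MatForm k M p} (hA : CptForm A) (C : MatForm k M q)
    (r : ℕ) : CptForm (F.iter lieMatForm lieMatForm TwistedDirac.wedgeMat r A C) :=
  F.iter_of_left (B := TwistedDirac.wedgeMat) (PU := CptForm) (isStable_cptForm (p + q)) (fun X _ hu => CptForm.lie hu X)
    (fun _ w hu => CptForm.wedgeMat hu w) r A hA C

theorem CptMat.iter_mulMatForm {h : MatFn k M} (hh : CptMat h) (A : MatForm k M 1) (r : ℕ) :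
    CptForm (F.iter lieMatFn lieMatForm TwistedDirac.mulMatForm r h A) :=
  F.iter_of_left (B := TwistedDirac.mulMatForm) (PU := CptMat) (isStable_cptForm 1) (fun X _ hu => CptMat.lie hu X)
    (fun _ w hu => CptMat.mulMatForm hu w) r h hh A

theorem CptMat.iter_formMat {h : MatFn k M} (hh : CptMat h) (φ : Form k M 1) (r : ℕ) :
    CptForm (F.iter lieForm lieMatFn TwistedDirac.formMat r φ h) :=
  F.iter_of_right (isStable_cptForm 1) (fun X _ hu => CptMat.lie hu X)
    (fun u _ hu => CptMat.formMat hu u) r φ h hh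

theorem CptSpinor.star_outer (ψ : Formal (Spinor k M)) {χ : Formal (Spinor k M)}
    (hχ : ∀ n, CptSpinor (χ n)) (n : ℕ) :
    CptMat (F.star lieSpinor lieSpinor TwistedDirac.outer ψ χ n) :=
  F.star_of_iter isStable_cptMat (fun r i j => F.iter_of_right isStable_cptMat
    (fun X _ hu => CptSpinor.lie hu X) (fun u _ hu => CptSpinor.outer hu u) r (ψ i) (χ j) (hχ j)) n

end Support

section InvDeriv

set_option linter.unusedSectionVars false

variable {k : ℕ} {M : Type*} [TopologicalSpace M] [ChartedSpace (EuclideanSpace ℝ (Fin k)) M]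
  [IsManifold (𝓡 k) ∞ M]
variable {U W Z : Type*} [AddCommGroup U] [Module (Fn k M) U] [AddCommGroup W]
  [Module (Fn k M) W] [AddCommGroup Z] [Module (Fn k M) Z]
variable {actU : CVec k M → U → U} {actW : CVec k M → W → W} {actZ : CVec k M → Z → Z}
  {B : U → W → Z}

namespace AbelianTwist

/-- For invariant `w` the Leibniz rule reduces to B(L_K z, w) = L_K B(z, w). -/
theorem mem_invDeriv_left {κ : Set (RVec k M)} (hB : IsBil k M B)
    (hL : ∀ X : RVec k M, Leib actU actW actZ B X.toCVec) {PU : U → Prop} {P : Z → Prop}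
    (hP : ∀ u w, PU u → P (B u w)) {u : U} (hu : u ∈ invDeriv κ actU PU) {w : W}
    (hw : ∀ K ∈ κ, actW K.toCVec w = 0) : B u w ∈ invDeriv κ actZ P := by
  induction hu using AddSubgroup.closure_induction with
  | mem x h =>
    obtain ⟨K, hK, z, hz, rfl⟩ := h
    have h1 := hL K z w
    rw [hw K hK, hB.zero_right, add_zero] at h1
    rw [← h1]
    exact AddSubgroup.subset_closure ⟨K, hK, _, hP _ w hz, rfl⟩
  | zero => rw [hB.zero_left]; exact zero_mem _
  | add x y _ _ hx hy => rw [hB.add_left]; exact add_mem hx hy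
  | neg x _ hx =>
    have : B (-x) w = -B x w := by rw [← zero_sub x, hB.sub_left, hB.zero_left, zero_sub]
    rw [this]; exact neg_mem hx

end AbelianTwist

end InvDeriv

section Assoc

set_option linter.unusedSectionVars false

variable {k : ℕ} {M : Type*} [TopologicalSpace M] [ChartedSpace (EuclideanSpace ℝ (Fin k)) M]
  [IsManifold (𝓡 k) ∞ M]

theorem formMat_outer (φ : Form k M 1) (f g : Spinor k M) :
    formMat φ (outer f g) = outerForm (formSpinor φ f) g := by
  funext i j
  change (f i * g j) • φ = g j • f i • φ
  rw [mul_comm, mul_smul]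

theorem AbelianTwist.star_formMat_outer (F : AbelianTwist k M) (φ : Formal (Form k M 1))
    (f g : Formal (Spinor k M)) :
    F.star lieForm lieMatFn formMat φ (F.star lieSpinor lieSpinor outer f g) =
      F.star lieSpinorForm lieSpinor outerForm (F.star lieForm lieSpinor formSpinor φ f) g :=
  F.star_assoc (isAct_lieForm 1) isAct_lieSpinor isAct_lieSpinor isAct_lieMatFn
      isAct_lieSpinorForm isBil_formMat isBil_outerForm (fun X => leib_outer X.toCVec)
      (fun X => leib_formSpinor X.toCVec) formMat_outer φ f g

end Assoc

/-! ### Traces of matrix-valued top forms under the integral -/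

section Trace

set_option linter.unusedSectionVars false

variable {k : ℕ} {M : Type*} [TopologicalSpace M] [ChartedSpace (EuclideanSpace ℝ (Fin k)) M]

theorem traceMul_add {p : ℕ} (A C : MatForm k M p) (Γ : Matrix (Fin k) (Fin k) ℂ) :
    traceMul (A + C) Γ = traceMul A Γ + traceMul C Γ := by
  simp only [traceMul, Pi.add_apply, smul_add, Finset.sum_add_distrib]

theorem traceMul_lie {p : ℕ} (X : CVec k M) (A : MatForm k M p) (Γ : Matrix (Fin k) (Fin k) ℂ) :
    traceMul (lieMatForm X A) Γ = lieForm X (traceMul A Γ) := by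
  simp only [traceMul, lieForm_sum_form, (isAct_lieForm p).smul]
  rfl

theorem VanishesOff.traceMul {p : ℕ} {K : Set M} {A : MatForm k M p}
    (hA : ∀ i j, VanishesOff K (A i j)) (Γ : Matrix (Fin k) (Fin k) ℂ) :
    VanishesOff K (traceMul A Γ) :=
  VanishesOff.sum _ fun i => VanishesOff.sum _ fun l => (hA i l).smul_form _

variable [IsManifold (𝓡 k) ∞ M] [T2Space M] [SigmaCompactSpace M] (C : RealCoframe k M)

theorem CptForm.hasCompactSupport {A : MatForm k M k} (hA : CptForm A)
    (Γ : Matrix (Fin k) (Fin k) ℂ) (Y : Fin k → CVec k M) :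
    HasCompactSupport (traceMul A Γ Y) := by
  obtain ⟨K, hK, h⟩ := hA
  exact HasCompactSupport.intro hK fun x hx => VanishesOff.traceMul h Γ Y x hx

theorem RealCoframe.integral_traceMul_add {A A' : MatForm k M k} (hA : CptForm A)
    (hA' : CptForm A') (Γ : Matrix (Fin k) (Fin k) ℂ) :
    integral C.e (traceMul (A + A') Γ) =
      integral C.e (traceMul A Γ) + integral C.e (traceMul A' Γ) := by
  rw [traceMul_add, C.integral_eq_volInt, C.integral_eq_volInt, C.integral_eq_volInt]
  exact C.volInt_add _ _ (hA.hasCompactSupport Γ _) (hA'.hasCompactSupport Γ _)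

/-- Compact support is carried through the induction because additivity of the integral depends on
it. -/
theorem RealCoframe.integral_invDeriv {κ : Set (RVec k M)} (Γ : Matrix (Fin k) (Fin k) ℂ)
    {A : MatForm k M k} (hA : A ∈ AbelianTwist.invDeriv κ lieMatForm CptForm) :
    CptForm A ∧ integral C.e (traceMul A Γ) = 0 := by
  have hz : integral C.e (traceMul (0 : MatForm k M k) Γ) = 0 := by
    have h := C.integral_traceMul_add (CptForm.zero (p := k)) CptForm.zero Γ
    rw [add_zero] at h
    exact left_eq_add.1 h
  induction hA using AddSubgroup.closure_induction with
  | mem x h =>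
    obtain ⟨X, -, z, hz, rfl⟩ := h
    refine ⟨hz.lie X, ?_⟩
    obtain ⟨K, hK, h⟩ := hz
    rw [traceMul_lie]
    exact C.integral_lieForm_eq_zero X _ hK (VanishesOff.traceMul h Γ)
  | zero => exact ⟨CptForm.zero, hz⟩
  | add x y _ _ hx hy =>
    refine ⟨hx.1.add hy.1, ?_⟩
    rw [C.integral_traceMul_add hx.1 hy.1, hx.2, hy.2, add_zero]
  | neg x _ hx =>
    refine ⟨hx.1.neg, ?_⟩
    have h := C.integral_traceMul_add hx.1 hx.1.neg Γ
    rwa [add_neg_cancel, hz, hx.2, zero_add, eq_comm] at h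

end Trace

/-! ### The inner product and the action with undeformed wedge products -/

section Cartan

set_option linter.unusedSectionVars false

variable {δ : SpacetimeDim} {M : Type*} [TopologicalSpace M]
  [ChartedSpace (EuclideanSpace ℝ (Fin δ.dim)) M] [IsManifold (𝓡 δ.dim) ∞ M]
  {γ : GammaMatrices δ}

namespace CartanGeometry

variable (G : CartanGeometry M γ) {F : AbelianTwist δ.dim M}

/-- `A ∧ V ∧ ⋯ ∧ V` with undeformed products. -/
def wedgeConv (A : Formal (MatForm δ.dim M 1)) : (r : ℕ) → Formal (MatForm δ.dim M (r + 1))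
  | 0 => A
  | r + 1 => conv wedgeMat (wedgeConv A r) G.vielbein

variable [T2Space M]

/-- Each new factor V is invariant. So its star product differs from the plain one by derivatives
along Killing directions, and the error from the earlier factors remains of that kind after wedging
with V. -/
theorem wedgeV_sub_wedgeConv (hF : G.IsSemiKilling F) {A A' : Formal (MatForm δ.dim M 1)}
    (hA : ∀ n, CptForm (A n))
    (hAA' : ∀ n, A n - A' n ∈ AbelianTwist.invDeriv (G.centralKilling F) lieMatForm CptForm)
    (r : ℕ) : (∀ n, CptForm (G.wedgeV F A r n)) ∧ ∀ n, G.wedgeV F A r n - G.wedgeConv A' r n ∈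
      AbelianTwist.invDeriv (G.centralKilling F) lieMatForm CptForm := by
  induction r with
  | zero => exact ⟨hA, hAA'⟩
  | succ r ih =>
    have hV : ∀ K ∈ G.centralKilling F, ∀ n, lieMatForm K.toCVec (G.vielbein n) = 0 :=
      fun K hK n => (hK.1 n).1
    refine ⟨fun n => F.star_of_iter (isStable_cptForm _)
      (fun i m j => CptForm.iter_wedgeMat F (ih.1 m) _ i) n, fun n => ?_⟩
    have h1 := AbelianTwist.star_sub_conv_mem_right (G.isSplit hF) (isAct_lieMatForm _)
      (isAct_lieMatForm 1) (isAct_lieMatForm _) isBil_wedgeMat (fun X => leib_wedgeMat _)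
      (isStable_cptForm _) hV
      (fun i m w => CptForm.iter_wedgeMat F (ih.1 m) w i) n
    have h2 : conv wedgeMat (G.wedgeV F A r) G.vielbein n -
        conv wedgeMat (G.wedgeConv A' r) G.vielbein n ∈
        AbelianTwist.invDeriv (G.centralKilling F) lieMatForm CptForm := by
      rw [conv, conv, ← Finset.sum_sub_distrib]
      refine sum_mem fun q _ => ?_
      rw [← isBil_wedgeMat.sub_left]
      exact AbelianTwist.mem_invDeriv_left isBil_wedgeMat (fun X => leib_wedgeMat _)
        (fun u w hu => hu.wedgeMat w) (ih.2 q.1) fun K hK => hV K hK q.2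
    have h3 := add_mem h1 h2
    rwa [sub_add_sub_cancel] at h3

variable [SigmaCompactSpace M]

/-- Under the integral all star products with the vielbein can be removed. -/
theorem intTrace_wedgeV (hF : G.IsSemiKilling F) {A A' : Formal (MatForm δ.dim M 1)}
    (hA : ∀ n, CptForm (A n))
    (hAA' : ∀ n, A n - A' n ∈ AbelianTwist.invDeriv (G.centralKilling F) lieMatForm CptForm) :
    G.intTrace (G.wedgeV F A δ.spatial) = G.intTrace (G.wedgeConv A' δ.spatial) := by
  funext n
  obtain ⟨h1, h2⟩ := G.wedgeV_sub_wedgeConv hF hA hAA' δ.spatial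
  obtain ⟨h3, h4⟩ := G.coframe₀.integral_invDeriv γ.chirality (h2 n)
  have h5 : CptForm (G.wedgeConv A' δ.spatial n) := by
    have := (h1 n).add h3.neg
    rwa [neg_sub, add_sub_cancel] at this
  have h6 := G.coframe₀.integral_traceMul_add h3 h5 γ.chirality
  rw [sub_add_cancel, h4, zero_add] at h6
  exact h6

theorem CptSpinor.diracAdjoint {ψ : Formal (Spinor δ.dim M)} {n : ℕ} (h : CptSpinor (ψ n)) :
    CptSpinor (diracAdjoint γ ψ n) := by
  obtain ⟨K, hK, e⟩ := h
  refine ⟨K, hK, fun j x hx => ?_⟩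
  rw [CartanGeometry.diracAdjoint, sumFn_apply]
  refine Finset.sum_eq_zero fun i _ => ?_
  change (starRingEnd ℂ) (ψ n i x) * _ = 0
  rw [e i x hx, map_zero, zero_mul]

variable {E : Fin δ.dim → Formal (CVec δ.dim M)}

/-- Only the stars next to V are removed. Neither ψ₂ nor the adjoint of ψ₁ is invariant, so the star
between them stays. -/
theorem inner_eq (hF : G.IsSemiKilling F) {ψ₁ ψ₂ : Formal (Spinor δ.dim M)}
    (h₁ : ∀ n, CptSpinor (ψ₁ n)) :
    G.inner F ψ₁ ψ₂ = δ.innerConst • G.intTrace (G.wedgeConv (conv mulMatForm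
      (F.star lieSpinor lieSpinor outer ψ₂ (diracAdjoint γ ψ₁)) G.vielbein) δ.spatial) := by
  rw [inner]
  congr 1
  have hh := CptSpinor.star_outer F ψ₂ fun n => CptSpinor.diracAdjoint (γ := γ) (h₁ n)
  exact G.intTrace_wedgeV hF (fun n => F.star_of_iter (isStable_cptForm 1)
      (fun i m j => CptMat.iter_mulMatForm F (hh m) _ i) n)
    fun n => AbelianTwist.star_sub_conv_mem_right (G.isSplit hF) isAct_lieMatFn
      (isAct_lieMatForm 1) (isAct_lieMatForm 1) isBil_mulMatForm (fun X => leib_mulMatForm _)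
      (isStable_cptForm 1) (fun K hK n => (hK.1 n).1)
      (fun i m w => CptMat.iter_mulMatForm F (hh m) w i) n

/-- The form d_Ω ψ₂ is not invariant. Expanding it as V^a ⋆ ι⋆_{E_a} d_Ω ψ₂ exposes an invariant
left factor whose star can be dropped, and associativity leaves star products of spinors of the same
shape as in `inner_eq`. -/
theorem action_eq (hF : G.IsSemiKilling F) (hE : G.IsInverse E) {ψ₁ ψ₂ : Formal (Spinor δ.dim M)}
    (h₁ : ∀ n, CptSpinor (ψ₁ n)) :
    G.action F ψ₁ ψ₂ = δ.actionConst • G.intTrace (G.wedgeConv (∑ a, conv formMat (G.V a)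
      (F.star lieSpinor lieSpinor outer
        (F.star lieVec lieSpinorForm contractSpinor (E a) (G.covDiff F ψ₂)) (diracAdjoint γ ψ₁)))
      δ.spatial) := by
  rw [action]
  congr 1
  have e1 : F.star lieSpinorForm lieSpinor outerForm (G.covDiff F ψ₂) (diracAdjoint γ ψ₁) =
      ∑ a, F.star lieForm lieMatFn formMat (G.V a) (F.star lieSpinor lieSpinor outer
        (F.star lieVec lieSpinorForm contractSpinor (E a) (G.covDiff F ψ₂))
          (diracAdjoint γ ψ₁)) := by
    conv_lhs => rw [← (hE.isStarInverse F hF).sum_star_contract F (G.covDiff F ψ₂)]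
    rw [F.star_sum_left _ isAct_lieSpinorForm isAct_lieSpinor isBil_outerForm]
    refine Finset.sum_congr rfl fun a _ => ?_
    exact (F.star_formMat_outer _ _ _).symm
  rw [e1]
  have hh := fun a => CptSpinor.star_outer F
    (F.star lieVec lieSpinorForm contractSpinor (E a) (G.covDiff F ψ₂))
    fun n => CptSpinor.diracAdjoint (γ := γ) (h₁ n)
  refine G.intTrace_wedgeV hF (fun n => ?_) fun n => ?_
  · rw [Finset.sum_apply]
    exact (isStable_cptForm 1).sum _ fun a => F.star_of_iter (isStable_cptForm 1)
      (fun i m j => CptMat.iter_formMat F (hh a j) _ i) n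
  · rw [Finset.sum_apply, Finset.sum_apply, ← Finset.sum_sub_distrib]
    exact sum_mem fun a _ => AbelianTwist.star_sub_conv_mem_left (G.isSplit hF) (isAct_lieForm 1)
      isAct_lieMatFn (isAct_lieMatForm 1) isBil_formMat (fun X => leib_formMat _)
      (isStable_cptForm 1) (fun K hK n => G.lieForm_V hK.1 a n)
      (fun i m u => CptMat.iter_formMat F (hh a m) u i) n

end CartanGeometry

end Cartan

end TwistedDirac

end

open scoped Manifold ContDiff TensorProduct Topology

noncomputable section

namespace TwistedDirac

open Finset.HasAntidiagonal

/-! ### Antisymmetrised matrix products -/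

section Perm

open Equiv

/-- For fixed `ρ`, right multiplication by it reindexes the outer sum and absorbs its sign, so each
of the p! choices contributes equally. -/
theorem sum_perm_sum_perm {p : ℕ} {S : Type*} [AddCommGroup S] (f : Perm (Fin p ⊕ Fin 1) → S) :
    ∑ σ, (Perm.sign σ : ℤ) • ∑ ρ : Perm (Fin p), (Perm.sign ρ : ℤ) •
        f (σ * Perm.sumCongr ρ 1) = p.factorial • ∑ σ, (Perm.sign σ : ℤ) • f σ := by
  simp only [Finset.smul_sum]
  rw [Finset.sum_comm]
  have h : ∀ ρ : Perm (Fin p), ∑ σ : Perm (Fin p ⊕ Fin 1), (Perm.sign σ : ℤ) •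
      (Perm.sign ρ : ℤ) • f (σ * Perm.sumCongr ρ 1) = ∑ σ, (Perm.sign σ : ℤ) • f σ := by
    intro ρ
    refine Eq.trans (Finset.sum_congr rfl fun σ _ => ?_) (Equiv.sum_comp
      (Equiv.mulRight (Perm.sumCongr ρ (1 : Perm (Fin 1)))) fun σ => (Perm.sign σ : ℤ) • f σ)
    rw [Equiv.coe_mulRight, Perm.sign_mul, Perm.sign_sumCongr, Perm.sign_one, mul_one,
      Units.val_mul, mul_smul]
  simp only [h, Finset.sum_const, Finset.card_univ, Fintype.card_perm, Fintype.card_fin,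
    Finset.smul_sum]

theorem sum_perm_fin_zero {n : ℕ} {S : Type*} [AddCommMonoid S] (c : Fin (n + 1) → S) :
    ∑ π : Perm (Fin (n + 1)), c (π 0) = n.factorial • ∑ a, c a := by
  rw [← Perm.decomposeFin.symm.sum_comp, Fintype.sum_prod_type, Finset.smul_sum]
  refine Finset.sum_congr rfl fun a _ => ?_
  simp [Perm.decomposeFin_symm_apply_zero, Fintype.card_perm]

/-- A sum over functions that vanishes on noninjective functions is a sum over permutations. -/
theorem sum_fun_eq_sum_perm {ι : Type*} [Fintype ι] [DecidableEq ι] {S : Type*} [AddCommMonoid S]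
    (g : (ι → ι) → S) (hg : ∀ f, ¬ Function.Injective f → g f = 0) :
    ∑ f, g f = ∑ π : Perm ι, g π := by
  symm
  refine Finset.sum_of_injOn (fun π : Perm ι => (π : ι → ι))
    (fun _ _ _ _ h => DFunLike.coe_injective h) (fun _ _ => Finset.mem_coe.2 (Finset.mem_univ _))
    (fun f _ hf => hg f fun hinj => hf ?_) fun _ _ => rfl
  exact ⟨Equiv.ofBijective f (Finite.injective_iff_bijective.1 hinj), by simp, rfl⟩

theorem permCongr_castSucc {p : ℕ} (σ : Perm (Fin p ⊕ Fin 1)) (i : Fin p) :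
    (finSumFinEquiv (m := p) (n := 1)).permCongr σ i.castSucc = finSumFinEquiv (σ (Sum.inl i)) := by
  rw [Equiv.permCongr_apply]
  congr 2
  exact finSumFinEquiv_symm_apply_castAdd i

theorem permCongr_last {p : ℕ} (σ : Perm (Fin p ⊕ Fin 1)) :
    (finSumFinEquiv (m := p) (n := 1)).permCongr σ (Fin.last p) =
      finSumFinEquiv (σ (Sum.inr 0)) := by
  rw [Equiv.permCongr_apply]
  congr 2
  exact finSumFinEquiv_symm_apply_natAdd 0

end Perm

/-! ### Antisymmetrised products of linear combinations of matrices -/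

section MatProd

variable {N : Type*} [Fintype N] {S : Type*} [CommRing S] {T ι : Type*}

/-- The matrix product `a (Y 0) v (Y 1) ⋯ v (Y p)`. -/
def matProd (a v : T → Matrix N N S) : (p : ℕ) → (Fin (p + 1) → T) → Matrix N N S
  | 0, Y => a (Y 0)
  | p + 1, Y => matProd a v p (fun i => Y i.castSucc) * v (Y (Fin.last (p + 1)))

theorem matProd_succ (a v : T → Matrix N N S) (p : ℕ) (Y : Fin (p + 2) → T) :
    matProd a v (p + 1) Y = matProd a v p (fun i => Y i.castSucc) * v (Y (Fin.last (p + 1))) := rfl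

variable [Fintype ι]

/-- Expansion of the matrix product of linear combinations. -/
theorem matProd_sum (s : ι → T → S) (m g : ι → Matrix N N S) (p : ℕ) (Y : Fin (p + 1) → T) :
    matProd (fun y => ∑ a, s a y • m a) (fun y => ∑ a, s a y • g a) p Y =
      ∑ f : Fin (p + 1) → ι, (∏ i, s (f i) (Y i)) • matProd m g p f := by
  induction p with
  | zero =>
    rw [← (Equiv.funUnique (Fin 1) ι).symm.sum_comp]
    refine Finset.sum_congr rfl fun a _ => ?_
    simp [matProd]
  | succ p ih =>
    have key : ∀ F : (Fin (p + 1 + 1) → ι) → Matrix N N S, ∑ f, F f =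
        ∑ f : Fin (p + 1) → ι, ∑ a, F (Fin.snoc (α := fun _ => ι) f a) := fun F => by
      rw [← (Fin.snocEquiv fun _ => ι).sum_comp, Fintype.sum_prod_type, Finset.sum_comm]
      rfl
    rw [matProd_succ, ih, key, Finset.sum_mul]
    refine Finset.sum_congr rfl fun f _ => ?_
    rw [Finset.mul_sum]
    refine Finset.sum_congr rfl fun a _ => ?_
    rw [matProd_succ, Fin.prod_univ_castSucc (n := p + 1)]
    simp only [Fin.snoc_castSucc, Fin.snoc_last, smul_mul_smul_comm]

/-- After multilinear expansion, the sum over `σ` for a fixed index function `f` is a determinant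
with rows selected by `f`. It vanishes when `f` repeats an index, and otherwise equals the sign of
`f` times the determinant of the coefficients. -/
theorem sum_sign_matProd {n : ℕ} (s : Fin (n + 1) → T → S) (m g : Fin (n + 1) → Matrix N N S)
    (Y : Fin (n + 1) → T) :
    ∑ σ : Equiv.Perm (Fin (n + 1)), (Equiv.Perm.sign σ : ℤ) •
      matProd (fun y => ∑ a, s a y • m a) (fun y => ∑ a, s a y • g a) n (fun i => Y (σ i)) =
      (Matrix.of fun a b => s a (Y b)).det •
        ∑ π : Equiv.Perm (Fin (n + 1)), (Equiv.Perm.sign π : ℤ) • matProd m g n π := by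
  simp only [matProd_sum, Finset.smul_sum]
  rw [Finset.sum_comm]
  have h : ∀ f : Fin (n + 1) → Fin (n + 1), ∑ σ : Equiv.Perm (Fin (n + 1)),
      (Equiv.Perm.sign σ : ℤ) • (∏ i, s (f i) (Y (σ i))) • matProd m g n f =
      ((Matrix.of fun a b => s a (Y b)).submatrix f id).det • matProd m g n f := by
    intro f
    rw [← Matrix.det_transpose, Matrix.det_apply, Finset.sum_smul]
    refine Finset.sum_congr rfl fun σ _ => ?_
    rw [smul_assoc, Units.smul_def]
    rfl
  simp only [h]
  rw [sum_fun_eq_sum_perm]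
  · refine Finset.sum_congr rfl fun π _ => ?_
    rw [Matrix.det_permute, mul_comm, mul_smul, ← Int.cast_smul_eq_zsmul S]
  · intro f hf
    rw [Function.Injective] at hf
    push Not at hf
    obtain ⟨i, j, hij, hne⟩ := hf
    rw [Matrix.det_zero_of_row_eq hne (funext fun b => by
      change s (f i) (Y b) = s (f j) (Y b)
      rw [hij]), zero_smul]

end MatProd

/-! ### Matrix-valued formal forms as matrices over power series -/

section Hat

set_option linter.unusedSectionVars false

variable {k : ℕ} {M : Type*} [TopologicalSpace M] [ChartedSpace (EuclideanSpace ℝ (Fin k)) M]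

/-- Evaluation of a formal matrix-valued form on vector fields. -/
def hat {p : ℕ} (A : Formal (MatForm k M p)) (Y : Fin p → CVec k M) :
    Matrix (Fin k) (Fin k) (PowerSeries (Fn k M)) :=
  Matrix.of fun i j => PowerSeries.mk fun n => A n i j Y

theorem factorial_smul_hat_wedge {p : ℕ} (A : Formal (MatForm k M (p + 1)))
    (C : Formal (MatForm k M 1)) (Y : Fin (p + 1 + 1) → CVec k M) :
    (p + 1).factorial • hat (conv wedgeMat A C) Y =
      ∑ σ : Equiv.Perm (Fin (p + 1) ⊕ Fin 1), (Equiv.Perm.sign σ : ℤ) •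
        (hat A (fun i => Y (finSumFinEquiv (σ (Sum.inl i)))) *
          hat C (fun i => Y (finSumFinEquiv (σ (Sum.inr i))))) := by
  refine Matrix.ext fun i j => PowerSeries.ext fun n => ?_
  rw [Matrix.smul_apply, Matrix.sum_apply, map_nsmul, map_sum]
  have h1 : PowerSeries.coeff n (hat (conv wedgeMat A C) Y i j) =
      ∑ q ∈ antidiagonal n, ∑ l, wedge (A q.1 i l) (C q.2 l j) Y := by
    rw [hat, Matrix.of_apply, PowerSeries.coeff_mk, conv, Finset.sum_apply, Finset.sum_apply,
      form_sum_apply]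
    refine Finset.sum_congr rfl fun q _ => ?_
    exact form_sum_apply _ _ _
  have h2 : ∀ σ : Equiv.Perm (Fin (p + 1) ⊕ Fin 1), PowerSeries.coeff n (((Equiv.Perm.sign σ : ℤ) •
        (hat A (fun i => Y (finSumFinEquiv (σ (Sum.inl i)))) *
          hat C (fun i => Y (finSumFinEquiv (σ (Sum.inr i)))))) i j) =
      ∑ q ∈ antidiagonal n, ∑ l, (Equiv.Perm.sign σ : ℤ) •
        (A q.1 i l (fun i => Y (finSumFinEquiv (σ (Sum.inl i)))) *
          C q.2 l j (fun i => Y (finSumFinEquiv (σ (Sum.inr i))))) := by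
    intro σ
    rw [Matrix.smul_apply, map_zsmul, Matrix.mul_apply, map_sum, Finset.sum_comm, Finset.smul_sum]
    refine Finset.sum_congr rfl fun l _ => ?_
    rw [PowerSeries.coeff_mul, Finset.smul_sum]
    simp only [hat, Matrix.of_apply, PowerSeries.coeff_mk]
  simp only [h1, h2]
  rw [Finset.smul_sum, Finset.sum_comm]
  refine Finset.sum_congr rfl fun q _ => ?_
  rw [Finset.smul_sum, Finset.sum_comm]
  refine Finset.sum_congr rfl fun l _ => ?_
  rw [← factorial_smul_wedge, Nat.factorial_one, mul_one]

theorem nsmul_hat_cancel {n : ℕ} (hn : n ≠ 0)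
    {A B : Matrix (Fin k) (Fin k) (PowerSeries (Fn k M))} (h : n • A = n • B) : A = B := by
  refine Matrix.ext fun i j => PowerSeries.ext fun m => ?_
  have h1 := congrArg (fun C : Matrix (Fin k) (Fin k) (PowerSeries (Fn k M)) =>
    PowerSeries.coeff m (C i j)) h
  simp only [Matrix.smul_apply, map_nsmul] at h1
  exact nsmul_fn_cancel hn h1

end Hat

section Cartan

set_option linter.unusedSectionVars false

variable {δ : SpacetimeDim} {M : Type*} [TopologicalSpace M]
  [ChartedSpace (EuclideanSpace ℝ (Fin δ.dim)) M] [IsManifold (𝓡 δ.dim) ∞ M]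
  {γ : GammaMatrices δ}

namespace CartanGeometry

variable (G : CartanGeometry M γ)

/-- In the induction the product of the first factors is already antisymmetrised, so
antisymmetrising over all slots reproduces each term (p+1)! times, by `sum_perm_sum_perm`. This is
the factor in `factorial_smul_hat_wedge`, and it cancels. -/
theorem hat_wedgeConv (A : Formal (MatForm δ.dim M 1)) (p : ℕ) (Y : Fin (p + 1) → CVec δ.dim M) :
    hat (G.wedgeConv A p) Y = ∑ σ : Equiv.Perm (Fin (p + 1)), (Equiv.Perm.sign σ : ℤ) •
      matProd (fun y => hat A fun _ => y) (fun y => hat G.vielbein fun _ => y) p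
        fun i => Y (σ i) := by
  induction p with
  | zero =>
    rw [Finset.sum_eq_single 1 (fun σ _ hσ => absurd (Subsingleton.elim (α := Equiv.Perm (Fin 1)) σ 1) hσ)
      fun h => absurd (Finset.mem_univ _) h]
    simp only [Equiv.Perm.sign_one, Units.val_one, one_smul, matProd,
      Equiv.Perm.one_apply]
    congr 1
    funext i
    rw [Subsingleton.elim (α := Fin 1) i 0]
  | succ p ih =>
    refine nsmul_hat_cancel (p + 1).factorial_ne_zero ?_
    have hf := sum_perm_sum_perm (p := p + 1) fun σ =>
      matProd (fun y => hat A fun _ => y) (fun y => hat G.vielbein fun _ => y) p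
        (fun i => Y (finSumFinEquiv (σ (Sum.inl i)))) *
        hat G.vielbein fun _ => Y (finSumFinEquiv (σ (Sum.inr 0)))
    have hs : ∀ Y : Fin (p + 1 + 1) → CVec δ.dim M,
        ∑ σ : Equiv.Perm (Fin (p + 1 + 1)), (Equiv.Perm.sign σ : ℤ) •
          matProd (fun y => hat A fun _ => y) (fun y => hat G.vielbein fun _ => y) (p + 1)
            (fun i => Y (σ i)) =
        ∑ σ : Equiv.Perm (Fin (p + 1) ⊕ Fin 1), (Equiv.Perm.sign σ : ℤ) •
          (matProd (fun y => hat A fun _ => y) (fun y => hat G.vielbein fun _ => y) p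
            (fun i => Y (finSumFinEquiv (σ (Sum.inl i)))) *
            hat G.vielbein fun _ => Y (finSumFinEquiv (σ (Sum.inr 0)))) := fun Y => by
      rw [← (finSumFinEquiv (m := p + 1) (n := 1)).permCongr.sum_comp]
      simp only [Equiv.Perm.sign_permCongr, matProd_succ, permCongr_castSucc, permCongr_last]
    rw [hs, ← hf]
    refine (factorial_smul_hat_wedge _ _ Y).trans ?_
    refine Finset.sum_congr rfl fun σ _ => congrArg _ ?_
    rw [ih, Finset.sum_mul]
    refine Finset.sum_congr rfl fun ρ _ => ?_
    rw [smul_mul_assoc]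
    congr 3
    funext i
    rw [Subsingleton.elim (α := Fin 1) i 0]
    rfl

end CartanGeometry

end Cartan

end TwistedDirac

end

open scoped Manifold ContDiff TensorProduct Topology

noncomputable section

namespace TwistedDirac

open Finset.HasAntidiagonal

/-! ### Clifford algebra -/

namespace GammaMatrices

theorem anticomm {δ : SpacetimeDim} (γ : GammaMatrices δ) {a b : Fin δ.dim} (h : a ≠ b) :
    γ.gamma a * γ.gamma b = -(γ.gamma b * γ.gamma a) := by
  have h1 := γ.clifford a b
  rw [eta, if_neg h, mul_zero, zero_smul] at h1
  exact eq_neg_of_add_eq_zero_left h1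

theorem mul_up {δ : SpacetimeDim} (γ : GammaMatrices δ) (a : Fin δ.dim) :
    γ.gamma a * γ.up a = 1 := by
  have h := γ.up_mul a
  rw [γ.up_eq] at h ⊢
  rwa [mul_smul_comm, ← smul_mul_assoc]

theorem gamma_sq {δ : SpacetimeDim} (γ : GammaMatrices δ) (a : Fin δ.dim) :
    γ.gamma a * γ.gamma a = eta a a • 1 := by
  have h := γ.clifford a a
  rw [← two_smul ℂ (γ.gamma a * γ.gamma a), mul_smul] at h
  exact smul_right_injective _ (two_ne_zero (α := ℂ)) h

end GammaMatrices

/-- Either the swap affects the last two factors, which anticommute because `f` is injective, or it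
takes place inside the shorter product and the induction hypothesis applies. -/
theorem matProd_swap {R : Type*} {N : Type*} [Fintype N] [CommRing R] {n : ℕ}
    (g : Fin (n + 1) → Matrix N N R) (hg : ∀ a b, a ≠ b → g a * g b = -(g b * g a)) (p : ℕ)
    (f : Fin (p + 1) → Fin (n + 1)) (hf : Function.Injective f) (i : Fin p) :
    matProd g g p (fun j => f (Equiv.swap i.castSucc i.succ j)) = -matProd g g p f := by
  induction p with
  | zero => exact i.elim0
  | succ p ih =>
    refine Fin.lastCases ?_ (fun i => ?_) i
    · have hlast : Equiv.swap (Fin.last p).castSucc (Fin.last p).succ (Fin.last (p + 1)) =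
          (Fin.last p).castSucc := by
        rw [← Fin.succ_last, Equiv.swap_apply_right]
      have hac := hg (f (Fin.last p).castSucc) (f (Fin.last p).succ)
        (hf.ne (Fin.castSucc_lt_succ).ne)
      cases p with
      | zero =>
        change g (f (Equiv.swap _ _ (Fin.last 0).castSucc)) * g (f (Equiv.swap _ _ (Fin.last 1))) =
          -(g (f (Fin.last 0).castSucc) * g (f (Fin.last 0).succ))
        rw [hlast, Equiv.swap_apply_left, hac, neg_neg]
      | succ q =>
        rw [matProd_succ, matProd_succ, matProd_succ g g (q + 1) f, matProd_succ g g q]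
        have hlow : ∀ i : Fin (q + 1), Equiv.swap (Fin.last (q + 1)).castSucc
            (Fin.last (q + 1)).succ i.castSucc.castSucc = i.castSucc.castSucc := fun i => by
          refine Equiv.swap_apply_of_ne_of_ne ?_ ?_
          · exact fun h => (Fin.castSucc_lt_last i).ne (Fin.castSucc_injective _ h)
          · rw [Fin.succ_last]
            exact (Fin.castSucc_lt_last _).ne
        simp only [hlow, hlast, Equiv.swap_apply_left]
        rw [mul_assoc, mul_assoc, ← Fin.succ_last (q + 1), hac, mul_neg, neg_neg]
    · have hlast : Equiv.swap i.castSucc.castSucc i.castSucc.succ (Fin.last (p + 1)) =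
          Fin.last (p + 1) := by
        rw [Fin.succ_castSucc]
        exact Equiv.swap_apply_of_ne_of_ne (Fin.castSucc_lt_last _).ne'
          (Fin.castSucc_lt_last _).ne'
      have hlow : ∀ j : Fin (p + 1), Equiv.swap i.castSucc.castSucc i.castSucc.succ j.castSucc =
          (Equiv.swap i.castSucc i.succ j).castSucc := fun j => by
        rw [Fin.succ_castSucc, (Fin.castSucc_injective (p + 1)).swap_apply]
      rw [matProd_succ, matProd_succ, hlast]
      simp only [hlow]
      rw [ih (fun j => f j.castSucc) (hf.comp (Fin.castSucc_injective _)) i, neg_mul]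

/-- Adjacent transpositions generate the permutation group, and each of them changes the sign of the
permutation as well as that of the product. -/
theorem matProd_perm {R : Type*} {N : Type*} [Fintype N] [CommRing R] {n : ℕ}
    (g : Fin (n + 1) → Matrix N N R) (hg : ∀ a b, a ≠ b → g a * g b = -(g b * g a))
    (π : Equiv.Perm (Fin (n + 1))) :
    (Equiv.Perm.sign π : ℤ) • matProd g g n π = matProd g g n id := by
  have hπ : π ∈ Submonoid.closure (Set.range fun i : Fin n => Equiv.swap i.castSucc i.succ) := by
    rw [Equiv.Perm.mclosure_swap_castSucc_succ]
    trivial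
  induction hπ using Submonoid.closure_induction_right with
  | one => simp
  | mul_right x hx y hy ih =>
    obtain ⟨i, rfl⟩ := hy
    have h := matProd_swap g hg n x x.injective i
    change (Equiv.Perm.sign (x * Equiv.swap i.castSucc i.succ) : ℤ) •
      matProd g g n (fun j => x (Equiv.swap i.castSucc i.succ j)) = _
    rw [h, Equiv.Perm.sign_mul, Equiv.Perm.sign_swap (Fin.castSucc_lt_succ).ne]
    simp [ih]

/-- The product of all gamma matrices. -/
def GammaMatrices.volume {δ : SpacetimeDim} (γ : GammaMatrices δ) :
    Matrix (Fin δ.dim) (Fin δ.dim) ℂ := matProd γ.gamma γ.gamma δ.spatial id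

/-- The scalar `γ_0 ⋯ γ_{D-1} Γ`. -/
def SpacetimeDim.volumeConst : SpacetimeDim → ℂ
  | two => 1
  | four => -Complex.I

/-- The product of all gammas squares to 1 for D = 2 and to -1 for D = 4. The chirality matrix is
this product, with an additional factor i for D = 4. -/
theorem GammaMatrices.volume_mul_chirality {δ : SpacetimeDim} (γ : GammaMatrices δ) :
    γ.volume * γ.chirality = δ.volumeConst • 1 := by
  cases δ with
  | two =>
    have h01 : γ.gamma 1 * γ.gamma 0 = -(γ.gamma 0 * γ.gamma 1) := γ.anticomm (by decide)
    have h0 : γ.gamma 0 * γ.gamma 0 = 1 := γ.gamma_zero_sq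
    have h1 : γ.gamma 1 * γ.gamma 1 = -1 := by
      rw [γ.gamma_sq, eta, if_pos rfl, if_neg (by decide), neg_smul, one_smul]
    change γ.gamma 0 * γ.gamma 1 * (γ.gamma 0 * γ.gamma 1) = (1 : ℂ) • 1
    rw [mul_assoc, ← mul_assoc (γ.gamma 1), h01, neg_mul, mul_assoc, h1, mul_neg_one, neg_neg, h0,
      one_smul]
  | four =>
    have h10 : γ.gamma 1 * γ.gamma 0 = -(γ.gamma 0 * γ.gamma 1) := γ.anticomm (by decide)
    have h20 : γ.gamma 2 * γ.gamma 0 = -(γ.gamma 0 * γ.gamma 2) := γ.anticomm (by decide)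
    have h30 : γ.gamma 3 * γ.gamma 0 = -(γ.gamma 0 * γ.gamma 3) := γ.anticomm (by decide)
    have h21 : γ.gamma 2 * γ.gamma 1 = -(γ.gamma 1 * γ.gamma 2) := γ.anticomm (by decide)
    have h31 : γ.gamma 3 * γ.gamma 1 = -(γ.gamma 1 * γ.gamma 3) := γ.anticomm (by decide)
    have h32 : γ.gamma 3 * γ.gamma 2 = -(γ.gamma 2 * γ.gamma 3) := γ.anticomm (by decide)
    have h0 : γ.gamma 0 * γ.gamma 0 = 1 := γ.gamma_zero_sq
    have hs : ∀ a : Fin (SpacetimeDim.four).dim, a ≠ 0 → γ.gamma a * γ.gamma a = -1 := by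
      intro a ha
      rw [γ.gamma_sq, eta, if_pos rfl, if_neg ha, neg_smul, one_smul]
    change γ.gamma 0 * γ.gamma 1 * γ.gamma 2 * γ.gamma 3 *
      (Complex.I • (γ.gamma 0 * γ.gamma 1 * γ.gamma 2 * γ.gamma 3)) = (-Complex.I) • 1
    have e : γ.gamma 0 * γ.gamma 1 * γ.gamma 2 * γ.gamma 3 *
        (γ.gamma 0 * γ.gamma 1 * γ.gamma 2 * γ.gamma 3) = -1 := by
      have ac : ∀ {x y : Matrix (Fin (SpacetimeDim.four).dim) (Fin (SpacetimeDim.four).dim) ℂ},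
          x * y = -(y * x) → ∀ z, x * (y * z) = -(y * (x * z)) := fun h z => by
        rw [← mul_assoc, h, neg_mul, mul_assoc]
      have sq : ∀ a : Fin (SpacetimeDim.four).dim, a ≠ 0 → ∀ z,
          γ.gamma a * (γ.gamma a * z) = -z := fun a ha z => by
        rw [← mul_assoc, hs a ha, neg_one_mul]
      have sq0 : ∀ z, γ.gamma 0 * (γ.gamma 0 * z) = z := fun z => by rw [← mul_assoc, h0, one_mul]
      simp only [mul_assoc, mul_neg, neg_neg, mul_one, ac h10, ac h20, ac h30, ac h21, ac h31, ac h32,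
        sq0, sq 1 (by decide), hs 3 (by decide)]
      exact hs 2 (by decide)
    rw [mul_smul_comm, e, neg_smul, smul_neg]

end TwistedDirac

end

open scoped Manifold ContDiff TensorProduct Topology

noncomputable section

namespace TwistedDirac

open Finset.HasAntidiagonal

/-! ### Evaluation of the integrands -/

section Constants

variable {k : ℕ} {M : Type*} [TopologicalSpace M] [ChartedSpace (EuclideanSpace ℝ (Fin k)) M]

/-- Constants as power series. -/
def cstHom (k : ℕ) (M : Type*) [TopologicalSpace M] [ChartedSpace (EuclideanSpace ℝ (Fin k)) M] :
    ℂ →+* PowerSeries (Fn k M) :=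
  PowerSeries.C.comp
    { toFun := cst
      map_one' := rfl
      map_mul' := fun _ _ => rfl
      map_zero' := rfl
      map_add' := fun _ _ => rfl }

theorem cstHom_apply (c : ℂ) : cstHom k M c = PowerSeries.C (cst c) := rfl

/-- Constant matrices as matrices of power series. -/
def cmat (k : ℕ) (M : Type*) [TopologicalSpace M] [ChartedSpace (EuclideanSpace ℝ (Fin k)) M] :
    Matrix (Fin k) (Fin k) ℂ →+* Matrix (Fin k) (Fin k) (PowerSeries (Fn k M)) :=
  (cstHom k M).mapMatrix

theorem cmat_apply (Γ : Matrix (Fin k) (Fin k) ℂ) (i j : Fin k) :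
    cmat k M Γ i j = PowerSeries.C (cst (Γ i j)) := rfl

theorem cmat_smul (c : ℂ) (Γ : Matrix (Fin k) (Fin k) ℂ) :
    cmat k M (c • Γ) = cstHom k M c • cmat k M Γ := by
  refine Matrix.ext fun i j => ?_
  change cstHom k M (c * Γ i j) = cstHom k M c * cstHom k M (Γ i j)
  exact map_mul _ _ _

/-- A formal matrix-valued function as a matrix of power series. -/
def matSeries (h : Formal (MatFn k M)) : Matrix (Fin k) (Fin k) (PowerSeries (Fn k M)) :=
  Matrix.of fun i j => PowerSeries.mk fun n => h n i j

theorem coeff_matSeries (h : Formal (MatFn k M)) (n : ℕ) (i j : Fin k) :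
    PowerSeries.coeff n (matSeries h i j) = h n i j := by
  rw [matSeries, Matrix.of_apply, PowerSeries.coeff_mk]

/-- Inserting 1 = γ^a γ_a after the first factor completes the remaining gammas to a full product
that no longer involves `m`. -/
theorem matProd_mul_up {δ : SpacetimeDim} (γ : GammaMatrices δ) {M : Type*} [TopologicalSpace M]
    [ChartedSpace (EuclideanSpace ℝ (Fin δ.dim)) M]
    (m : Fin δ.dim → Matrix (Fin δ.dim) (Fin δ.dim) (PowerSeries (Fn δ.dim M))) (p : ℕ)
    (f : Fin (p + 1) → Fin δ.dim) :
    matProd m (fun a => cmat δ.dim M (γ.gamma a)) p f =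
      m (f 0) * cmat δ.dim M (γ.up (f 0)) * cmat δ.dim M (matProd γ.gamma γ.gamma p f) := by
  induction p with
  | zero =>
    change m (f 0) = m (f 0) * cmat δ.dim M (γ.up (f 0)) * cmat δ.dim M (γ.gamma (f 0))
    rw [mul_assoc, ← map_mul, γ.up_mul, map_one, mul_one]
  | succ p ih =>
    rw [matProd_succ, ih, matProd_succ, map_mul, mul_assoc]
    rfl

end Constants

section Cartan

set_option linter.unusedSectionVars false

variable {δ : SpacetimeDim} {M : Type*} [TopologicalSpace M]
  [ChartedSpace (EuclideanSpace ℝ (Fin δ.dim)) M] [IsManifold (𝓡 δ.dim) ∞ M]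
  {γ : GammaMatrices δ}

namespace CartanGeometry

variable (G : CartanGeometry M γ)

/-- The components of the vielbein as power series. -/
def series (a : Fin δ.dim) (y : CVec δ.dim M) : PowerSeries (Fn δ.dim M) :=
  PowerSeries.mk fun n => contract y (G.V a n)

/-- The determinant of the vielbein relative to the classical one. -/
def det : PowerSeries (Fn δ.dim M) :=
  (Matrix.of fun a b => G.series a (G.coframe₀.basis b)).det

theorem coeff_zero_det : PowerSeries.coeff 0 G.det = 1 := by
  rw [PowerSeries.coeff_zero_eq_constantCoeff_apply, det, RingHom.map_det]
  have : (PowerSeries.constantCoeff (R := Fn δ.dim M)).mapMatrix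
      (Matrix.of fun a b => G.series a (G.coframe₀.basis b)) = 1 := by
    refine Matrix.ext fun a b => ?_
    change PowerSeries.constantCoeff (G.series a (G.coframe₀.basis b)) = _
    rw [series, ← PowerSeries.coeff_zero_eq_constantCoeff_apply, PowerSeries.coeff_mk]
    refine (G.coframe₀.contract_basis b a).trans ?_
    rw [Matrix.one_apply]
    simp only [eq_comm]
  rw [this, Matrix.det_one]

theorem hat_vielbein (y : CVec δ.dim M) :
    hat G.vielbein (fun _ => y) = ∑ a, G.series a y • cmat δ.dim M (γ.gamma a) := by
  refine Matrix.ext fun i j => PowerSeries.ext fun n => ?_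
  rw [Matrix.sum_apply, map_sum, hat, Matrix.of_apply, PowerSeries.coeff_mk]
  change (∑ a, (cst (γ.gamma a i j) : Fn δ.dim M) • G.V a n) (fun _ => y) = _
  rw [form_sum_apply]
  refine Finset.sum_congr rfl fun a _ => ?_
  rw [Matrix.smul_apply, smul_eq_mul, cmat_apply, PowerSeries.coeff_mul_C, series,
    PowerSeries.coeff_mk, mul_comm]
  rfl

theorem hat_mulMatForm (h : Formal (MatFn δ.dim M)) (y : CVec δ.dim M) :
    hat (conv mulMatForm h G.vielbein) (fun _ => y) =
      ∑ a, G.series a y • (matSeries h * cmat δ.dim M (γ.gamma a)) := by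
  have e : hat (conv mulMatForm h G.vielbein) (fun _ => y) =
      matSeries h * hat G.vielbein (fun _ => y) := by
    refine Matrix.ext fun i j => PowerSeries.ext fun n => ?_
    rw [Matrix.mul_apply, map_sum, hat, Matrix.of_apply, PowerSeries.coeff_mk, conv,
      Finset.sum_apply, Finset.sum_apply, form_sum_apply]
    simp only [PowerSeries.coeff_mul]
    rw [Finset.sum_comm]
    refine Finset.sum_congr rfl fun q _ => (form_sum_apply _ _ _).trans ?_
    refine Finset.sum_congr rfl fun l _ => ?_
    rw [coeff_matSeries, hat, Matrix.of_apply, PowerSeries.coeff_mk]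
    rfl
  rw [e, hat_vielbein, Finset.mul_sum]
  simp only [mul_smul_comm]

theorem hat_formMat (h : Fin δ.dim → Formal (MatFn δ.dim M)) (y : CVec δ.dim M) :
    hat (∑ a, conv formMat (G.V a) (h a)) (fun _ => y) =
      ∑ a, G.series a y • matSeries (h a) := by
  refine Matrix.ext fun i j => PowerSeries.ext fun n => ?_
  rw [Matrix.sum_apply, map_sum, hat, Matrix.of_apply, PowerSeries.coeff_mk, Finset.sum_apply,
    Finset.sum_apply, Finset.sum_apply, form_sum_apply]
  refine Finset.sum_congr rfl fun a _ => ?_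
  rw [Matrix.smul_apply, smul_eq_mul, PowerSeries.coeff_mul, conv, Finset.sum_apply,
    Finset.sum_apply, form_sum_apply]
  refine Finset.sum_congr rfl fun q _ => ?_
  rw [coeff_matSeries, series, PowerSeries.coeff_mk, mul_comm]
  rfl

/-- The value of `A ∧ V ∧ ⋯ ∧ V` on the classical frame. -/
theorem hat_wedgeConv_basis (A : Formal (MatForm δ.dim M 1))
    (m : Fin δ.dim → Matrix (Fin δ.dim) (Fin δ.dim) (PowerSeries (Fn δ.dim M)))
    (hA : ∀ y, hat A (fun _ => y) = ∑ a, G.series a y • m a) :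
    hat (G.wedgeConv A δ.spatial) G.coframe₀.basis =
      G.det • (δ.spatial.factorial • ∑ a, m a * cmat δ.dim M (γ.up a)) *
        cmat δ.dim M γ.volume := by
  have hv : (fun y => hat A fun _ => y) = fun y => ∑ a, G.series a y • m a := funext hA
  have hg : (fun y => hat G.vielbein fun _ => y) =
      fun y => ∑ a, G.series a y • cmat δ.dim M (γ.gamma a) := funext G.hat_vielbein
  rw [hat_wedgeConv, hv, hg]
  refine (sum_sign_matProd G.series m (fun a => cmat δ.dim M (γ.gamma a))
    G.coframe₀.basis).trans ?_
  rw [smul_mul_assoc, det, ← sum_perm_fin_zero, Finset.sum_mul]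
  congr 1
  refine Finset.sum_congr rfl fun π _ => ?_
  -- With its sign, every ordering of the gammas equals the volume product. A term then depends on
  -- `π` only through `π 0`, and each value is attained (D-1)! times.
  rw [matProd_mul_up, ← mul_smul_comm, ← map_zsmul, matProd_perm _ fun a b => γ.anticomm]
  rfl

/-- The volume product meets the chirality matrix in a scalar, so only the trace of ∑ m_a γ^a and
the determinant of the vielbein remain. -/
theorem traceMul_wedgeConv (A : Formal (MatForm δ.dim M 1))
    (m : Fin δ.dim → Matrix (Fin δ.dim) (Fin δ.dim) (PowerSeries (Fn δ.dim M)))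
    (hA : ∀ y, hat A (fun _ => y) = ∑ a, G.series a y • m a) (n : ℕ) :
    traceMul (G.wedgeConv A δ.spatial n) γ.chirality G.coframe₀.basis =
      cst (δ.spatial.factorial * δ.volumeConst) *
        PowerSeries.coeff n (G.det * (∑ a, m a * cmat δ.dim M (γ.up a)).trace) := by
  have h1 : traceMul (G.wedgeConv A δ.spatial n) γ.chirality G.coframe₀.basis =
      PowerSeries.coeff n (hat (G.wedgeConv A δ.spatial) G.coframe₀.basis *
        cmat δ.dim M γ.chirality).trace := by
    rw [Matrix.trace, map_sum, traceMul, form_sum_apply]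
    refine Finset.sum_congr rfl fun i _ => ?_
    rw [Matrix.diag_apply, Matrix.mul_apply, map_sum, form_sum_apply]
    refine Finset.sum_congr rfl fun l _ => ?_
    rw [cmat_apply, PowerSeries.coeff_mul_C, mul_comm, hat, Matrix.of_apply, PowerSeries.coeff_mk]
    rfl
  rw [h1, G.hat_wedgeConv_basis A m hA, mul_assoc, ← map_mul, γ.volume_mul_chirality, cmat_smul,
    map_one, mul_smul_comm, mul_one, ← Nat.cast_smul_eq_nsmul (PowerSeries (Fn δ.dim M)),
    Matrix.trace_smul, Matrix.trace_smul, Matrix.trace_smul, smul_eq_mul, smul_eq_mul, smul_eq_mul]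
  have h2 : ((δ.spatial.factorial : ℕ) : PowerSeries (Fn δ.dim M)) =
      cstHom δ.dim M (δ.spatial.factorial : ℂ) := (map_natCast _ _).symm
  rw [h2, mul_left_comm G.det, ← mul_assoc, ← map_mul, cstHom_apply, PowerSeries.coeff_C_mul,
    mul_comm δ.volumeConst]

variable [T2Space M] [SigmaCompactSpace M]

/-- The constant relating the inner product to the integral over `M`. -/
def _root_.TwistedDirac.SpacetimeDim.totalConst (δ : SpacetimeDim) : ℂ :=
  δ.innerConst * (δ.spatial.factorial * δ.volumeConst) * δ.dim

theorem _root_.TwistedDirac.SpacetimeDim.totalConst_ne_zero (δ : SpacetimeDim) :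
    δ.totalConst ≠ 0 := by
  cases δ <;>
    simp [SpacetimeDim.totalConst, SpacetimeDim.innerConst, SpacetimeDim.volumeConst,
      SpacetimeDim.dim, SpacetimeDim.spatial, Nat.factorial]

/-- The normalisations of the two pairings are matched: D compensates γ_a γ^a = D in the inner
product, and i compensates the i in the Dirac operator. -/
theorem _root_.TwistedDirac.SpacetimeDim.actionConst_eq (δ : SpacetimeDim) :
    δ.actionConst = δ.innerConst * δ.dim * Complex.I := by
  cases δ
  · simp [SpacetimeDim.actionConst, SpacetimeDim.innerConst, SpacetimeDim.dim,
      SpacetimeDim.spatial]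
  · simp [SpacetimeDim.actionConst, SpacetimeDim.innerConst, SpacetimeDim.dim,
      SpacetimeDim.spatial]
    rw [mul_right_comm, Complex.I_mul_I]
    norm_num

theorem hasCompactSupport_coeff (h : Formal (MatFn δ.dim M)) (hh : ∀ n, CptMat (h n)) (n : ℕ)
    (m : Matrix (Fin δ.dim) (Fin δ.dim) ℂ) :
    HasCompactSupport
      (PowerSeries.coeff n (G.det * (matSeries h * cmat δ.dim M m).trace) : Fn δ.dim M) := by
  choose K hK hhK using hh
  refine HasCompactSupport.intro ((Finset.range (n + 1)).isCompact_biUnion fun i _ => hK i)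
    fun x hx => ?_
  rw [PowerSeries.coeff_mul, sumFn_apply]
  refine Finset.sum_eq_zero fun q hq => ?_
  have hq' : q.2 ∈ Finset.range (n + 1) := by
    rw [Finset.mem_range]
    have := mem_antidiagonal.1 hq
    omega
  have hxK : x ∉ K q.2 := fun h => hx (Set.mem_biUnion hq' h)
  change _ * (PowerSeries.coeff q.2 (matSeries h * cmat δ.dim M m).trace : Fn δ.dim M) x = 0
  rw [Matrix.trace, map_sum, sumFn_apply, Finset.sum_eq_zero, mul_zero]
  intro i _
  rw [Matrix.diag_apply, Matrix.mul_apply, map_sum, sumFn_apply]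
  refine Finset.sum_eq_zero fun l _ => ?_
  rw [cmat_apply, PowerSeries.coeff_mul_C, coeff_matSeries]
  change h q.2 i l x * _ = 0
  rw [hhK q.2 i l x hxK, zero_mul]

variable {F : AbelianTwist δ.dim M}

/-- The inner product as an integral over `M`. -/
theorem inner_eq_volInt (hF : G.IsSemiKilling F) {ψ₁ ψ₂ : Formal (Spinor δ.dim M)}
    (h₁ : ∀ n, CptSpinor (ψ₁ n)) (n : ℕ) :
    G.inner F ψ₁ ψ₂ n = δ.totalConst * G.coframe₀.volInt (PowerSeries.coeff n (G.det *
      (matSeries (F.star lieSpinor lieSpinor outer ψ₂ (diracAdjoint γ ψ₁))).trace)) := by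
  set h := F.star lieSpinor lieSpinor outer ψ₂ (diracAdjoint γ ψ₁) with hh
  have hc := CptSpinor.star_outer F ψ₂ fun n => CptSpinor.diracAdjoint (γ := γ) (h₁ n)
  have hcs := G.hasCompactSupport_coeff h hc n 1
  rw [map_one, mul_one] at hcs
  rw [G.inner_eq hF h₁]
  change δ.innerConst * integral G.coframe₀.e _ = _
  rw [G.coframe₀.integral_eq_volInt, G.traceMul_wedgeConv _ _ (G.hat_mulMatForm h)]
  -- Here m_a = h γ_a, and the sum over `a` of γ_a γ^a is D.
  have h1 : ∑ a, matSeries h * cmat δ.dim M (γ.gamma a) * cmat δ.dim M (γ.up a) =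
      cstHom δ.dim M δ.dim • matSeries h := by
    simp only [mul_assoc, ← map_mul, γ.mul_up, map_one, mul_one]
    rw [Finset.sum_const, Finset.card_univ, Fintype.card_fin, map_natCast, Nat.cast_smul_eq_nsmul]
  rw [h1, Matrix.trace_smul, smul_eq_mul, mul_left_comm, cstHom_apply, PowerSeries.coeff_C_mul,
    ← mul_assoc, cst_mul_cst, G.coframe₀.volInt_cst_mul _ _ hcs, SpacetimeDim.totalConst]
  ring

end CartanGeometry

end Cartan

end TwistedDirac

end

open scoped Manifold ContDiff TensorProduct Topology

noncomputable section

namespace TwistedDirac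

open Finset.HasAntidiagonal

/-! ### The Aschieri–Castellani Dirac operator -/

section Constants

set_option linter.unusedSectionVars false

variable {k : ℕ} {M : Type*} [TopologicalSpace M] [ChartedSpace (EuclideanSpace ℝ (Fin k)) M]

theorem isBil_outer : IsBil k M (outer (k := k) (M := M)) where
  add_left u u' w := funext fun i => funext fun j => add_mul (u i) (u' i) (w j)
  add_right u w w' := funext fun i => funext fun j => mul_add (u i) (w j) (w' j)
  smul_left c u w := funext fun i => funext fun j => mul_assoc (cst c) (u i) (w j)
  smul_right c u w := funext fun i => funext fun j => mul_left_comm (u i) (cst c) (w j)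

/-- Left multiplication of matrix-valued functions with a constant matrix. -/
def constLeft (Γ : Matrix (Fin k) (Fin k) ℂ) : MatFn k M →+ MatFn k M :=
  AddMonoidHom.mk' (fun A i j => ∑ l, cst (Γ i l) * A l j) fun A C =>
    funext fun i => funext fun j => by
      simp only [Pi.add_apply, mul_add, Finset.sum_add_distrib]

theorem matSeries_constLeft (Γ : Matrix (Fin k) (Fin k) ℂ) (h : Formal (MatFn k M)) :
    matSeries (fun n => constLeft Γ (h n)) = cmat k M Γ * matSeries h := by
  refine Matrix.ext fun i j => PowerSeries.ext fun n => ?_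
  rw [coeff_matSeries, Matrix.mul_apply, map_sum]
  change ∑ l, cst (Γ i l) * h n l j = _
  refine Finset.sum_congr rfl fun l _ => ?_
  rw [cmat_apply, PowerSeries.coeff_C_mul, coeff_matSeries]

theorem matSeries_sum {ι : Type*} (s : Finset ι) (h : ι → Formal (MatFn k M)) :
    matSeries (∑ a ∈ s, h a) = ∑ a ∈ s, matSeries (h a) := by
  refine Matrix.ext fun i j => PowerSeries.ext fun n => ?_
  rw [coeff_matSeries, Matrix.sum_apply, map_sum, Finset.sum_apply, Finset.sum_apply,
    Finset.sum_apply]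
  exact Finset.sum_congr rfl fun a _ => (coeff_matSeries _ _ _ _).symm

theorem matSeries_add (h h' : Formal (MatFn k M)) :
    matSeries (h + h') = matSeries h + matSeries h' := by
  refine Matrix.ext fun i j => PowerSeries.ext fun n => ?_
  rw [coeff_matSeries, Matrix.add_apply, map_add, coeff_matSeries, coeff_matSeries]
  rfl

variable [IsManifold (𝓡 k) ∞ M] (F : AbelianTwist k M)

theorem matSeries_star_constMul (Γ : Matrix (Fin k) (Fin k) ℂ) (f g : Formal (Spinor k M)) :
    matSeries (F.star lieSpinor lieSpinor outer (fun n => constMul Γ (f n)) g) =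
      cmat k M Γ * matSeries (F.star lieSpinor lieSpinor outer f g) := by
  rw [← matSeries_constLeft]
  congr 1
  funext n
  refine (F.map_star (constMul Γ) id (constLeft Γ) (fun c A => ?_)
    (fun X u => (lieSpinor_constMul _ _ _).symm) (fun X w => rfl) (fun u w => ?_) f g n).symm
  · refine funext fun i => funext fun j => ?_
    change ∑ l, cst (Γ i l) * (cst c * A l j) = cst c * ∑ l, cst (Γ i l) * A l j
    rw [Finset.mul_sum]
    exact Finset.sum_congr rfl fun l _ => mul_left_comm _ _ _
  · refine funext fun i => funext fun j => ?_
    change ∑ l, cst (Γ i l) * (u l * w j) = (∑ l, cst (Γ i l) * u l) * w j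
    rw [Finset.sum_mul]
    exact Finset.sum_congr rfl fun l _ => (mul_assoc _ _ _).symm

theorem exists_bump [T2Space M] (x : M) :
    ∃ b : ContMDiffMap (𝓡 k) 𝓘(ℝ, ℝ) M ℝ ∞, HasCompactSupport b ∧ (∀ y, 0 ≤ b y) ∧ b x = 1 := by
  obtain ⟨f⟩ : Nonempty (SmoothBumpFunction (𝓡 k) x) := inferInstance
  exact ⟨⟨f, f.contMDiff⟩, f.hasCompactSupport, fun y => f.nonneg, f.eq_one⟩

end Constants

section Cartan

set_option linter.unusedSectionVars false

variable {δ : SpacetimeDim} {M : Type*} [TopologicalSpace M]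
  [ChartedSpace (EuclideanSpace ℝ (Fin δ.dim)) M] [IsManifold (𝓡 δ.dim) ∞ M]
  {γ : GammaMatrices δ}

namespace CartanGeometry

variable (G : CartanGeometry M γ) {F : AbelianTwist δ.dim M}

/-- Cyclicity of the trace brings γ^a to the left of the outer product, where it combines with the
contraction to the Dirac operator up to the factor i. -/
theorem trace_matSeries_contrDirac (E : Fin δ.dim → Formal (CVec δ.dim M))
    (ψ χ : Formal (Spinor δ.dim M)) :
    (∑ a, matSeries (F.star lieSpinor lieSpinor outer
        (F.star lieVec lieSpinorForm contractSpinor (E a) (G.covDiff F ψ)) χ) *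
        cmat δ.dim M (γ.up a)).trace =
      cstHom δ.dim M (-Complex.I) *
        (matSeries (F.star lieSpinor lieSpinor outer (G.contrDirac F E ψ) χ)).trace := by
  have h1 : G.contrDirac F E ψ = ∑ a, fun n => constMul (Complex.I • γ.up a)
      (F.star lieVec lieSpinorForm contractSpinor (E a) (G.covDiff F ψ) n) := by
    funext n
    rw [Finset.sum_apply]
    rfl
  rw [h1, F.star_sum_left _ isAct_lieSpinor isAct_lieSpinor isBil_outer, matSeries_sum,
    Matrix.trace_sum, Matrix.trace_sum, Finset.mul_sum]
  refine Finset.sum_congr rfl fun a _ => ?_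
  rw [matSeries_star_constMul, cmat_smul, smul_mul_assoc, Matrix.trace_smul, smul_eq_mul,
    ← mul_assoc, ← map_mul, neg_mul, Complex.I_mul_I, neg_neg, map_one, one_mul,
    Matrix.trace_mul_comm]

/-- Since γ₀² = 1, the γ₀ in the Dirac adjoint is undone by a second one; the witness contains it
conjugated because the adjoint conjugates again. -/
theorem exists_diracAdjoint_eq [T2Space M] (d : Spinor δ.dim M) (b : ContMDiffMap (𝓡 δ.dim) 𝓘(ℝ, ℝ) M ℝ ∞)
    (hb : HasCompactSupport b) : ∃ ψ : Formal (Spinor δ.dim M),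
      (∀ n i, HasCompactSupport (ψ n i)) ∧
        diracAdjoint γ ψ 0 = fun j => ofRealFn b * conjFn (d j) := by
  refine ⟨Formal.const fun i => ofRealFn b *
    ∑ l, d l * cst ((starRingEnd ℂ) (γ.gamma 0 l i)), fun n i => ?_, funext fun j => ?_⟩
  · rw [Formal.const]
    split_ifs
    · refine HasCompactSupport.intro (K := tsupport b) hb fun x hx => ?_
      change (b x : ℂ) * _ = 0
      rw [image_eq_zero_of_notMem_tsupport hx, Complex.ofReal_zero, zero_mul]
    · exact HasCompactSupport.zero
  · ext x
    rw [diracAdjoint, sumFn_apply]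
    change ∑ i, (starRingEnd ℂ) ((b x : ℂ) *
      (∑ l, d l * cst ((starRingEnd ℂ) (γ.gamma 0 l i)) : Fn δ.dim M) x) * γ.gamma 0 i j =
        (b x : ℂ) * (starRingEnd ℂ) (d j x)
    have h (l : Fin δ.dim) : ∑ i, γ.gamma 0 l i * γ.gamma 0 i j =
        (1 : Matrix (Fin δ.dim) (Fin δ.dim) ℂ) l j := by
      rw [← γ.gamma_zero_sq, Matrix.mul_apply]
    calc _ = ∑ i, ∑ l, (b x : ℂ) * (starRingEnd ℂ) (d l x) *
          (γ.gamma 0 l i * γ.gamma 0 i j) := by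
          refine Finset.sum_congr rfl fun i _ => ?_
          rw [sumFn_apply, Finset.mul_sum, map_sum, Finset.sum_mul]
          refine Finset.sum_congr rfl fun l _ => ?_
          change (starRingEnd ℂ) ((b x : ℂ) * (d l x * (starRingEnd ℂ) (γ.gamma 0 l i))) * _ = _
          rw [map_mul, map_mul, Complex.conj_ofReal, Complex.conj_conj]
          ring
      _ = ∑ l, (b x : ℂ) * (starRingEnd ℂ) (d l x) *
          (1 : Matrix (Fin δ.dim) (Fin δ.dim) ℂ) l j := by
          rw [Finset.sum_comm]
          refine Finset.sum_congr rfl fun l _ => ?_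
          rw [← Finset.mul_sum, h]
      _ = _ := by
          rw [Finset.sum_eq_single j, Matrix.one_apply_eq, mul_one]
          · intro l _ hl
            rw [Matrix.one_apply_ne hl, mul_zero]
          · exact fun hj => (hj (Finset.mem_univ _)).elim

/-- The lowest order of the inner product density. -/
theorem coeff_det_mul_trace {d : Formal (Spinor δ.dim M)} (w : Formal (Spinor δ.dim M)) {n : ℕ}
    (hd : ∀ m < n, d m = 0) :
    PowerSeries.coeff n (G.det *
      (matSeries (F.star lieSpinor lieSpinor outer d w)).trace) = ∑ i, d n i * w 0 i := by
  rw [PowerSeries.coeff_mul, Finset.sum_eq_single (0, n)]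
  · rw [coeff_zero_det, one_mul, Matrix.trace, map_sum]
    refine Finset.sum_congr rfl fun i _ => ?_
    rw [Matrix.diag_apply, coeff_matSeries,
      F.star_leading_left isAct_lieSpinor isAct_lieSpinor isBil_outer w hd]
    rfl
  · rintro ⟨p, q⟩ hpq hne
    have hq : q < n := by
      have h1 : p + q = n := mem_antidiagonal.1 hpq
      rcases Nat.eq_zero_or_pos p with rfl | hp
      · exact (hne (by rw [← h1, zero_add])).elim
      · omega
    rw [Matrix.trace, map_sum, Finset.sum_eq_zero, mul_zero]
    intro i _
    rw [Matrix.diag_apply, coeff_matSeries,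
      F.star_leading_left isAct_lieSpinor isAct_lieSpinor isBil_outer w
        fun m hm => hd m (hm.trans hq), hd q hq]
    exact zero_mul _
  · exact fun h => (h (by rw [mem_antidiagonal, zero_add])).elim

variable [T2Space M] [SigmaCompactSpace M]

theorem hasCompactSupport_coeff_star (ψ : Formal (Spinor δ.dim M))
    {ψ₁ : Formal (Spinor δ.dim M)} (h₁ : ∀ n, CptSpinor (ψ₁ n)) (n : ℕ) :
    HasCompactSupport (PowerSeries.coeff n (G.det * (matSeries
      (F.star lieSpinor lieSpinor outer ψ (diracAdjoint γ ψ₁))).trace) : Fn δ.dim M) := by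
  have := G.hasCompactSupport_coeff _ (CptSpinor.star_outer F ψ fun n =>
    CptSpinor.diracAdjoint (γ := γ) (h₁ n)) n 1
  rwa [map_one, mul_one] at this

theorem inner_add_right (hF : G.IsSemiKilling F) {ψ₁ : Formal (Spinor δ.dim M)}
    (h₁ : ∀ n, CptSpinor (ψ₁ n)) (χ χ' : Formal (Spinor δ.dim M)) :
    G.inner F ψ₁ (χ + χ') = G.inner F ψ₁ χ + G.inner F ψ₁ χ' := by
  funext n
  rw [Pi.add_apply, G.inner_eq_volInt hF h₁, G.inner_eq_volInt hF h₁, G.inner_eq_volInt hF h₁,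
    F.star_add_left isAct_lieSpinor isAct_lieSpinor isBil_outer, matSeries_add, Matrix.trace_add,
    mul_add, map_add, G.coframe₀.volInt_add _ _ (G.hasCompactSupport_coeff_star _ h₁ _)
      (G.hasCompactSupport_coeff_star _ h₁ _), mul_add]

/-- The inner product is nondegenerate. -/
theorem eq_zero_of_inner_eq_zero (hF : G.IsSemiKilling F) (d : Formal (Spinor δ.dim M))
    (h : ∀ ψ₁ : Formal (Spinor δ.dim M), (∀ n i, HasCompactSupport (ψ₁ n i)) →
      G.inner F ψ₁ d = 0) : d = 0 := by
  funext n
  induction n using Nat.strong_induction_on with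
  | _ n ih =>
    by_contra hne
    obtain ⟨j, hj⟩ := Function.ne_iff.1 hne
    obtain ⟨x, hx⟩ : ∃ x, d n j x ≠ 0 := by
      by_contra! hx
      exact hj (ContMDiffMap.ext hx)
    -- By induction `d` starts at order `n`. With ψ₁ such that its adjoint at order zero is b times
    -- the conjugate of d_n, the coefficient of order n of the inner product is a nonzero constant
    -- times ∫ b |d_n|².
    obtain ⟨b, hb, hb0, hbx⟩ := exists_bump (k := δ.dim) x
    obtain ⟨ψ₁, hψ, hadj⟩ := exists_diracAdjoint_eq (γ := γ) (d n) b hb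
    have h₁ : ∀ n, CptSpinor (ψ₁ n) := fun n => CptSpinor.of_hasCompactSupport (hψ n)
    have hc := G.hasCompactSupport_coeff_star (F := F) d h₁ n
    have h0 := congrFun (h ψ₁ hψ) n
    rw [G.inner_eq_volInt hF h₁, Pi.zero_apply] at h0
    have h0' := (mul_eq_zero.1 h0).resolve_left δ.totalConst_ne_zero
    rw [G.coeff_det_mul_trace _ ih, hadj] at h0' hc
    have hval : ∀ y, (∑ i, d n i * (ofRealFn b * conjFn (d n i)) : Fn δ.dim M) y =
        ((b y * ∑ i, Complex.normSq (d n i y) : ℝ) : ℂ) := fun y => by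
      rw [sumFn_apply, Complex.ofReal_mul, Complex.ofReal_sum, Finset.mul_sum]
      refine Finset.sum_congr rfl fun i _ => ?_
      rw [Complex.normSq_eq_conj_mul_self]
      change d n i y * ((b y : ℂ) * (starRingEnd ℂ) (d n i y)) = _
      ring
    have h2 := G.coframe₀.eq_zero_of_volInt_eq_zero _ hc (fun y => by
      rw [hval, Complex.ofReal_re]
      exact mul_nonneg (hb0 y) (Finset.sum_nonneg fun i _ => Complex.normSq_nonneg _))
      (fun y => by rw [hval, Complex.ofReal_im]) h0'
    have h3 := hval x
    rw [h2, hbx, one_mul] at h3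
    have h4 : ∑ i, Complex.normSq (d n i x) = 0 := (Complex.ofReal_eq_zero.1 h3.symm)
    exact hx (Complex.normSq_eq_zero.1 ((Finset.sum_eq_zero_iff_of_nonneg fun i _ =>
      Complex.normSq_nonneg _).1 h4 j (Finset.mem_univ j)))

theorem eq_of_inner_eq (hF : G.IsSemiKilling F) {χ χ' : Formal (Spinor δ.dim M)}
    (h : ∀ ψ₁ : Formal (Spinor δ.dim M), (∀ n i, HasCompactSupport (ψ₁ n i)) →
      G.inner F ψ₁ χ = G.inner F ψ₁ χ') : χ = χ' := by
  refine sub_eq_zero.1 (G.eq_zero_of_inner_eq_zero hF (χ - χ') fun ψ₁ hψ => ?_)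
  have h1 := G.inner_add_right hF (fun n => CptSpinor.of_hasCompactSupport (hψ n)) (χ - χ') χ'
  rw [sub_add_cancel, h ψ₁ hψ] at h1
  exact left_eq_add.1 (h1.trans (add_comm _ _))

/-- The contraction Dirac operator is the Aschieri–Castellani Dirac operator. -/
theorem isACDirac_contrDirac {E : Fin δ.dim → Formal (CVec δ.dim M)} (hF : G.IsSemiKilling F)
    (hE : G.IsInverse E) : G.IsACDirac F (G.contrDirac F E) := by
  intro ψ₂ ψ₁ hψ
  have h₁ : ∀ n, CptSpinor (ψ₁ n) := fun n => CptSpinor.of_hasCompactSupport (hψ n)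
  funext n
  rw [G.inner_eq_volInt hF h₁, G.action_eq hF hE h₁]
  change _ = δ.actionConst * integral G.coframe₀.e _
  have hcs := G.hasCompactSupport_coeff_star (F := F) (G.contrDirac F E ψ₂) h₁ n
  rw [G.coframe₀.integral_eq_volInt, G.traceMul_wedgeConv _ _ (G.hat_formMat _),
    trace_matSeries_contrDirac, mul_left_comm, cstHom_apply, PowerSeries.coeff_C_mul,
    ← mul_assoc, cst_mul_cst, G.coframe₀.volInt_cst_mul _ _ hcs, δ.actionConst_eq,
    SpacetimeDim.totalConst]
  -- The factor i comes from the action constant, the factor -i from `trace_matSeries_contrDirac`.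
  have hI : Complex.I * -Complex.I = 1 := by rw [mul_neg, Complex.I_mul_I, neg_neg]
  linear_combination (-(δ.innerConst * δ.dim * (δ.spatial.factorial * δ.volumeConst) *
    G.coframe₀.volInt (PowerSeries.coeff n (G.det * (matSeries (F.star lieSpinor lieSpinor outer
      (G.contrDirac F E ψ₂) (diracAdjoint γ ψ₁))).trace)))) * hI

end CartanGeometry

end Cartan

end TwistedDirac

end

theorem mainTheorem5 (δ : SpacetimeDim) {M : Type*} [TopologicalSpace M]
    [ChartedSpace (EuclideanSpace ℝ (Fin δ.dim)) M] [IsManifold (𝓡 δ.dim) ∞ M]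
    [T2Space M] [SigmaCompactSpace M]
    (γ : GammaMatrices δ) (F : AbelianTwist δ.dim M) (G : CartanGeometry M γ)
    (hF : G.IsSemiKilling F) :
    (∃! E : Fin δ.dim → Formal (CVec δ.dim M), G.IsInverse E) ∧
    (∃! E' : Fin δ.dim → Formal (CVec δ.dim M), G.IsStarInverse F E') ∧
    (∃! D : Formal (Spinor δ.dim M) → Formal (Spinor δ.dim M), G.IsACDirac F D) ∧
    ∀ (E E' : Fin δ.dim → Formal (CVec δ.dim M))
      (D : Formal (Spinor δ.dim M) → Formal (Spinor δ.dim M)),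
      G.IsInverse E → G.IsStarInverse F E' → G.IsACDirac F D →
        D = G.contrDirac F E' ∧
        D = G.deformedDirac F E ∧
        (G.IsKilling F → D = G.classicalDirac E) := by
  have hinv : ∃! E : Fin δ.dim → Formal (CVec δ.dim M), G.IsInverse E := by
    simpa only [G.isInverse_iff] using G.existsUnique_isStarInverse (AbelianTwist.trivial δ.dim M)
  have huniq : ∀ D D' : Formal (Spinor δ.dim M) → Formal (Spinor δ.dim M),
      G.IsACDirac F D → G.IsACDirac F D' → D = D' := fun D D' h h' => funext fun ψ₂ =>
    G.eq_of_inner_eq hF fun ψ₁ hψ => (h ψ₂ ψ₁ hψ).trans (h' ψ₂ ψ₁ hψ).symm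
  refine ⟨hinv, G.existsUnique_isStarInverse F, ?_, fun E E' D hE hE' hD => ?_⟩
  · obtain ⟨E, hE, -⟩ := hinv
    exact ⟨_, G.isACDirac_contrDirac hF hE, fun D hD =>
      huniq _ _ hD (G.isACDirac_contrDirac hF hE)⟩
  -- The classical inverse is itself a star inverse, so uniqueness makes the two vielbeins equal.
  · have hEE : E' = E := (G.existsUnique_isStarInverse F).unique hE' (hE.isStarInverse F hF)
    have hDc : D = G.contrDirac F E := huniq _ _ hD (G.isACDirac_contrDirac hF hE)
    have hDd : D = G.deformedDirac F E :=
      hDc.trans (CartanGeometry.contrDirac_eq_deformedDirac hE hF)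
    rw [hEE]
    exact ⟨hDc, hDd, fun hK => hDd.trans (CartanGeometry.deformedDirac_eq_classicalDirac hE hK)⟩
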